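/- Let $\Bbbk=\mathbb{C}$, let $n\ge 2$, $q=e^{2\pi \mathrm{i}/n}$ and $p=-e^{\pi \mathrm{i}/n}$ (so $p^2=q$). Let $H_{2n^2}$ be Pansera's Hopf algebra: the $\Bbbk$-algebra generated by $x,y,z$ with relations $$x^n=y^n=1,\quad xy=yx,\quad zx=yz,\quad zy=xz,\quad z^2=\frac1n\sum_{r,s=0}^{n-1}q^{-rs}x^ry^s,$$ in which $x,y$ are grouplike, $\Delta(z)=J(z\otimes z)$ with $J=\frac1n\sum_{r,s=0}^{n-1}q^{-rs}x^r\otimes y^s$, $\epsilon(z)=1$ and $S(z)=z$. Let $i,j\in\mathbb{Z}$ with $\gcd(i^2-j^2,n)=1$ and let $$A^-=\Bbbk\langle u,v\rangle/(p^{i^2-j^2}uv-vu),$$ graded with $u,v$ in degree $1$. Then $A^-$ is Artin–Schelter regular of dimension $2$, and there is exactly one $H_{2n^2}$-module algebra structure on $A^-$ that is the representation $\pi_{i,j}$ on $\Bbbk u\oplus\Bbbk v$, i.e. $$xu=q^iu,\quad xv=q^jv,\quad yu=q^ju,\quad yv=q^iv,\quad zu=q^{ij}v,\quad zv=u.$$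 For this action the fixed ring $(A^-)^{H_{2n^2}}=\{a: ha=\epsilon(h)a \text{ for all } h\in H_{2n^2}\}$ is a commutative polynomial ring in two algebraically independent generators, namely $$(A^-)^{H_{2n^2}}=\begin{cases}\Bbbk[u^n+v^n,\;u^nv^n] & n \text{ odd},\\ \Bbbk[u^n+(-1)^{ij}v^n,\;u^nv^n] & n\text{ even}.\end{cases}$$ Moreover $H_{2n^2}$ is a reflection Hopf algebra for $A^-$: $H_{2n^2}$ is a finite-dimensional semisimple Hopf algebra, $A^-$ is an AS regular $H_{2n^2}$-module algebra, the action preserves the grading and is inner-faithful (no nonzero Hopf ideal of $H_{2n^2}$ annihilates $A^-$), and the fixed ring, with the induced grading, is AS regular. Here a connected $\mathbb{N}$-graded $\Bbbk$-algebra $A$ is Artin–Schelter (AS) regular of dimension $d$ if it has global dimension $d$ and finite Gelfand–Kirillov dimension and, for some $l\in\mathbb{Z}$, $\operatorname{Ext}^m_A(\Bbbk,A)$ is $0$ for $m\ne d$ and is $\Bbbk(l)$ for $m=d$. -/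

import Mathlib

open CategoryTheory Filter
open scoped TensorProduct

noncomputable section

set_option linter.unusedSectionVars false

universe u v w

namespace ASRegular

section

variable (k : Type v) {A : Type u} [Field k] [Ring A] [Algebra k A]

/-- The subspaces `𝒜 i` make `A` into a connected `ℕ`-graded `k`-algebra: `A = ⨁ 𝒜 i`,
`𝒜 i * 𝒜 j ⊆ 𝒜 (i + j)` and `𝒜 0 = k`. -/
structure IsConnectedGraded (𝒜 : ℕ → Submodule k A) : Prop where
  nontrivial : Nontrivial A
  gradedMonoid : SetLike.GradedMonoid 𝒜
  isInternal : DirectSum.IsInternal 𝒜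
  zero_eq : 𝒜 0 = 1

/-- The (left) global dimension of a ring: the supremum of the projective dimensions of all its
left modules. -/
def globalDimension (A : Type u) [Ring A] : WithBot ℕ∞ :=
  ⨆ M : ModuleCat.{u} A, projectiveDimension M

/-- The Gelfand-Kirillov dimension of a `k`-algebra: the supremum over the finite-dimensional
subspaces `V` of `limsup (log dim (k + V + ⋯ + V ^ m) / log m)`. Note that
`(k + V) ^ m = k + V + ⋯ + V ^ m`. -/
def gkDimension (A : Type u) [Ring A] [Algebra k A] : ENNReal :=
  ⨆ (V : Submodule k A) (_ : V.FG), limsup (fun m : ℕ =>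
    ENNReal.ofReal (Real.log (Module.finrank k ↥((1 ⊔ V) ^ m)) / Real.log m)) atTop

variable {k}

/-- The left ideal of `A` generated by the elements of positive degree. -/
def augmentationIdeal (𝒜 : ℕ → Submodule k A) : Ideal A :=
  Ideal.span (⋃ i > 0, (𝒜 i : Set A))

/-- The trivial left `A`-module `k = A / A_{> 0}`. -/
def trivialModule (𝒜 : ℕ → Submodule k A) : ModuleCat.{u} A :=
  ModuleCat.of A (A ⧸ augmentationIdeal 𝒜)

/-- Right multiplication by `a`, as an endomorphism of the left module `A`. -/
def rightMul (a : A) : ModuleCat.of A A ⟶ ModuleCat.of A A :=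
  ModuleCat.ofHom (LinearMap.toSpanSingleton A A a)

/-- The Gorenstein condition in dimension `d`: `Ext_A^i(k, A) = 0` for `i ≠ d`, and
`Ext_A^d(k, A)` is isomorphic, up to a shift of degrees, to the trivial right module `k`:
it is one-dimensional over `k`, and elements of `A` of positive degree act on it by `0`. (A graded
vector space of dimension one is concentrated in a single degree, so it is `k(l)` for some `l`.) -/
structure IsGorenstein (𝒜 : ℕ → Submodule k A) (d : ℕ) : Prop where
  ext_eq_zero : ∀ i : ℕ, i ≠ d →
    Subsingleton (Abelian.Ext (trivialModule 𝒜) (ModuleCat.of A A) i)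
  finrank_ext : Module.finrank k (Abelian.Ext (trivialModule 𝒜) (ModuleCat.of A A) d) = 1
  ext_comp_eq_zero : ∀ i > 0, ∀ a ∈ 𝒜 i,
    ∀ e : Abelian.Ext (trivialModule 𝒜) (ModuleCat.of A A) d,
      e.comp (Abelian.Ext.mk₀ (rightMul a)) (add_zero d) = 0

/-- Artin-Schelter regular algebras of dimension `d`. -/
structure IsASRegular (𝒜 : ℕ → Submodule k A) (d : ℕ) : Prop where
  connectedGraded : IsConnectedGraded k 𝒜
  globalDimension_eq : globalDimension A = d
  gkDimension_lt_top : gkDimension k A < ⊤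
  gorenstein : IsGorenstein 𝒜 d

end

end ASRegular

namespace HopfAction

variable (k : Type v) (H : Type w) (A : Type u) [Field k] [Ring H] [HopfAlgebra k H] [Ring A]
  [Algebra k A]

/-- A (left) `H`-module algebra structure on `A`: an `H`-module structure such that
`h (a b) = ∑ (h₁ a) (h₂ b)` and `h 1 = ε(h) 1`. -/
structure ModuleAlgebra where
  /-- The action, as a representation of the algebra `H` on the vector space `A`. -/
  act : H →ₐ[k] Module.End k A
  act_one : ∀ h : H, act h 1 = Coalgebra.counit (R := k) h • (1 : A)
  act_mul : ∀ (h : H) (a b : A), act h (a * b) =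
    TensorProduct.lift ((LinearMap.mul k A).compl₁₂ (act.toLinearMap.flip a)
      (act.toLinearMap.flip b)) (Coalgebra.comul (R := k) h)

variable {k H A}

/-- The fixed ring `A ^ H = {a | h a = ε(h) a for all h}`. -/
def fixedRing (ρ : ModuleAlgebra k H A) : Subalgebra k A where
  carrier := {a | ∀ h : H, ρ.act h a = Coalgebra.counit (R := k) h • a}
  add_mem' ha hb h := by rw [map_add, ha h, hb h, smul_add]
  algebraMap_mem' c h := by
    rw [Algebra.algebraMap_eq_smul_one, map_smul, ρ.act_one, smul_comm]
  mul_mem' {a b} ha hb h := by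
    have key : TensorProduct.lift ((LinearMap.mul k A).compl₁₂ (ρ.act.toLinearMap.flip a)
        (ρ.act.toLinearMap.flip b)) =
        (LinearMap.toSpanSingleton k A (a * b)) ∘ₗ (Coalgebra.counit (R := k) (A := H)) ∘ₗ
          (TensorProduct.lid k H).toLinearMap ∘ₗ (Coalgebra.counit (R := k)).rTensor H := by
      ext x y
      simp [ha x, hb y, smul_smul, mul_comm]
    rw [ρ.act_mul, key]
    simp

/-- The action is homogeneous: it preserves the grading of `A`. -/
def PreservesGrading (ρ : ModuleAlgebra k H A) (𝒜 : ℕ → Submodule k A) : Prop :=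
  ∀ (h : H) (i : ℕ), ∀ a ∈ 𝒜 i, ρ.act h a ∈ 𝒜 i

/-- The action is inner-faithful: no nonzero Hopf ideal of `H` annihilates `A`. -/
def IsInnerFaithful (ρ : ModuleAlgebra k H A) : Prop :=
  ∀ I : Ideal H, I.IsTwoSided → I.IsHopfIdeal k → (∀ h ∈ I, ∀ a : A, ρ.act h a = 0) → I = ⊥

/-- The grading that a subalgebra inherits. -/
def inducedGrading (B : Subalgebra k A) (𝒜 : ℕ → Submodule k A) (i : ℕ) : Submodule k B :=
  (𝒜 i).comap B.val.toLinearMap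

/-- `H` is a reflection Hopf algebra for the graded algebra `A`, with respect to the action `ρ`:
`H` is a finite-dimensional semisimple Hopf algebra, `A` is an AS regular `H`-module algebra, the
action preserves the grading and is inner-faithful, and the fixed ring is AS regular. -/
structure IsReflectionHopfAlgebra (ρ : ModuleAlgebra k H A) (𝒜 : ℕ → Submodule k A) : Prop where
  finite : Module.Finite k H
  semisimple : IsSemisimpleRing H
  regular : ∃ d : ℕ, ASRegular.IsASRegular 𝒜 d
  preservesGrading : PreservesGrading ρ 𝒜
  innerFaithful : IsInnerFaithful ρ
  fixedRing_regular : ∃ d : ℕ, ASRegular.IsASRegular (inducedGrading (fixedRing ρ) 𝒜) d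

/-- The subalgebra `B` is the commutative polynomial ring `k[a, b]`: it is generated by `a` and
`b`, and is the polynomial ring in them. -/
def IsPolynomialRingIn (B : Subalgebra k A) (a b : A) : Prop :=
  B = Algebra.adjoin k {a, b} ∧
    ∃ e : MvPolynomial (Fin 2) k ≃ₐ[k] B,
      (e (MvPolynomial.X 0) : A) = a ∧ (e (MvPolynomial.X 1) : A) = b

end HopfAction

namespace Pansera

/-- The primitive `n`-th root of unity `q = exp (2 π i / n)`. -/
def q (n : ℕ) : ℂ := Complex.exp (2 * Real.pi * Complex.I / n)

/-- The square root `p = - exp (π i / n)` of `q`. -/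
def p (n : ℕ) : ℂ := -Complex.exp (Real.pi * Complex.I / n)

/-- For elements `a`, `b` of a complex algebra, the sum
`(1 / n) * ∑_{0 ≤ r, s < n} q ^ (- r s) a ^ r b ^ s`. -/
def twistSum (n : ℕ) {R : Type*} [Ring R] [Algebra ℂ R] (a b : R) : R :=
  (n : ℂ)⁻¹ • ∑ r ∈ Finset.range n, ∑ s ∈ Finset.range n, ((q n) ^ (r * s))⁻¹ • (a ^ r * b ^ s)

theorem q_isPrimitiveRoot (n : ℕ) [NeZero n] : IsPrimitiveRoot (q n) n :=
  Complex.isPrimitiveRoot_exp n (NeZero.ne n)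

theorem q_ne_zero (n : ℕ) : q n ≠ 0 := Complex.exp_ne_zero _

section TwistSum

variable {R : Type*} [Ring R] [Algebra ℂ R]

theorem map_twistSum {S : Type*} [Ring S] [Algebra ℂ S] (n : ℕ) (f : R →ₐ[ℂ] S) (a b : R) :
    f (twistSum n a b) = twistSum n (f a) (f b) := by
  simp [twistSum, map_sum]

theorem twistSum_comm (n : ℕ) {a b : R} (h : Commute a b) : twistSum n a b = twistSum n b a := by
  unfold twistSum
  rw [Finset.sum_comm]
  refine congrArg _ (Finset.sum_congr rfl fun r _ => Finset.sum_congr rfl fun s _ => ?_)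
  rw [mul_comm s r, (h.pow_pow s r).eq]

/-- If `c a = a' c` and `c b = b' c` then `c` conjugates the corresponding sums. -/
theorem mul_twistSum (n : ℕ) {a b a' b' c : R} (ha : SemiconjBy c a a') (hb : SemiconjBy c b b') :
    SemiconjBy c (twistSum n a b) (twistSum n a' b') := by
  unfold SemiconjBy twistSum
  rw [mul_smul_comm, smul_mul_assoc, Finset.mul_sum, Finset.sum_mul]
  refine congrArg _ (Finset.sum_congr rfl fun r _ => ?_)
  rw [Finset.mul_sum, Finset.sum_mul]
  refine Finset.sum_congr rfl fun s _ => ?_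
  rw [mul_smul_comm, smul_mul_assoc, ((ha.pow_right r).mul_right (hb.pow_right s)).eq]

/-- Idempotent of the cyclic group generated by `b`. -/
def idem (n : ℕ) (b : R) (r : ℕ) : R :=
  (n : ℂ)⁻¹ • ∑ s ∈ Finset.range n, ((q n) ^ (r * s))⁻¹ • b ^ s

theorem twistSum_eq (n : ℕ) (a b : R) :
    twistSum n a b = ∑ r ∈ Finset.range n, a ^ r * idem n b r := by
  simp only [twistSum, idem, Finset.smul_sum, Finset.mul_sum, mul_smul_comm]

theorem mul_idem (n : ℕ) [NeZero n] {b : R} (hb : b ^ n = 1) (r : ℕ) :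
    b * idem n b r = (q n) ^ r • idem n b r := by
  have hq := q_ne_zero n
  have h1 : (q n) ^ n = 1 := (q_isPrimitiveRoot n).pow_eq_one
  unfold idem
  rw [mul_smul_comm, smul_comm ((q n) ^ r)]
  congr 1
  rw [Finset.mul_sum, Finset.smul_sum]
  have key := Finset.sum_range_succ' (fun s => (q n) ^ r • ((q n) ^ (r * s))⁻¹ • b ^ s) n
  rw [Finset.sum_range_succ] at key
  have h0 : (q n) ^ r • ((q n) ^ (r * n))⁻¹ • b ^ n = (q n) ^ r • ((q n) ^ (r * 0))⁻¹ • b ^ 0 := by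
    rw [mul_comm r n, pow_mul, h1, hb]; simp
  rw [h0] at key
  rw [add_right_cancel key]
  refine Finset.sum_congr rfl fun s _ => ?_
  rw [mul_smul_comm, ← pow_succ', smul_smul]
  congr 1
  rw [mul_add, mul_one, pow_add]
  field_simp

theorem pow_mul_idem (n : ℕ) [NeZero n] {b : R} (hb : b ^ n = 1) (r s : ℕ) :
    b ^ s * idem n b r = (q n) ^ (r * s) • idem n b r := by
  induction s with
  | zero => simp
  | succ s ih => rw [pow_succ', mul_assoc, ih, mul_smul_comm, mul_idem n hb, smul_smul,
      ← pow_add, mul_add, mul_one]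

theorem idem_mul_idem (n : ℕ) [NeZero n] {b : R} (hb : b ^ n = 1) {r s : ℕ} (hr : r < n)
    (hs : s < n) : idem n b r * idem n b s = if r = s then idem n b s else 0 := by
  have hq := q_ne_zero n
  have hn : (n : ℂ) ≠ 0 := Nat.cast_ne_zero.mpr (NeZero.ne n)
  have : idem n b r * idem n b s =
      ((n : ℂ)⁻¹ * ∑ t ∈ Finset.range n, (((q n) ^ r)⁻¹ * (q n) ^ s) ^ t) • idem n b s := by
    conv_lhs => rw [idem]
    rw [smul_mul_assoc, Finset.sum_mul, mul_smul, Finset.sum_smul]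
    refine congrArg _ (Finset.sum_congr rfl fun t _ => ?_)
    rw [smul_mul_assoc, pow_mul_idem n hb, smul_smul, mul_pow, inv_pow, ← pow_mul, ← pow_mul]
  rw [this]
  split_ifs with h
  · subst h
    simp [hq, hn]
  · have h1 : ((q n) ^ r)⁻¹ * (q n) ^ s ≠ 1 := by
      intro h'
      apply h
      apply (q_isPrimitiveRoot n).pow_inj hr hs
      field_simp at h'
      exact h'.symm
    rw [geom_sum_eq h1]
    have : (((q n) ^ r)⁻¹ * (q n) ^ s) ^ n = 1 := by
      rw [mul_pow, inv_pow, ← pow_mul, ← pow_mul, mul_comm r, mul_comm s, pow_mul, pow_mul,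
        (q_isPrimitiveRoot n).pow_eq_one]
      simp
    simp [this]

theorem twistSum_one_left (n : ℕ) [NeZero n] (b : R) : twistSum n 1 b = 1 := by
  have hq := q_ne_zero n
  have hn : (n : ℂ) ≠ 0 := Nat.cast_ne_zero.mpr (NeZero.ne n)
  have key : ∀ s ∈ Finset.range n, ∑ r ∈ Finset.range n, ((q n) ^ (r * s))⁻¹ =
      if s = 0 then (n : ℂ) else 0 := by
    intro s hs
    have : ∀ r ∈ Finset.range n, ((q n) ^ (r * s))⁻¹ = (((q n) ^ s)⁻¹) ^ r := by
      intro r _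
      rw [inv_pow, ← pow_mul, mul_comm]
    rw [Finset.sum_congr rfl this]
    split_ifs with h
    · simp [h]
    · have h1 : ((q n) ^ s)⁻¹ ≠ 1 := by
        intro h'
        rw [inv_eq_one] at h'
        exact (q_isPrimitiveRoot n).pow_ne_one_of_pos_of_lt h (Finset.mem_range.mp hs) h'
      rw [geom_sum_eq h1, inv_pow, ← pow_mul, mul_comm, pow_mul,
        (q_isPrimitiveRoot n).pow_eq_one]
      simp
  unfold twistSum
  rw [Finset.sum_comm]
  simp only [one_pow, one_mul]
  simp only [← Finset.sum_smul]
  rw [Finset.sum_congr rfl fun s hs => by rw [key s hs]]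
  simp [ite_smul, Finset.sum_ite_eq', hn, NeZero.pos n]

theorem twistSum_mul_left (n : ℕ) [NeZero n] {a a' b : R} (hb : b ^ n = 1)
    (haa' : Commute a a') (hab' : Commute a' b) :
    twistSum n (a * a') b = twistSum n a b * twistSum n a' b := by
  have hc : ∀ r s, Commute (idem n b r) (a' ^ s) := by
    intro r s
    unfold idem
    refine Commute.smul_left (Commute.sum_left _ _ _ fun t _ => Commute.smul_left ?_ _) _
    exact (hab'.pow_pow s t).symm
  simp only [twistSum_eq]
  rw [Finset.sum_mul_sum]
  refine Finset.sum_congr rfl fun r hr => ?_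
  have : ∀ s ∈ Finset.range n, a ^ r * idem n b r * (a' ^ s * idem n b s) =
      if r = s then a ^ r * a' ^ s * idem n b s else 0 := by
    intro s hs
    rw [mul_assoc, ← mul_assoc (idem n b r), (hc r s).eq, mul_assoc (a' ^ s), ← mul_assoc,
      idem_mul_idem n hb (Finset.mem_range.mp hr) (Finset.mem_range.mp hs)]
    split_ifs <;> simp
  rw [Finset.sum_congr rfl this, Finset.sum_ite_eq, if_pos hr, haa'.mul_pow]

theorem twistSum_one_right (n : ℕ) [NeZero n] (b : R) : twistSum n b 1 = 1 := by
  rw [twistSum_comm n (Commute.one_right b), twistSum_one_left]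

theorem twistSum_mul_right (n : ℕ) [NeZero n] {a a' b : R} (hb : b ^ n = 1)
    (haa' : Commute a a') (hab : Commute a b) (hab' : Commute a' b) :
    twistSum n b (a * a') = twistSum n b a * twistSum n b a' := by
  rw [twistSum_comm n (hab.mul_left hab').symm, twistSum_mul_left n hb haa' hab',
    twistSum_comm n hab, twistSum_comm n hab']

theorem twistSum_commute (n : ℕ) {a b c d : R} (hac : Commute a c) (had : Commute a d)
    (hbc : Commute b c) (hbd : Commute b d) : Commute (twistSum n a b) (twistSum n c d) := by
  have h1 : Commute (twistSum n a b) c :=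
    (mul_twistSum n (c := c) hac.symm hbc.symm).symm
  have h2 : Commute (twistSum n a b) d :=
    (mul_twistSum n (c := d) had.symm hbd.symm).symm
  exact mul_twistSum n h1 h2

theorem twistSum_mul_mul (n : ℕ) [NeZero n] {a b c d : R} (hb : b ^ n = 1) (hd : d ^ n = 1)
    (ha : a ^ n = 1) (hc : c ^ n = 1)
    (hab : Commute a b) (hac : Commute a c) (had : Commute a d) (hbc : Commute b c)
    (hbd : Commute b d) (hcd : Commute c d) :
    twistSum n (a * c) (b * d) =
      twistSum n a d * (twistSum n b c * (twistSum n a b * twistSum n c d)) := by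
  have hbd1 : (b * d) ^ n = 1 := by rw [hbd.mul_pow, hb, hd, one_mul]
  rw [twistSum_mul_left n hbd1 hac (hbc.symm.mul_right hcd),
    twistSum_mul_right n ha hbd hab.symm had.symm,
    twistSum_mul_right n hc hbd hbc hcd.symm, twistSum_comm n hbc,
    (twistSum_commute n (Commute.refl a) had hab.symm hbd).eq, mul_assoc]
  congr 1
  rw [← mul_assoc, ← mul_assoc]
  congr 1
  exact twistSum_commute n hac hab hbc (Commute.refl b)

end TwistSum

/-- The three generators of the algebra `H`. -/
inductive Gen : Type
  | x | y | z

/-- The defining relations of `H`: `x` and `y` generate the group algebra of `ℤ/n × ℤ/n`, `z`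
commutes with it up to the automorphism interchanging `x` and `y`, and `z ^ 2 = μ(J)`. -/
inductive Rel (n : ℕ) : FreeAlgebra ℂ Gen → FreeAlgebra ℂ Gen → Prop
  | x_pow : Rel n (FreeAlgebra.ι ℂ Gen.x ^ n) 1
  | y_pow : Rel n (FreeAlgebra.ι ℂ Gen.y ^ n) 1
  | x_y : Rel n (FreeAlgebra.ι ℂ Gen.x * FreeAlgebra.ι ℂ Gen.y)
      (FreeAlgebra.ι ℂ Gen.y * FreeAlgebra.ι ℂ Gen.x)
  | z_x : Rel n (FreeAlgebra.ι ℂ Gen.z * FreeAlgebra.ι ℂ Gen.x)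
      (FreeAlgebra.ι ℂ Gen.y * FreeAlgebra.ι ℂ Gen.z)
  | z_y : Rel n (FreeAlgebra.ι ℂ Gen.z * FreeAlgebra.ι ℂ Gen.y)
      (FreeAlgebra.ι ℂ Gen.x * FreeAlgebra.ι ℂ Gen.z)
  | z_sq : Rel n (FreeAlgebra.ι ℂ Gen.z ^ 2)
      (twistSum n (FreeAlgebra.ι ℂ Gen.x) (FreeAlgebra.ι ℂ Gen.y))

/-- The algebra `H = ℂ[ℤ/n × ℤ/n][z; σ] / (z ^ 2 - μ(J))`. -/
def H (n : ℕ) : Type := RingQuot (Rel n)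

instance (n : ℕ) : Ring (H n) := inferInstanceAs (Ring (RingQuot (Rel n)))

instance (n : ℕ) : Algebra ℂ (H n) := inferInstanceAs (Algebra ℂ (RingQuot (Rel n)))

namespace H

variable (n : ℕ)

/-- The quotient map from the free algebra. -/
def mk : FreeAlgebra ℂ Gen →ₐ[ℂ] H n := RingQuot.mkAlgHom ℂ (Rel n)

/-- The generator `x`. -/
def x : H n := mk n (FreeAlgebra.ι ℂ Gen.x)

/-- The generator `y`. -/
def y : H n := mk n (FreeAlgebra.ι ℂ Gen.y)

/-- The generator `z`. -/
def z : H n := mk n (FreeAlgebra.ι ℂ Gen.z)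

variable {n}

theorem mk_rel {a b : FreeAlgebra ℂ Gen} (h : Rel n a b) : mk n a = mk n b :=
  RingQuot.mkAlgHom_rel ℂ h

theorem x_pow : x n ^ n = 1 := by
  simpa [x] using mk_rel (Rel.x_pow (n := n))

theorem y_pow : y n ^ n = 1 := by
  simpa [y] using mk_rel (Rel.y_pow (n := n))

theorem x_y : Commute (x n) (y n) := by
  simpa [x, y, Commute, SemiconjBy] using mk_rel (Rel.x_y (n := n))

theorem z_x : SemiconjBy (z n) (x n) (y n) := by
  simpa [x, y, z, Commute, SemiconjBy] using mk_rel (Rel.z_x (n := n))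

theorem z_y : SemiconjBy (z n) (y n) (x n) := by
  simpa [x, y, z, Commute, SemiconjBy] using mk_rel (Rel.z_y (n := n))

theorem z_sq : z n ^ 2 = twistSum n (x n) (y n) := by
  simpa [x, y, z, map_twistSum] using mk_rel (Rel.z_sq (n := n))

/-- Algebra maps out of `H` from images of the generators. -/
def lift {B : Type*} [Ring B] [Algebra ℂ B] (a b c : B) (ha : a ^ n = 1) (hb : b ^ n = 1)
    (hab : a * b = b * a) (hca : c * a = b * c) (hcb : c * b = a * c)
    (hc : c ^ 2 = twistSum n a b) : H n →ₐ[ℂ] B :=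
  RingQuot.liftAlgHom ℂ ⟨FreeAlgebra.lift ℂ (fun g => Gen.rec a b c g), by
    intro u v h
    cases h
    · simpa using ha
    · simpa using hb
    · simpa using hab
    · simpa using hca
    · simpa using hcb
    · simpa [map_twistSum] using hc⟩

section lift

variable {B : Type*} [Ring B] [Algebra ℂ B] {a b c : B} (ha : a ^ n = 1) (hb : b ^ n = 1)
    (hab : a * b = b * a) (hca : c * a = b * c) (hcb : c * b = a * c)
    (hc : c ^ 2 = twistSum n a b)

@[simp] theorem lift_x : lift a b c ha hb hab hca hcb hc (x n) = a :=
  (RingQuot.liftAlgHom_mkAlgHom_apply ..).trans (by simp)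

@[simp] theorem lift_y : lift a b c ha hb hab hca hcb hc (y n) = b :=
  (RingQuot.liftAlgHom_mkAlgHom_apply ..).trans (by simp)

@[simp] theorem lift_z : lift a b c ha hb hab hca hcb hc (z n) = c :=
  (RingQuot.liftAlgHom_mkAlgHom_apply ..).trans (by simp)

end lift

theorem hom_ext {B : Type*} [Ring B] [Algebra ℂ B] {f g : H n →ₐ[ℂ] B} (hx : f (x n) = g (x n))
    (hy : f (y n) = g (y n)) (hz : f (z n) = g (z n)) : f = g := by
  refine RingQuot.ringQuot_ext' ℂ f g (FreeAlgebra.hom_ext (funext fun t => ?_))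
  cases t
  · exact hx
  · exact hy
  · exact hz

theorem mk_surjective : Function.Surjective (mk n) := RingQuot.mkAlgHom_surjective ℂ (Rel n)

/-- Induction along products of generators. -/
theorem induction {P : H n → Prop} (hadd : ∀ a b, P a → P b → P (a + b))
    (hmul : ∀ a b, P a → P b → P (a * b)) (hc : ∀ c : ℂ, P (algebraMap ℂ (H n) c))
    (hx : P (x n)) (hy : P (y n)) (hz : P (z n)) (h : H n) : P h := by
  obtain ⟨w, rfl⟩ := mk_surjective h
  induction w using FreeAlgebra.induction with
  | grade0 r => rw [AlgHom.commutes]; exact hc r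
  | grade1 t => cases t <;> assumption
  | mul a b ha hb => rw [map_mul]; exact hmul _ _ ha hb
  | add a b ha hb => rw [map_add]; exact hadd _ _ ha hb

variable (n) [NeZero n]

/-- The twist `J = (1 / n) * ∑ q ^ (- r s) x ^ r ⊗ y ^ s`. -/
def J : H n ⊗[ℂ] H n := twistSum n (x n ⊗ₜ[ℂ] (1 : H n)) ((1 : H n) ⊗ₜ[ℂ] y n)


theorem comul_x_pow : (x n ⊗ₜ[ℂ] x n) ^ n = 1 := by
  simp [Algebra.TensorProduct.tmul_pow, x_pow, Algebra.TensorProduct.one_def]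

theorem comul_y_pow : (y n ⊗ₜ[ℂ] y n) ^ n = 1 := by
  simp [Algebra.TensorProduct.tmul_pow, y_pow, Algebra.TensorProduct.one_def]

theorem comul_x_y : (x n ⊗ₜ[ℂ] x n) * (y n ⊗ₜ[ℂ] y n) = (y n ⊗ₜ[ℂ] y n) * (x n ⊗ₜ[ℂ] x n) := by
  simp [x_y.eq]

theorem comul_z_x : J n * (z n ⊗ₜ[ℂ] z n) * (x n ⊗ₜ[ℂ] x n) =
    (y n ⊗ₜ[ℂ] y n) * (J n * (z n ⊗ₜ[ℂ] z n)) := by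
  have h : SemiconjBy (y n ⊗ₜ[ℂ] y n) (J n) (J n) :=
    mul_twistSum n (by simp [SemiconjBy, x_y.eq]) (by simp [SemiconjBy])
  exact (SemiconjBy.mul_left (Commute.symm h) (by simp [SemiconjBy, z_x.eq])).eq

theorem comul_z_y : J n * (z n ⊗ₜ[ℂ] z n) * (y n ⊗ₜ[ℂ] y n) =
    (x n ⊗ₜ[ℂ] x n) * (J n * (z n ⊗ₜ[ℂ] z n)) := by
  have h : SemiconjBy (x n ⊗ₜ[ℂ] x n) (J n) (J n) :=
    mul_twistSum n (by simp [SemiconjBy]) (by simp [SemiconjBy, x_y.eq])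
  exact (SemiconjBy.mul_left (Commute.symm h) (by simp [SemiconjBy, z_y.eq])).eq

theorem comul_z_sq : (J n * (z n ⊗ₜ[ℂ] z n)) ^ 2 =
    twistSum n (x n ⊗ₜ[ℂ] x n) (y n ⊗ₜ[ℂ] y n) := by
  have h : SemiconjBy (z n ⊗ₜ[ℂ] z n) (J n)
      (twistSum n (y n ⊗ₜ[ℂ] (1 : H n)) ((1 : H n) ⊗ₜ[ℂ] x n)) :=
    mul_twistSum n (by simp [SemiconjBy, z_x.eq]) (by simp [SemiconjBy, z_y.eq])
  have hz : z n ⊗ₜ[ℂ] z n * z n ⊗ₜ[ℂ] z n =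
      twistSum n (x n ⊗ₜ[ℂ] (1 : H n)) (y n ⊗ₜ[ℂ] (1 : H n)) *
        twistSum n ((1 : H n) ⊗ₜ[ℂ] x n) ((1 : H n) ⊗ₜ[ℂ] y n) := by
    have h1 := map_twistSum n
      (Algebra.TensorProduct.includeLeft : H n →ₐ[ℂ] H n ⊗[ℂ] H n) (x n) (y n)
    have h2 := map_twistSum n
      (Algebra.TensorProduct.includeRight : H n →ₐ[ℂ] H n ⊗[ℂ] H n) (x n) (y n)
    simp only [Algebra.TensorProduct.includeLeft_apply,
      Algebra.TensorProduct.includeRight_apply, ← z_sq] at h1 h2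
    rw [← h1, ← h2]
    simp [sq]
  have hx : x n ⊗ₜ[ℂ] x n = (x n ⊗ₜ[ℂ] (1 : H n)) * ((1 : H n) ⊗ₜ[ℂ] x n) := by simp
  have hy : y n ⊗ₜ[ℂ] y n = (y n ⊗ₜ[ℂ] (1 : H n)) * ((1 : H n) ⊗ₜ[ℂ] y n) := by simp
  rw [sq, mul_assoc, ← mul_assoc (z n ⊗ₜ[ℂ] z n), h.eq, mul_assoc, hz, hx, hy, J]
  refine (twistSum_mul_mul n ?_ ?_ ?_ ?_ ?_ ?_ ?_ ?_ ?_ ?_).symm <;>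
  simp [Algebra.TensorProduct.tmul_pow, x_pow, y_pow, Algebra.TensorProduct.one_def, Commute,
    SemiconjBy, x_y.eq]

/-- The comultiplication: `x` and `y` are grouplike and `Δ(z) = J (z ⊗ z)`. -/
def comulHom : H n →ₐ[ℂ] H n ⊗[ℂ] H n :=
  lift (x n ⊗ₜ x n) (y n ⊗ₜ y n) (J n * (z n ⊗ₜ z n)) (comul_x_pow n) (comul_y_pow n)
    (comul_x_y n) (comul_z_x n) (comul_z_y n) (comul_z_sq n)

/-- The counit, equal to `1` on the generators. -/
def counitHom : H n →ₐ[ℂ] ℂ :=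
  lift 1 1 1 (by simp) (by simp) (by simp) (by simp) (by simp)
    (by rw [twistSum_one_left, one_pow])

theorem comulHom_x : comulHom n (x n) = x n ⊗ₜ x n := by
  rw [comulHom, lift_x]

theorem comulHom_y : comulHom n (y n) = y n ⊗ₜ y n := by
  rw [comulHom, lift_y]

theorem comulHom_z : comulHom n (z n) = J n * (z n ⊗ₜ z n) := by
  rw [comulHom, lift_z]

theorem counitHom_x : counitHom n (x n) = 1 := by
  rw [counitHom, lift_x]

theorem counitHom_y : counitHom n (y n) = 1 := by
  rw [counitHom, lift_y]

theorem counitHom_z : counitHom n (z n) = 1 := by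
  rw [counitHom, lift_z]

theorem coassoc_aux :
    (Algebra.TensorProduct.assoc ℂ ℂ ℂ (H n) (H n) (H n)).toAlgHom.comp
      ((Algebra.TensorProduct.map (comulHom n) (.id ℂ (H n))).comp (comulHom n))
      = (Algebra.TensorProduct.map (.id ℂ (H n)) (comulHom n)).comp (comulHom n) := by
  refine hom_ext ?_ ?_ ?_
  · simp [comulHom_x]
  · simp [comulHom_y]
  · have hl : (Algebra.TensorProduct.assoc ℂ ℂ ℂ (H n) (H n) (H n)).toAlgHom
        ((Algebra.TensorProduct.map (comulHom n) (.id ℂ (H n))) (z n ⊗ₜ z n)) =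
        twistSum n (x n ⊗ₜ[ℂ] ((1 : H n) ⊗ₜ[ℂ] (1 : H n))) ((1 : H n) ⊗ₜ[ℂ] (y n ⊗ₜ[ℂ] (1 : H n))) *
          (z n ⊗ₜ[ℂ] (z n ⊗ₜ[ℂ] z n)) := by
      have h := map_twistSum n ((Algebra.TensorProduct.assoc ℂ ℂ ℂ (H n) (H n) (H n)).toAlgHom.comp
        (Algebra.TensorProduct.includeLeft : H n ⊗[ℂ] H n →ₐ[ℂ] (H n ⊗[ℂ] H n) ⊗[ℂ] H n))
        (x n ⊗ₜ[ℂ] (1 : H n)) ((1 : H n) ⊗ₜ[ℂ] y n)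
      have e : (J n * (z n ⊗ₜ z n)) ⊗ₜ[ℂ] z n = (J n ⊗ₜ[ℂ] (1 : H n)) * ((z n ⊗ₜ z n) ⊗ₜ z n) := by
        simp
      rw [Algebra.TensorProduct.map_tmul, comulHom_z, AlgHom.id_apply, e, map_mul]
      simp only [AlgHom.comp_apply, Algebra.TensorProduct.includeLeft_apply] at h
      rw [J, h]
      simp
    have hr : (Algebra.TensorProduct.map (.id ℂ (H n)) (comulHom n)) (z n ⊗ₜ z n) =
        twistSum n ((1 : H n) ⊗ₜ[ℂ] (x n ⊗ₜ[ℂ] (1 : H n))) ((1 : H n) ⊗ₜ[ℂ] ((1 : H n) ⊗ₜ[ℂ] y n)) *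
          (z n ⊗ₜ[ℂ] (z n ⊗ₜ[ℂ] z n)) := by
      have h := map_twistSum n
        (Algebra.TensorProduct.includeRight : H n ⊗[ℂ] H n →ₐ[ℂ] H n ⊗[ℂ] (H n ⊗[ℂ] H n))
        (x n ⊗ₜ[ℂ] (1 : H n)) ((1 : H n) ⊗ₜ[ℂ] y n)
      have e : z n ⊗ₜ[ℂ] (J n * (z n ⊗ₜ z n)) = ((1 : H n) ⊗ₜ[ℂ] J n) * (z n ⊗ₜ (z n ⊗ₜ z n)) := by
        simp
      rw [Algebra.TensorProduct.map_tmul, comulHom_z, AlgHom.id_apply, e]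
      simp only [Algebra.TensorProduct.includeRight_apply] at h
      rw [J, h]
    simp only [AlgHom.comp_apply, comulHom_z, map_mul]
    rw [hl, hr, J, map_twistSum, map_twistSum, map_twistSum, ← mul_assoc, ← mul_assoc]
    congr 1
    have e1 : x n ⊗ₜ[ℂ] (x n ⊗ₜ[ℂ] (1 : H n)) =
        (x n ⊗ₜ[ℂ] ((1 : H n) ⊗ₜ[ℂ] (1 : H n))) * ((1 : H n) ⊗ₜ[ℂ] (x n ⊗ₜ[ℂ] (1 : H n))) := by simp
    have e2 : (1 : H n) ⊗ₜ[ℂ] (y n ⊗ₜ[ℂ] y n) =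
        ((1 : H n) ⊗ₜ[ℂ] (y n ⊗ₜ[ℂ] (1 : H n))) * ((1 : H n) ⊗ₜ[ℂ] ((1 : H n) ⊗ₜ[ℂ] y n)) := by simp
    have e3 : ∀ a b c : H n, (Algebra.TensorProduct.assoc ℂ ℂ ℂ (H n) (H n) (H n)).toAlgHom
        (a ⊗ₜ[ℂ] b ⊗ₜ[ℂ] c) = a ⊗ₜ[ℂ] (b ⊗ₜ[ℂ] c) := fun _ _ _ => rfl
    simp only [Algebra.TensorProduct.map_tmul, comulHom_x, comulHom_y, map_one, AlgHom.id_apply,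
      Algebra.TensorProduct.one_def, e3, e1, e2]
    rw [twistSum_mul_left, twistSum_mul_right]
    · refine (Commute.mul_left ?_ ?_).eq.trans (mul_assoc _ _ _).symm <;>
      refine twistSum_commute n ?_ ?_ ?_ ?_ <;> simp [Commute, SemiconjBy, x_y.eq]
    all_goals
      simp [Algebra.TensorProduct.tmul_pow, x_pow, y_pow, Algebra.TensorProduct.one_def, Commute,
        SemiconjBy]

instance : Bialgebra ℂ (H n) :=
  Bialgebra.ofAlgHom (comulHom n) (counitHom n) (coassoc_aux n)
    (by
      refine hom_ext ?_ ?_ ?_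
      · simp [comulHom_x, counitHom_x]
      · simp [comulHom_y, counitHom_y]
      · simp [comulHom_z, counitHom_z, J, map_twistSum, counitHom_x,
          ← Algebra.TensorProduct.one_def, twistSum_one_left])
    (by
      refine hom_ext ?_ ?_ ?_
      · simp [comulHom_x, counitHom_x]
      · simp [comulHom_y, counitHom_y]
      · simp [comulHom_z, counitHom_z, J, map_twistSum, counitHom_y,
          ← Algebra.TensorProduct.one_def, twistSum_one_right])

theorem comul_apply (h : H n) : Coalgebra.comul (R := ℂ) h = comulHom n h := rfl

theorem counit_apply (h : H n) : Coalgebra.counit (R := ℂ) h = counitHom n h := rfl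

variable {n}

theorem x_inv : x n ^ (n - 1) * x n = 1 := by
  rw [← pow_succ, Nat.sub_add_cancel (NeZero.pos n), x_pow]

theorem y_inv : y n ^ (n - 1) * y n = 1 := by
  rw [← pow_succ, Nat.sub_add_cancel (NeZero.pos n), y_pow]

theorem twistSum_inv_left {R : Type*} [Ring R] [Algebra ℂ R] {a a' b : R} (ha : a' * a = 1)
    (haa : Commute a' a) (hb : b ^ n = 1) (hab : Commute a b) :
    twistSum n a' b * twistSum n a b = 1 := by
  rw [← twistSum_mul_left n hb haa hab, ha, twistSum_one_left]

theorem twistSum_inv_inv {R : Type*} [Ring R] [Algebra ℂ R] {a a' b b' : R} (ha : a' * a = 1)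
    (hb : b' * b = 1) (hbn : b ^ n = 1) (han : a' ^ n = 1) (haa : Commute a' a)
    (hbb : Commute b' b) (hab : Commute a b) (hab' : Commute a' b) (hb'a : Commute b' a') :
    twistSum n a' b' = twistSum n a b := by
  have h1 := twistSum_inv_left ha haa hbn hab
  have h2 : twistSum n a' b' * twistSum n a' b = 1 := by
    rw [← twistSum_mul_right n han hbb hb'a hab'.symm, hb, twistSum_one_right]
  calc twistSum n a' b' = twistSum n a' b' * (twistSum n a' b * twistSum n a b) := by
        rw [h1, mul_one]
    _ = twistSum n a b := by rw [← mul_assoc, h2, one_mul]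

open MulOpposite

theorem twistSum_op {R : Type*} [Ring R] [Algebra ℂ R] (a b : R) (h : Commute a b) :
    twistSum n (op a) (op b) = op (twistSum n a b) := by
  unfold twistSum
  rw [op_smul, Finset.op_sum]
  refine congrArg _ (Finset.sum_congr rfl fun r _ => ?_)
  rw [Finset.op_sum]
  refine Finset.sum_congr rfl fun s _ => ?_
  rw [op_smul, (h.pow_pow r s).eq, op_mul, op_pow, op_pow]

variable (n)

theorem antipode_x_pow : (op (x n ^ (n - 1))) ^ n = 1 := by
  rw [← op_pow, ← pow_mul, mul_comm, pow_mul, x_pow, one_pow, op_one]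

theorem antipode_y_pow : (op (y n ^ (n - 1))) ^ n = 1 := by
  rw [← op_pow, ← pow_mul, mul_comm, pow_mul, y_pow, one_pow, op_one]

theorem antipode_x_y : op (x n ^ (n - 1)) * op (y n ^ (n - 1)) =
    op (y n ^ (n - 1)) * op (x n ^ (n - 1)) := by
  rw [← op_mul, ← op_mul, (x_y.pow_pow _ _).eq]

theorem antipode_z_x : op (z n) * op (x n ^ (n - 1)) = op (y n ^ (n - 1)) * op (z n) := by
  rw [← op_mul, ← op_mul, (z_y.pow_right _).eq]

theorem antipode_z_y : op (z n) * op (y n ^ (n - 1)) = op (x n ^ (n - 1)) * op (z n) := by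
  rw [← op_mul, ← op_mul, (z_x.pow_right _).eq]

theorem antipode_z_sq : op (z n) ^ 2 = twistSum n (op (x n ^ (n - 1))) (op (y n ^ (n - 1))) := by
  rw [← op_pow, z_sq, twistSum_op _ _ (x_y.pow_pow _ _)]
  congr 1
  refine (twistSum_inv_inv x_inv y_inv y_pow ?_ (Commute.pow_self _ _) (Commute.pow_self _ _) x_y
    (x_y.pow_left _) (x_y.symm.pow_pow _ _)).symm
  rw [← pow_mul, mul_comm, pow_mul, x_pow, one_pow]

/-- The antipode as an anti-homomorphism: `S(x) = x⁻¹`, `S(y) = y⁻¹`, `S(z) = z`. -/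
def antipodeHom : H n →ₐ[ℂ] (H n)ᵐᵒᵖ :=
  lift (op (x n ^ (n - 1))) (op (y n ^ (n - 1))) (op (z n)) (antipode_x_pow n) (antipode_y_pow n)
    (antipode_x_y n) (antipode_z_x n) (antipode_z_y n) (antipode_z_sq n)

/-- The antipode as a linear map. -/
def antipodeLin : H n →ₗ[ℂ] H n :=
  (opLinearEquiv ℂ).symm.toLinearMap ∘ₗ (antipodeHom n).toLinearMap

theorem antipodeLin_mul (a b : H n) : antipodeLin n (a * b) = antipodeLin n b * antipodeLin n a := by
  simp [antipodeLin]

theorem antipodeLin_algebraMap (c : ℂ) :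
    antipodeLin n (algebraMap ℂ (H n) c) = algebraMap ℂ (H n) c := by
  simp [antipodeLin]

theorem antipodeLin_x : antipodeLin n (x n) = x n ^ (n - 1) := by
  simp [antipodeLin, antipodeHom]

theorem antipodeLin_y : antipodeLin n (y n) = y n ^ (n - 1) := by
  simp [antipodeLin, antipodeHom]

theorem antipodeLin_z : antipodeLin n (z n) = z n := by
  simp [antipodeLin, antipodeHom]

theorem antipodeLin_pow (a : H n) (k : ℕ) : antipodeLin n (a ^ k) = antipodeLin n a ^ k := by
  simp [antipodeLin]

/-- `∑ a₁ ⊗ a₂ ↦ ∑ S(a₁) a₂`. -/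
def antiL : H n ⊗[ℂ] H n →ₗ[ℂ] H n := LinearMap.mul' ℂ (H n) ∘ₗ (antipodeLin n).rTensor (H n)

/-- `∑ a₁ ⊗ a₂ ↦ ∑ a₁ S(a₂)`. -/
def antiR : H n ⊗[ℂ] H n →ₗ[ℂ] H n := LinearMap.mul' ℂ (H n) ∘ₗ (antipodeLin n).lTensor (H n)

theorem antiL_tmul (a b : H n) : antiL n (a ⊗ₜ b) = antipodeLin n a * b := by simp [antiL]

theorem antiR_tmul (a b : H n) : antiR n (a ⊗ₜ b) = a * antipodeLin n b := by simp [antiR]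

theorem antiL_mul_tmul (s : H n ⊗[ℂ] H n) (c d : H n) :
    antiL n (s * (c ⊗ₜ d)) = antipodeLin n c * antiL n s * d := by
  induction s with
  | zero => simp
  | tmul a b => simp [antiL_tmul, antipodeLin_mul, mul_assoc]
  | add s t hs ht => rw [add_mul, map_add, hs, ht, map_add, mul_add, add_mul]

theorem antiR_tmul_mul (s : H n ⊗[ℂ] H n) (c d : H n) :
    antiR n ((c ⊗ₜ d) * s) = c * antiR n s * antipodeLin n d := by
  induction s with
  | zero => simp
  | tmul a b => simp [antiR_tmul, antipodeLin_mul, mul_assoc]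
  | add s t hs ht => rw [mul_add, map_add, hs, ht, map_add, mul_add, add_mul]

theorem antiL_mul {s : H n ⊗[ℂ] H n} {c : ℂ} (hs : antiL n s = algebraMap ℂ (H n) c)
    (t : H n ⊗[ℂ] H n) : antiL n (s * t) = algebraMap ℂ (H n) c * antiL n t := by
  induction t with
  | zero => simp
  | tmul a b => rw [antiL_mul_tmul, hs, antiL_tmul, ← Algebra.commutes, mul_assoc]
  | add t u ht hu => rw [mul_add, map_add, ht, hu, map_add, mul_add]

theorem antiR_mul {s : H n ⊗[ℂ] H n} {c : ℂ} (hs : antiR n s = algebraMap ℂ (H n) c)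
    (t : H n ⊗[ℂ] H n) : antiR n (t * s) = antiR n t * algebraMap ℂ (H n) c := by
  induction t with
  | zero => simp
  | tmul a b => rw [antiR_tmul_mul, hs, antiR_tmul, mul_assoc, mul_assoc, Algebra.commutes]
  | add t u ht hu => rw [add_mul, map_add, ht, hu, map_add, add_mul]

theorem J_eq : J n = (n : ℂ)⁻¹ • ∑ r ∈ Finset.range n, ∑ s ∈ Finset.range n,
    ((q n) ^ (r * s))⁻¹ • ((x n ^ r) ⊗ₜ[ℂ] (y n ^ s)) := by
  simp [J, twistSum, Algebra.TensorProduct.tmul_pow]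

theorem antiL_J : antiL n (J n) = twistSum n (x n ^ (n - 1)) (y n) := by
  simp [J_eq, twistSum, antiL_tmul, antipodeLin_pow, antipodeLin_x]

theorem antiL_comul (h : H n) :
    antiL n (comulHom n h) = algebraMap ℂ (H n) (counitHom n h) := by
  induction h using induction with
  | hadd a b ha hb => simp [ha, hb]
  | hmul a b ha hb => rw [map_mul, antiL_mul n ha, hb, map_mul, map_mul]
  | hc c =>
    rw [AlgHom.commutes, AlgHom.commutes, Algebra.TensorProduct.algebraMap_apply, antiL_tmul,
      antipodeLin_algebraMap, mul_one]
    rfl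
  | hx => rw [comulHom_x, counitHom_x, antiL_tmul, antipodeLin_x, x_inv, map_one]
  | hy => rw [comulHom_y, counitHom_y, antiL_tmul, antipodeLin_y, y_inv, map_one]
  | hz =>
    rw [comulHom_z, counitHom_z, antiL_mul_tmul, antiL_J, antipodeLin_z,
      (mul_twistSum n (z_x.pow_right _) z_y).eq, mul_assoc, ← sq, z_sq, twistSum_comm n x_y,
      twistSum_inv_left y_inv (Commute.pow_self _ _) x_pow x_y.symm, map_one]

theorem antiR_comul (h : H n) :
    antiR n (comulHom n h) = algebraMap ℂ (H n) (counitHom n h) := by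
  induction h using induction with
  | hadd a b ha hb => simp [ha, hb]
  | hmul a b ha hb => rw [map_mul, antiR_mul n hb, ha, map_mul, map_mul]
  | hc c =>
    rw [AlgHom.commutes, AlgHom.commutes, Algebra.TensorProduct.algebraMap_apply, antiR_tmul]
    have := antipodeLin_algebraMap n 1
    rw [map_one] at this
    rw [this, mul_one]
    rfl
  | hx =>
    rw [comulHom_x, counitHom_x, antiR_tmul, antipodeLin_x, (Commute.self_pow _ _).eq, x_inv,
      map_one]
  | hy =>
    rw [comulHom_y, counitHom_y, antiR_tmul, antipodeLin_y, (Commute.self_pow _ _).eq, y_inv,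
      map_one]
  | hz =>
    have hzy : Commute (z n * z n) (y n) := SemiconjBy.mul_left z_x z_y
    have h : antiR n (J n * (z n ⊗ₜ z n)) = twistSum n (x n) (y n ^ (n - 1)) * (z n * z n) := by
      rw [J_eq, twistSum, smul_mul_assoc, Finset.sum_mul, map_smul, map_sum, smul_mul_assoc,
        Finset.sum_mul]
      refine congrArg _ (Finset.sum_congr rfl fun r _ => ?_)
      rw [Finset.sum_mul, map_sum, Finset.sum_mul]
      refine Finset.sum_congr rfl fun s _ => ?_
      rw [smul_mul_assoc, map_smul, smul_mul_assoc, Algebra.TensorProduct.tmul_mul_tmul,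
        antiR_tmul, antipodeLin_mul, antipodeLin_z, antipodeLin_pow, antipodeLin_y, mul_assoc,
        ← mul_assoc (z n) (z n), mul_assoc (x n ^ r), ((hzy.pow_right (n - 1)).pow_right s).eq]
    rw [comulHom_z, counitHom_z, h, ← sq, z_sq, twistSum_comm n (x_y.pow_right _),
      twistSum_comm n x_y,
      twistSum_inv_left y_inv (Commute.pow_self _ _) x_pow x_y.symm, map_one]

instance : HopfAlgebra ℂ (H n) where
  antipode := antipodeLin n
  mul_antipode_rTensor_comul := LinearMap.ext (antiL_comul n)
  mul_antipode_lTensor_comul := LinearMap.ext (antiR_comul n)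

end H

/-- The defining relation `p ^ (i² - j²) u v = v u`, with `u` and `v` the generators `0` and `1`. -/
inductive AMinusRel (n : ℕ) (i j : ℤ) : FreeAlgebra ℂ (Fin 2) → FreeAlgebra ℂ (Fin 2) → Prop
  | rel : AMinusRel n i j
      ((p n) ^ (i ^ 2 - j ^ 2) • (FreeAlgebra.ι ℂ 0 * FreeAlgebra.ι ℂ 1))
      (FreeAlgebra.ι ℂ 1 * FreeAlgebra.ι ℂ 0)

/-- The algebra `A⁻ = ℂ⟨u, v⟩ / (p ^ (i² - j²) u v - v u)`. -/
def AMinus (n : ℕ) (i j : ℤ) : Type := RingQuot (AMinusRel n i j)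

namespace AMinus

variable (n : ℕ) (i j : ℤ)

instance : Ring (AMinus n i j) := inferInstanceAs (Ring (RingQuot (AMinusRel n i j)))

instance : Algebra ℂ (AMinus n i j) := inferInstanceAs (Algebra ℂ (RingQuot (AMinusRel n i j)))

/-- The generator `u`. -/
def u : AMinus n i j := RingQuot.mkAlgHom ℂ (AMinusRel n i j) (FreeAlgebra.ι ℂ 0)

/-- The generator `v`. -/
def v : AMinus n i j := RingQuot.mkAlgHom ℂ (AMinusRel n i j) (FreeAlgebra.ι ℂ 1)

/-- The grading with `u` and `v` in degree one. -/
def grading (d : ℕ) : Submodule ℂ (AMinus n i j) := (Submodule.span ℂ {u n i j, v n i j}) ^ d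

end AMinus

/-- The action of `H` restricts to the representation `π_{i,j}` on `ℂ u ⊕ ℂ v`, given in the basis
`u, v` by the matrices `diag(q ^ i, q ^ j)` of `x`, `diag(q ^ j, q ^ i)` of `y` and
`(0, 1; q ^ (i j), 0)` of `z`. -/
structure ActsByPi {n : ℕ} [NeZero n] {i j : ℤ}
    (ρ : HopfAction.ModuleAlgebra ℂ (H n) (AMinus n i j)) : Prop where
  x_u : ρ.act (H.x n) (AMinus.u n i j) = (q n) ^ i • AMinus.u n i j
  x_v : ρ.act (H.x n) (AMinus.v n i j) = (q n) ^ j • AMinus.v n i j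
  y_u : ρ.act (H.y n) (AMinus.u n i j) = (q n) ^ j • AMinus.u n i j
  y_v : ρ.act (H.y n) (AMinus.v n i j) = (q n) ^ i • AMinus.v n i j
  z_u : ρ.act (H.z n) (AMinus.u n i j) = (q n) ^ (i * j) • AMinus.v n i j
  z_v : ρ.act (H.z n) (AMinus.v n i j) = AMinus.u n i j

end Pansera

end

noncomputable section

/-! The monomials `u ^ a * v ^ b` form a basis of `A⁻` in which the whole action is explicit: `x`
and `y` are diagonal with eigenvalues `q ^ (i a + j b)` and `q ^ (j a + i b)`, while `z` exchanges
the two exponents up to the power `zExponent` of `p`. The twist `J` multiplies a tensor of an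
`x`-eigenvector of weight `α` and a `y`-eigenvector of weight `β` by `q ^ (α β)`. So `Δ(z) = J (z ⊗
z)` determines `z` on products of monomials, which gives uniqueness, and existence reduces to
polynomial identities between exponents of `p`.

The pair of weights of a monomial is obtained from `(a, b)` by a matrix of determinant `i² - j²`, a
unit modulo `n`. This is used twice. Every pair of residues is attained, so each primitive
idempotent of `ℂ[x, y]` is detected by a monomial, and the action is faithful
(`ActsByPi.eq_zero_of_act_eq_zero`), hence inner-faithful. Conversely the weights vanish only when
`n` divides `a` and `b`, so the elements fixed by `x` and `y` are spanned by the `u ^ (n a) * v ^ (n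
b)`. Since `p ^ (n * n) = 1`, these form a commutative polynomial ring, and after a change of sign
of `v ^ n` the element `z` interchanges its two variables. The fixed ring is therefore the ring of
symmetric polynomials in two variables (`ActsByPi.fixedRing_eq_map`), freely generated by the
elementary ones.

Artin–Schelter regularity is proved once, for any `QuantumPlane` with homogeneous generators of
positive degree (`IsGrading.isASRegular`). It applies to `A⁻`, and to the fixed ring with `μ = 1`
and degrees `n` and `2 * n`. For the global dimension, each module gets a two-step resolution
through cokernels of maps between free modules `A ⊗ M`. For the Gorenstein condition, `s` and then
`t` are divided out, and the two long exact sequences of `Ext` are followed. Finally, `H` is a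
quotient of the group algebra of a finite group, hence finite-dimensional and semisimple. -/

theorem mul_pow_eq_smul_of_mul_eq_smul {k : Type v} {A : Type u} [CommSemiring k] [Semiring A]
    [Algebra k A] {s t : A} {μ : k} (h : t * s = μ • (s * t)) (i : ℕ) :
    t * s ^ i = μ ^ i • (s ^ i * t) := by
  induction i with
  | zero => simp
  | succ i ih =>
    rw [pow_succ, ← mul_assoc, ih, smul_mul_assoc, mul_assoc, h, mul_smul_comm, smul_smul,
      mul_assoc, pow_succ]

/-- Generators `s`, `t` of an algebra with `t s = μ s t`, for a unit `μ`, whose ordered monomials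
`s ^ i t ^ j` form a basis. -/
structure QuantumPlane (k : Type v) (A : Type u) [Field k] [Ring A] [Algebra k A] where
  /-- The first generator. -/
  s : A
  /-- The second generator. -/
  t : A
  /-- The commutation parameter. -/
  μ : k
  /-- The basis of ordered monomials. -/
  basis : Module.Basis (ℕ × ℕ) k A
  basis_apply : ∀ i j, basis (i, j) = s ^ i * t ^ j
  μ_ne_zero : μ ≠ 0
  t_mul_s : t * s = μ • (s * t)

namespace QuantumPlane

/-! ### Multiplication of monomials in a quantum plane -/

section Basic

variable {k : Type v} {A : Type u} [Field k] [Ring A] [Algebra k A] (Q : QuantumPlane k A)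

theorem t_pow_mul_s (j : ℕ) : Q.t ^ j * Q.s = Q.μ ^ j • (Q.s * Q.t ^ j) := by
  induction j with
  | zero => simp
  | succ j ih =>
    rw [pow_succ, mul_assoc, Q.t_mul_s, mul_smul_comm, ← mul_assoc, ih, smul_mul_assoc, smul_smul,
      mul_assoc, pow_succ']

theorem t_pow_mul_s_pow (j i : ℕ) : Q.t ^ j * Q.s ^ i = Q.μ ^ (j * i) • (Q.s ^ i * Q.t ^ j) := by
  induction i with
  | zero => simp
  | succ i ih =>
    rw [pow_succ, ← mul_assoc, ih, smul_mul_assoc, mul_assoc, Q.t_pow_mul_s, mul_smul_comm,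
      smul_smul, mul_assoc, ← pow_add, mul_add, mul_one]

theorem basis_mul_basis (a b c d : ℕ) :
    Q.basis (a, b) * Q.basis (c, d) = Q.μ ^ (b * c) • Q.basis (a + c, b + d) := by
  simp only [basis_apply]
  rw [mul_assoc, ← mul_assoc (Q.t ^ b), t_pow_mul_s_pow, smul_mul_assoc, mul_smul_comm, pow_add,
    pow_add]
  simp only [mul_assoc]

theorem basis_zero : Q.basis (0, 0) = 1 := by simp [basis_apply]

theorem basis_s : Q.basis (1, 0) = Q.s := by simp [basis_apply]

theorem basis_t : Q.basis (0, 1) = Q.t := by simp [basis_apply]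

theorem basis_mul_t (x : ℕ × ℕ) : Q.basis x * Q.t = Q.basis (x.1, x.2 + 1) := by
  rw [← basis_t, ← Prod.mk.eta (p := x), basis_mul_basis]; simp

theorem basis_mul_s (x : ℕ × ℕ) : Q.basis x * Q.s = Q.μ ^ x.2 • Q.basis (x.1 + 1, x.2) := by
  rw [← basis_s, ← Prod.mk.eta (p := x), basis_mul_basis]; simp

theorem s_mul_basis (x : ℕ × ℕ) : Q.s * Q.basis x = Q.basis (x.1 + 1, x.2) := by
  rw [← basis_s, ← Prod.mk.eta (p := x), basis_mul_basis]; simp [add_comm]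

theorem t_mul_basis (x : ℕ × ℕ) : Q.t * Q.basis x = Q.μ ^ x.1 • Q.basis (x.1, x.2 + 1) := by
  rw [← basis_t, ← Prod.mk.eta (p := x), basis_mul_basis]; simp [add_comm]

end Basic

/-! ### The free modules `A ⊗ M` and the differential attached to `t` -/

section FreeResolution

variable {k : Type v} {A : Type u} [Field k] [Ring A] [Algebra k A] (Q : QuantumPlane k A)
variable {M : Type w} [AddCommGroup M] [Module k M]

/-- The `A`-linear map `p ⊗ m ↦ p a ⊗ m - p ⊗ T m` on `A ⊗ M`. -/
def differential (a : A) (T : M →ₗ[k] M) : A ⊗[k] M →ₗ[A] A ⊗[k] M :=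
  TensorProduct.AlgebraTensorModule.map (LinearMap.toSpanSingleton A A a) LinearMap.id -
    TensorProduct.AlgebraTensorModule.map LinearMap.id T

@[simp] theorem differential_tmul (a : A) (T : M →ₗ[k] M) (p : A) (m : M) :
    differential a T (p ⊗ₜ m) = (p * a) ⊗ₜ[k] m - p ⊗ₜ[k] T m := by
  simp [differential]

/-- Induction principle for `A ⊗ M` along the monomial basis. -/
theorem tensor_induction {P : A ⊗[k] M → Prop} (hadd : ∀ p p', P p → P p' → P (p + p'))
    (hzero : P 0) (h : ∀ x m, P (Q.basis x ⊗ₜ m)) (p : A ⊗[k] M) : P p := by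
  induction p with
  | zero => exact hzero
  | add p p' hp hp' => exact hadd p p' hp hp'
  | tmul a m =>
    rw [← Q.basis.linearCombination_repr a, Finsupp.linearCombination_apply, Finsupp.sum,
      TensorProduct.sum_tmul]
    refine Finset.sum_induction _ P hadd hzero fun x _ => ?_
    rw [TensorProduct.smul_tmul]
    exact h _ _

/-- Two linear maps on `A ⊗ M` agree if they do on basis monomials. -/
theorem tensor_ext {N : Type*} [AddCommGroup N] [Module k N] {f g : A ⊗[k] M →ₗ[k] N}
    (h : ∀ x m, f (Q.basis x ⊗ₜ m) = g (Q.basis x ⊗ₜ m)) : f = g := by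
  refine LinearMap.ext fun p => ?_
  induction p using Q.tensor_induction with
  | hadd p p' hp hp' => rw [map_add, map_add, hp, hp']
  | hzero => rw [map_zero, map_zero]
  | h x m => exact h x m

/-- Coordinates of `A ⊗ M` with respect to the monomial basis. -/
def coords : A ⊗[k] M ≃ₗ[k] (ℕ × ℕ →₀ M) := TensorProduct.equivFinsuppOfBasisLeft Q.basis

@[simp] theorem coords_basis_tmul (x : ℕ × ℕ) (m : M) :
    Q.coords (Q.basis x ⊗ₜ[k] m) = Finsupp.single x m := by
  simp [coords, TensorProduct.equivFinsuppOfBasisLeft_apply_tmul]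

/-- Right multiplication by `t` raises the exponent of `t` by one and introduces no scalar. The
coordinates with positive `t`-exponent already suffice for injectivity. -/
theorem coords_differential (T : M →ₗ[k] M) (p : A ⊗[k] M) (i j : ℕ) :
    Q.coords (differential Q.t T p) (i, j + 1) = Q.coords p (i, j) - T (Q.coords p (i, j + 1)) := by
  induction p using Q.tensor_induction with
  | hadd p p' hp hp' => simp only [map_add, Finsupp.add_apply, hp, hp']; abel
  | hzero => simp
  | h x m =>
    obtain ⟨a, b⟩ := x
    rw [differential_tmul, basis_mul_t, map_sub, coords_basis_tmul, coords_basis_tmul,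
      coords_basis_tmul]
    simp only [Finsupp.sub_apply, Finsupp.single_apply, Prod.mk.injEq, add_left_inj]
    split_ifs <;> simp

/-- A kernel element has coordinates `c (i, j) = T (c (i, j + 1))`, hence `c (i, j) = T ^ N (c (i, j
+ N))`, which vanishes for large `N` by finiteness of the support. Nothing is required of `T`. -/
theorem differential_injective (T : M →ₗ[k] M) :
    Function.Injective (differential Q.t T : A ⊗[k] M →ₗ[A] A ⊗[k] M) := by
  rw [← LinearMap.ker_eq_bot, LinearMap.ker_eq_bot']
  intro p hp
  have h1 : ∀ i j, Q.coords p (i, j) = T (Q.coords p (i, j + 1)) := by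
    intro i j
    have := Q.coords_differential T p i j
    rw [hp, map_zero, Finsupp.zero_apply] at this
    exact (sub_eq_zero.mp this.symm)
  have h2 : ∀ N i j, Q.coords p (i, j) = (T ^ N) (Q.coords p (i, j + N)) := by
    intro N
    induction N with
    | zero => simp
    | succ N ih =>
      intro i j
      rw [ih, h1, pow_succ]
      rfl
  refine Q.coords.map_eq_zero_iff.mp (Finsupp.ext fun x => ?_)
  obtain ⟨N, hN⟩ := (((Q.coords p).support.image Prod.snd).exists_nat_subset_range)
  have : Q.coords p (x.1, x.2 + N) = 0 := by
    by_contra h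
    have := hN (Finset.mem_image_of_mem Prod.snd (Finsupp.mem_support_iff.mpr h))
    rw [Finset.mem_range] at this
    lia
  rw [← Prod.mk.eta (p := x), h2 N, this, map_zero, Finsupp.zero_apply]

/-- The map `s ^ i t ^ j ⊗ m ↦ X ^ i T ^ j m`. -/
def evalT (T : M →ₗ[k] M) : A ⊗[k] M →ₗ[k] (ℕ →₀ M) :=
  Finsupp.lsum k (fun x : ℕ × ℕ => Finsupp.lsingle x.1 ∘ₗ T ^ x.2) ∘ₗ Q.coords.toLinearMap

@[simp] theorem evalT_basis_tmul (T : M →ₗ[k] M) (x : ℕ × ℕ) (m : M) :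
    Q.evalT T (Q.basis x ⊗ₜ[k] m) = Finsupp.single x.1 ((T ^ x.2) m) := by
  simp [evalT]

theorem evalT_surjective (T : M →ₗ[k] M) : Function.Surjective (Q.evalT T) := by
  intro f
  induction f using Finsupp.induction_linear with
  | zero => exact ⟨0, map_zero _⟩
  | add f g hf hg =>
    obtain ⟨p, rfl⟩ := hf
    obtain ⟨p', rfl⟩ := hg
    exact ⟨p + p', map_add _ _ _⟩
  | single i m => exact ⟨Q.basis (i, 0) ⊗ₜ m, by simp⟩

/-- Modulo the image, `s ^ i t ^ j ⊗ m` is congruent to `s ^ i ⊗ T ^ j m`. The cokernel thus becomes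
`M[X]`, modelled as `ℕ →₀ M`, with `X` in the role of `s`. -/
theorem exact_differential_evalT (T : M →ₗ[k] M) :
    Function.Exact (differential Q.t T : A ⊗[k] M →ₗ[A] A ⊗[k] M) (Q.evalT T) := by
  intro p
  constructor
  · intro hp
    -- Each `p` differs from its normal form, supported on the powers of `s`, by an element of the
    -- image.
    have key : ∀ p : A ⊗[k] M, p - Finsupp.lsum k (fun i : ℕ => TensorProduct.mk k A M
        (Q.basis (i, 0))) (Q.evalT T p) ∈ LinearMap.range (differential (M := M) Q.t T) := by
      intro p
      induction p using Q.tensor_induction with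
      | hadd p p' hp hp' =>
        rw [map_add, map_add, add_sub_add_comm]
        exact add_mem hp hp'
      | hzero => simp
      | h x m =>
        obtain ⟨i, j⟩ := x
        rw [evalT_basis_tmul, Finsupp.lsum_single, TensorProduct.mk_apply]
        induction j generalizing m with
        | zero => simp
        | succ j ih =>
          have h1 := ih (T m)
          rw [show (T ^ j) (T m) = (T ^ (j + 1)) m from by rw [pow_succ]; rfl] at h1
          have h2 : Q.basis (i, j + 1) ⊗ₜ[k] m - Q.basis (i, j) ⊗ₜ[k] T m ∈
              LinearMap.range (differential (M := M) Q.t T) :=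
            ⟨Q.basis (i, j) ⊗ₜ m, by rw [differential_tmul, basis_mul_t]⟩
          simpa using add_mem h1 h2
    have := key p
    rwa [hp, map_zero, sub_zero] at this
  · rintro ⟨p, rfl⟩
    have : Q.evalT T ∘ₗ (differential Q.t T).restrictScalars k = 0 := by
      refine Q.tensor_ext fun x m => ?_
      simp [basis_mul_t, pow_succ]
    exact LinearMap.congr_fun this p

end FreeResolution

/-! ### The one-variable analogue on `M[X]` -/

section Shift

variable {k : Type v} [Field k] {M : Type w} [AddCommGroup M] [Module k M]

/-- The map `X ^ i m ↦ X ^ (i + 1) m - X ^ i T m`. -/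
def shift (T : M →ₗ[k] M) : (ℕ →₀ M) →ₗ[k] (ℕ →₀ M) :=
  Finsupp.lsum k fun i => Finsupp.lsingle (i + 1) - Finsupp.lsingle i ∘ₗ T

@[simp] theorem shift_single (T : M →ₗ[k] M) (i : ℕ) (m : M) :
    shift T (Finsupp.single i m) = Finsupp.single (i + 1) m - Finsupp.single i (T m) := by
  simp [shift]

theorem shift_apply (T : M →ₗ[k] M) (f : ℕ →₀ M) (i : ℕ) :
    shift T f (i + 1) = f i - T (f (i + 1)) := by
  induction f using Finsupp.induction_linear with
  | zero => simp
  | add f g hf hg => simp only [map_add, Finsupp.add_apply, hf, hg]; abel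
  | single j m =>
    rw [shift_single]
    simp only [Finsupp.sub_apply, Finsupp.single_apply, add_left_inj]
    split_ifs <;> simp

theorem shift_injective (T : M →ₗ[k] M) : Function.Injective (shift T) := by
  rw [← LinearMap.ker_eq_bot, LinearMap.ker_eq_bot']
  intro f hf
  have h1 : ∀ i, f i = T (f (i + 1)) := by
    intro i
    have := shift_apply T f i
    rw [hf, Finsupp.zero_apply] at this
    exact (sub_eq_zero.mp this.symm)
  have h2 : ∀ N i, f i = (T ^ N) (f (i + N)) := by
    intro N
    induction N with
    | zero => simp
    | succ N ih =>
      intro i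
      rw [ih, h1, pow_succ]
      rfl
  refine Finsupp.ext fun i => ?_
  obtain ⟨N, hN⟩ := f.support.exists_nat_subset_range
  have : f (i + N) = 0 := by
    by_contra h
    have := hN (Finsupp.mem_support_iff.mpr h)
    rw [Finset.mem_range] at this
    lia
  rw [h2 N, this, map_zero, Finsupp.zero_apply]

/-- The map `X ^ i m ↦ T ^ i m`. -/
def evalS (T : M →ₗ[k] M) : (ℕ →₀ M) →ₗ[k] M := Finsupp.lsum k fun i => T ^ i

@[simp] theorem evalS_single (T : M →ₗ[k] M) (i : ℕ) (m : M) :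
    evalS T (Finsupp.single i m) = (T ^ i) m := by
  simp [evalS]

/-- This is division by `X - T`: modulo the image, `X ^ i m` is congruent to `T ^ i m`. -/
theorem exact_shift_evalS (T : M →ₗ[k] M) : Function.Exact (shift T) (evalS T) := by
  intro f
  constructor
  · intro hf
    have key : ∀ f, f - Finsupp.single 0 (evalS T f) ∈ LinearMap.range (shift T) := by
      intro f
      induction f using Finsupp.induction_linear with
      | zero => simp
      | add f g hf hg =>
        rw [map_add, Finsupp.single_add, add_sub_add_comm]
        exact add_mem hf hg
      | single i m =>
        rw [evalS_single]
        induction i generalizing m with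
        | zero => simp
        | succ i ih =>
          have h1 := ih (T m)
          rw [show (T ^ i) (T m) = (T ^ (i + 1)) m from by rw [pow_succ]; rfl] at h1
          have h2 : Finsupp.single (i + 1) m - Finsupp.single i (T m) ∈ LinearMap.range (shift T) :=
            ⟨Finsupp.single i m, by rw [shift_single]⟩
          simpa using add_mem h1 h2
    have := key f
    rwa [hf, Finsupp.single_zero, sub_zero] at this
  · rintro ⟨f, rfl⟩
    have : evalS T ∘ₗ shift T = 0 := by
      refine Finsupp.lhom_ext fun i m => ?_
      simp [pow_succ]
    exact LinearMap.congr_fun this f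

end Shift

end QuantumPlane

/-- A short exact sequence of modules gives a short exact sequence in the category of modules. -/
theorem ModuleCat.shortExact_moduleCatMk {R : Type u} [Ring R] {X Y Z : Type v} [AddCommGroup X]
    [AddCommGroup Y] [AddCommGroup Z] [Module R X] [Module R Y] [Module R Z] {f : X →ₗ[R] Y}
    {g : Y →ₗ[R] Z} (hf : Function.Injective f) (hg : Function.Surjective g)
    (h : Function.Exact f g) :
    (ShortComplex.moduleCatMk f g h.linearMap_comp_eq_zero).ShortExact :=
  ModuleCat.shortComplex_shortExact _ h hf hg

namespace QuantumPlane

/-! ### Global dimension at most two -/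

section GlobalDimension

variable {k : Type v} {A : Type u} [Field k] [Ring A] [Algebra k A] (Q : QuantumPlane k A)
variable (M : Type u) [AddCommGroup M] [Module k M]

/-- The quotient of `A ⊗ M` by the image of `p ⊗ m ↦ p t ⊗ m - p ⊗ T m`. -/
abbrev Coker (T : M →ₗ[k] M) : Type u :=
  (A ⊗[k] M) ⧸ LinearMap.range (differential (M := M) Q.t T)

/-- `M` is free over the field `k`, so `A ⊗ M` is free over `A`, and the injective differential is a
free resolution of length one. -/
theorem hasProjectiveDimensionLT_coker (T : M →ₗ[k] M) :
    HasProjectiveDimensionLT (ModuleCat.of A (Q.Coker M T)) 2 := by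
  have hP : Projective (ModuleCat.of A (A ⊗[k] M)) :=
    (IsProjective.iff_projective _).mp inferInstance
  exact (ModuleCat.shortExact_moduleCatMk (Q.differential_injective T)
    (Submodule.mkQ_surjective _) (LinearMap.exact_map_mkQ_range _)).hasProjectiveDimensionLT_X₃ 1
    (inferInstanceAs (HasProjectiveDimensionLT (ModuleCat.of A (A ⊗[k] M)) 1))
    (inferInstanceAs (HasProjectiveDimensionLT (ModuleCat.of A (A ⊗[k] M)) (1 + 1)))

variable [Module A M] [IsScalarTower k A M]

/-- The action map `A ⊗ M → M`. -/
def actionMap : A ⊗[k] M →ₗ[A] M :=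
  TensorProduct.AlgebraTensorModule.lift
    { toFun := fun a => Algebra.lsmul k k M a
      map_add' := fun a b => map_add _ a b
      map_smul' := fun a b => by ext m; simp }

@[simp] theorem actionMap_tmul (a : A) (m : M) : actionMap M (a ⊗ₜ[k] m) = a • m := by
  simp [actionMap]

theorem lsmul_pow_apply (a : A) (j : ℕ) (m : M) : (Algebra.lsmul k k M a ^ j) m = a ^ j • m := by
  rw [← map_pow]; rfl

theorem evalS_evalT (p : A ⊗[k] M) :
    evalS (Algebra.lsmul k k M Q.s) (Q.evalT (Algebra.lsmul k k M Q.t) p) = actionMap M p := by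
  have : evalS (Algebra.lsmul k k M Q.s) ∘ₗ Q.evalT (Algebra.lsmul k k M Q.t) =
      (actionMap M).restrictScalars k := by
    refine Q.tensor_ext fun x m => ?_
    simp [lsmul_pow_apply, smul_smul, ← basis_apply]
  exact LinearMap.congr_fun this p

/-- In the model `M[X]` the differential for `s` becomes `shift`. Since `t ^ j s = μ ^ j s t ^ j`,
both of its terms acquire the same factor `μ ^ j`; absorbing it into the evaluation replaces `t` by
`μ t` on the source. -/
theorem evalT_differential_s (p : A ⊗[k] M) :
    Q.evalT (Algebra.lsmul k k M Q.t) (differential Q.s (Algebra.lsmul k k M Q.s) p) =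
      shift (Algebra.lsmul k k M Q.s) (Q.evalT (Q.μ • Algebra.lsmul k k M Q.t) p) := by
  have : Q.evalT (Algebra.lsmul k k M Q.t) ∘ₗ
      (differential Q.s (Algebra.lsmul k k M Q.s)).restrictScalars k =
      shift (Algebra.lsmul k k M Q.s) ∘ₗ Q.evalT (Q.μ • Algebra.lsmul k k M Q.t) := by
    refine Q.tensor_ext fun x m => ?_
    have h : Q.t ^ x.2 • Q.s • m = Q.μ ^ x.2 • Q.s • Q.t ^ x.2 • m := by
      rw [smul_smul, t_pow_mul_s, smul_assoc, mul_smul]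
    simp [basis_mul_s, ← TensorProduct.smul_tmul', lsmul_pow_apply, smul_pow, h]
  exact LinearMap.congr_fun this p

/-- The map between cokernels induced by `p ⊗ m ↦ p s ⊗ m - p ⊗ s m`. -/
def cokerMap : Q.Coker M (Q.μ • Algebra.lsmul k k M Q.t) →ₗ[A] Q.Coker M (Algebra.lsmul k k M Q.t) :=
  Submodule.mapQ _ _ (differential Q.s (Algebra.lsmul k k M Q.s)) <| by
    intro p hp
    rw [Submodule.mem_comap]
    refine (Q.exact_differential_evalT _ _).mp ?_
    rw [evalT_differential_s, (Q.exact_differential_evalT _ _).mpr hp, map_zero]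

/-- The map to `M` induced by the action. -/
def cokerAction : Q.Coker M (Algebra.lsmul k k M Q.t) →ₗ[A] M :=
  Submodule.liftQ _ (actionMap M) <| by
    intro p hp
    rw [LinearMap.mem_ker, ← evalS_evalT, (Q.exact_differential_evalT _ _).mpr hp, map_zero]

/-- Through `evalT`, the sequence `0 → Coker (μ t) → Coker t → M → 0` is the sequence of `shift` and
`evalS`, so its exactness is inherited from there. -/
theorem cokerMap_injective : Function.Injective (Q.cokerMap M) := by
  rw [← LinearMap.ker_eq_bot, LinearMap.ker_eq_bot']
  intro p hp
  obtain ⟨p, rfl⟩ := Submodule.mkQ_surjective _ p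
  rw [cokerMap, Submodule.mkQ_apply, Submodule.mapQ_apply, Submodule.Quotient.mk_eq_zero] at hp
  have h := (Q.exact_differential_evalT _ _).mpr hp
  rw [evalT_differential_s, ← map_zero (shift (Algebra.lsmul k k M Q.s))] at h
  rw [Submodule.mkQ_apply, Submodule.Quotient.mk_eq_zero]
  exact (Q.exact_differential_evalT _ _).mp (shift_injective _ h)

theorem cokerAction_surjective : Function.Surjective (Q.cokerAction M) := fun m =>
  ⟨Submodule.Quotient.mk (1 ⊗ₜ m), by simp [cokerAction]⟩

theorem exact_cokerMap_cokerAction : Function.Exact (Q.cokerMap M) (Q.cokerAction M) := by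
  intro p
  obtain ⟨p, rfl⟩ := Submodule.mkQ_surjective _ p
  constructor
  · intro hp
    rw [cokerAction, Submodule.mkQ_apply, Submodule.liftQ_apply, ← Q.evalS_evalT] at hp
    obtain ⟨f, hf⟩ := (exact_shift_evalS _ _).mp hp
    obtain ⟨p', rfl⟩ := Q.evalT_surjective (Q.μ • Algebra.lsmul k k M Q.t) f
    refine ⟨Submodule.Quotient.mk p', ?_⟩
    rw [cokerMap, Submodule.mapQ_apply, Submodule.mkQ_apply, Submodule.Quotient.eq]
    refine (Q.exact_differential_evalT _ _).mp ?_
    rw [map_sub, evalT_differential_s, hf, sub_self]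
  · rintro ⟨p', hp'⟩
    obtain ⟨p', rfl⟩ := Submodule.mkQ_surjective _ p'
    rw [← hp', cokerMap, cokerAction, Submodule.mkQ_apply, Submodule.mapQ_apply,
      Submodule.liftQ_apply, ← Q.evalS_evalT, evalT_differential_s]
    exact (exact_shift_evalS _).apply_apply_eq_zero _

/-- Modules over a quantum plane have projective dimension at most two. -/
theorem hasProjectiveDimensionLT (Q : QuantumPlane k A) :
    HasProjectiveDimensionLT (ModuleCat.of A M) 3 :=
  (ModuleCat.shortExact_moduleCatMk (Q.cokerMap_injective M) (Q.cokerAction_surjective M)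
    (Q.exact_cokerMap_cokerAction M)).hasProjectiveDimensionLT_X₃ 2
    (Q.hasProjectiveDimensionLT_coker M _)
    (@hasProjectiveDimensionLT_of_ge _ _ _ _ 2 3 (by lia)
      (Q.hasProjectiveDimensionLT_coker M (Algebra.lsmul k k M Q.t)))

theorem globalDimension_le (Q : QuantumPlane k A) : ASRegular.globalDimension A ≤ 2 := by
  refine iSup_le fun M => ?_
  let _ : Module k M := Module.compHom M (algebraMap k A)
  have : IsScalarTower k A M := ⟨fun a b m => by
    rw [Algebra.smul_def, mul_smul]; rfl⟩
  exact (projectiveDimension_le_iff M 2).mpr (Q.hasProjectiveDimensionLT M)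

end GlobalDimension

end QuantumPlane

namespace QuantumPlane

/-! ### Gradings of a quantum plane -/

section Grading

variable {k : Type v} {A : Type u} [Field k] [Ring A] [Algebra k A] (Q : QuantumPlane k A)

/-- The subspaces `𝒜 i` form a grading in which `s` and `t` are homogeneous of degrees `d`
and `e`. -/
structure IsGrading (𝒜 : ℕ → Submodule k A) (d e : ℕ) : Prop where
  gradedMonoid : SetLike.GradedMonoid 𝒜
  iSupIndep : iSupIndep 𝒜
  s_mem : Q.s ∈ 𝒜 d
  t_mem : Q.t ∈ 𝒜 e
  d_pos : 0 < d
  e_pos : 0 < e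

variable {Q} {𝒜 : ℕ → Submodule k A} {d e : ℕ} (h : Q.IsGrading 𝒜 d e)
include h

theorem IsGrading.basis_mem (x : ℕ × ℕ) : Q.basis x ∈ 𝒜 (x.1 * d + x.2 * e) := by
  have := h.gradedMonoid
  rw [← Prod.mk.eta (p := x), basis_apply]
  exact SetLike.mul_mem_graded (SetLike.pow_mem_graded x.1 h.s_mem)
    (SetLike.pow_mem_graded x.2 h.t_mem)

/-- Independence of the pieces leaves no choice: write `f` in `𝒜 m` as a combination of monomials of
degree `m` plus one of monomials of other degrees. The second part lies both in `𝒜 m` and in the sum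
of the other pieces, so it is zero. -/
theorem IsGrading.eq_span (m : ℕ) :
    𝒜 m = Submodule.span k (Q.basis '' {x | x.1 * d + x.2 * e = m}) := by
  have hle : Submodule.span k (Q.basis '' {x | x.1 * d + x.2 * e = m}) ≤ 𝒜 m := by
    rw [Submodule.span_le]
    rintro _ ⟨x, hx, rfl⟩
    exact (show _ = m from hx) ▸ h.basis_mem x
  refine le_antisymm (fun f hf => ?_) hle
  have htop : Submodule.span k (Q.basis '' {x | x.1 * d + x.2 * e = m}) ⊔
      Submodule.span k (Q.basis '' {x | x.1 * d + x.2 * e = m}ᶜ) = ⊤ := by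
    rw [← Submodule.span_union, ← Set.image_union, Set.union_compl_self, Set.image_univ,
      Q.basis.span_eq]
  obtain ⟨f₁, h₁, f₂, h₂, rfl⟩ := Submodule.mem_sup.mp (htop ▸ Submodule.mem_top : f ∈ _)
  have h₃ : f₂ ∈ ⨆ j, ⨆ _ : j ≠ m, 𝒜 j := by
    refine (Submodule.span_le.mpr ?_) h₂
    rintro _ ⟨x, hx, rfl⟩
    exact Submodule.mem_iSup_of_mem _ (Submodule.mem_iSup_of_mem hx (h.basis_mem x))
  have h₄ : f₂ ∈ 𝒜 m := by simpa using sub_mem hf (hle h₁)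
  rw [(Submodule.disjoint_def.mp (h.iSupIndep m)) f₂ h₄ h₃, add_zero]
  exact h₁

theorem IsGrading.isConnectedGraded : ASRegular.IsConnectedGraded k 𝒜 where
  nontrivial := ⟨Q.basis (0, 0), 0, Q.basis.ne_zero _⟩
  gradedMonoid := h.gradedMonoid
  isInternal := by
    rw [DirectSum.isInternal_submodule_iff_iSupIndep_and_iSup_eq_top]
    refine ⟨h.iSupIndep, ?_⟩
    rw [eq_top_iff, ← Q.basis.span_eq, Submodule.span_le]
    rintro _ ⟨x, rfl⟩
    exact Submodule.mem_iSup_of_mem _ (h.basis_mem x)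
  zero_eq := by
    have : {x : ℕ × ℕ | x.1 * d + x.2 * e = 0} = {(0, 0)} := by
      ext ⟨a, b⟩
      simp [h.d_pos.ne', h.e_pos.ne']
    rw [h.eq_span, this, Set.image_singleton, basis_zero, Submodule.one_eq_span]

end Grading

/-! ### Finite Gelfand–Kirillov dimension -/

section GKDimension

variable {k : Type v} {A : Type u} [Field k] [Ring A] [Algebra k A] (Q : QuantumPlane k A)

/-- The span of the monomials of total degree at most `N`. -/
def filtration (N : ℕ) : Submodule k A := Submodule.span k (Q.basis '' {x | x.1 + x.2 ≤ N})

theorem filtration_mono {N N' : ℕ} (h : N ≤ N') : Q.filtration N ≤ Q.filtration N' :=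
  Submodule.span_mono (Set.image_mono fun _ hx => le_trans hx h)

theorem filtration_mul_le (N N' : ℕ) :
    Q.filtration N * Q.filtration N' ≤ Q.filtration (N + N') := by
  rw [filtration, filtration, Submodule.span_mul_span, Submodule.span_le]
  rintro _ ⟨_, ⟨x, hx, rfl⟩, _, ⟨y, hy, rfl⟩, rfl⟩
  change Q.basis (x.1, x.2) * Q.basis (y.1, y.2) ∈ Q.filtration (N + N')
  rw [basis_mul_basis]
  refine Submodule.smul_mem _ _ (Submodule.subset_span ⟨_, ?_, rfl⟩)
  simp only [Set.mem_ofPred_eq] at hx hy ⊢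
  lia

theorem filtration_pow_le (N m : ℕ) : Q.filtration N ^ m ≤ Q.filtration (N * m) := by
  induction m with
  | zero =>
    rw [pow_zero, Submodule.one_le]
    exact Submodule.subset_span ⟨(0, 0), by simp, Q.basis_zero⟩
  | succ m ih =>
    rw [pow_succ, mul_add, mul_one]
    exact (mul_le_mul' ih le_rfl).trans (Q.filtration_mul_le _ _)

theorem exists_mem_filtration (a : A) : ∃ N, a ∈ Q.filtration N := by
  have : a ∈ Submodule.span k (Set.range Q.basis) := Q.basis.mem_span a
  induction this using Submodule.span_induction with
  | mem _ hx =>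
    obtain ⟨x, rfl⟩ := hx
    exact ⟨x.1 + x.2, Submodule.subset_span ⟨x, by simp, rfl⟩⟩
  | zero => exact ⟨0, zero_mem _⟩
  | add a b _ _ ha hb =>
    obtain ⟨N, hN⟩ := ha
    obtain ⟨N', hN'⟩ := hb
    exact ⟨max N N', add_mem (Q.filtration_mono (le_max_left _ _) hN)
      (Q.filtration_mono (le_max_right _ _) hN')⟩
  | smul c a _ ha =>
    obtain ⟨N, hN⟩ := ha
    exact ⟨N, Submodule.smul_mem _ _ hN⟩

theorem exists_le_filtration {V : Submodule k A} (hV : V.FG) : ∃ N, V ≤ Q.filtration N := by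
  obtain ⟨S, rfl⟩ := hV
  choose f hf using Q.exists_mem_filtration
  refine ⟨S.sup f, Submodule.span_le.mpr fun a ha => ?_⟩
  exact Q.filtration_mono (Finset.le_sup (f := f) ha) (hf a)

theorem finrank_le_of_le_filtration {V : Submodule k A} {N : ℕ} (hV : V ≤ Q.filtration N) :
    Module.finrank k V ≤ (N + 1) ^ 2 := by
  classical
  have hle : V ≤ Submodule.span k
      (((Finset.range (N + 1) ×ˢ Finset.range (N + 1)).image Q.basis : Finset A) : Set A) := by
    refine hV.trans (Submodule.span_mono ?_)
    rintro _ ⟨x, hx, rfl⟩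
    simp only [Set.mem_ofPred_eq] at hx
    exact Finset.mem_image_of_mem _ (Finset.mem_product.mpr
      ⟨Finset.mem_range.mpr (by lia), Finset.mem_range.mpr (by lia)⟩)
  refine (Submodule.finrank_mono hle).trans ((finrank_span_finset_le_card _).trans ?_)
  refine Finset.card_image_le.trans ?_
  simp [sq]

/-- The dimension of `(k + V) ^ m` is at most `(N * m + 1) ^ 2`, so its growth is at most quadratic.
Only finiteness is needed, and the crude bound `m ^ 4` avoids a limit computation. -/
theorem gkDimension_le (Q : QuantumPlane k A) : ASRegular.gkDimension k A ≤ 4 := by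
  refine iSup₂_le fun V hV => ?_
  obtain ⟨N, hN⟩ := Q.exists_le_filtration hV
  refine limsup_le_of_le (by isBoundedDefault) ?_
  -- For `m ≥ N + 2` one has `N * m + 1 ≤ m * m`, and `log m` is positive.
  filter_upwards [eventually_ge_atTop (N + 2)] with m hm
  have h1 : 1 ⊔ V ≤ Q.filtration N := sup_le (by
    rw [Submodule.one_le]
    exact Submodule.subset_span ⟨(0, 0), by simp, Q.basis_zero⟩) hN
  have h2 : Module.finrank k ↥((1 ⊔ V) ^ m) ≤ m ^ 4 := by
    refine (Q.finrank_le_of_le_filtration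
      ((pow_le_pow_left' h1 m).trans (Q.filtration_pow_le N m))).trans ?_
    calc (N * m + 1) ^ 2 ≤ (m * m) ^ 2 := by
          refine Nat.pow_le_pow_left ?_ 2
          nlinarith
      _ = m ^ 4 := by ring
  have hm1 : (1 : ℝ) < m := by exact_mod_cast (by lia : 1 < m)
  have h3 : Real.log (Module.finrank k ↥((1 ⊔ V) ^ m)) ≤ 4 * Real.log m := by
    rcases Nat.eq_zero_or_pos (Module.finrank k ↥((1 ⊔ V) ^ m)) with h0 | h0
    · rw [h0, Nat.cast_zero, Real.log_zero]
      exact mul_nonneg (by norm_num) (Real.log_nonneg hm1.le)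
    · calc Real.log (Module.finrank k ↥((1 ⊔ V) ^ m)) ≤ Real.log ((m : ℝ) ^ 4) :=
            Real.log_le_log (by exact_mod_cast h0) (by exact_mod_cast h2)
        _ = 4 * Real.log m := by rw [Real.log_pow]; norm_num
  rw [show (4 : ENNReal) = ENNReal.ofReal 4 by simp]
  exact ENNReal.ofReal_le_ofReal ((div_le_iff₀ (Real.log_pos hm1)).mpr h3)

end GKDimension

end QuantumPlane

namespace QuantumPlane

/-! ### Normality of `s` and the augmentation -/

section Normal

variable {k : Type v} {A : Type u} [Field k] [Ring A] [Algebra k A] (Q : QuantumPlane k A)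

theorem mem_span_basis_iff (S : Set (ℕ × ℕ)) (a : A) :
    a ∈ Submodule.span k (Q.basis '' S) ↔ ∀ x ∉ S, Q.basis.repr a x = 0 := by
  rw [Q.basis.mem_span_image]
  refine ⟨fun h x hx => ?_, fun h x hx => ?_⟩
  · by_contra h'
    exact hx (h (Finsupp.mem_support_iff.mpr h'))
  · by_contra h'
    exact Finsupp.mem_support_iff.mp hx (h x h')

/-- Coordinates of a linear map which permutes the basis monomials injectively up to scalars. -/
theorem repr_of_apply_basis {F : A →ₗ[k] A} {φ : ℕ × ℕ → ℕ × ℕ} {c : ℕ × ℕ → k}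
    (hφ : Function.Injective φ) (hF : ∀ x, F (Q.basis x) = c x • Q.basis (φ x)) (a : A) (x : ℕ × ℕ) :
    Q.basis.repr (F a) (φ x) = c x * Q.basis.repr a x := by
  have : Q.basis.coord (φ x) ∘ₗ F = c x • Q.basis.coord x := by
    refine Q.basis.ext fun y => ?_
    simp only [LinearMap.comp_apply, hF, map_smul, LinearMap.smul_apply, Module.Basis.coord_apply,
      Module.Basis.repr_self, Finsupp.single_apply, hφ.eq_iff, smul_eq_mul]
    split_ifs with h
    · rw [h]
    · simp
  exact LinearMap.congr_fun this a

theorem repr_s_mul (a : A) (i j : ℕ) :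
    Q.basis.repr (Q.s * a) (i + 1, j) = Q.basis.repr a (i, j) := by
  have := Q.repr_of_apply_basis (F := LinearMap.mulLeft k Q.s) (φ := fun x => (x.1 + 1, x.2))
    (c := fun _ => 1) (fun x y h => by aesop)
    (fun x => by simp [s_mul_basis]) a (i, j)
  simpa using this

theorem repr_mul_s (a : A) (i j : ℕ) :
    Q.basis.repr (a * Q.s) (i + 1, j) = Q.μ ^ j * Q.basis.repr a (i, j) :=
  Q.repr_of_apply_basis (F := LinearMap.mulRight k Q.s) (φ := fun x => (x.1 + 1, x.2))
    (c := fun x => Q.μ ^ x.2) (fun x y h => by aesop)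
    (fun x => by simp [basis_mul_s]) a (i, j)

theorem repr_t_mul (a : A) (i j : ℕ) :
    Q.basis.repr (Q.t * a) (i, j + 1) = Q.μ ^ i * Q.basis.repr a (i, j) :=
  Q.repr_of_apply_basis (F := LinearMap.mulLeft k Q.t) (φ := fun x => (x.1, x.2 + 1))
    (c := fun x => Q.μ ^ x.1) (fun x y h => by aesop)
    (fun x => by simp [t_mul_basis]) a (i, j)

theorem repr_mul_t (a : A) (i j : ℕ) :
    Q.basis.repr (a * Q.t) (i, j + 1) = Q.basis.repr a (i, j) := by
  have := Q.repr_of_apply_basis (F := LinearMap.mulRight k Q.t) (φ := fun x => (x.1, x.2 + 1))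
    (c := fun _ => 1) (fun x y h => by aesop)
    (fun x => by simp [basis_mul_t]) a (i, j)
  simpa using this

theorem eq_zero_of_s_mul {a : A} (h : Q.s * a = 0) : a = 0 :=
  Q.basis.ext_elem fun x => by simpa [h] using (Q.repr_s_mul a x.1 x.2).symm

theorem eq_zero_of_mul_s {a : A} (h : a * Q.s = 0) : a = 0 :=
  Q.basis.ext_elem fun x => by simpa [h, Q.μ_ne_zero] using (Q.repr_mul_s a x.1 x.2).symm

/-- Together with `exists_mul_s_iff` this says `s A = A s`: both are spanned by the monomials in
which `s` occurs, so `s` is a normal element. -/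
theorem exists_s_mul_iff {a : A} : (∃ b, Q.s * b = a) ↔ ∀ j, Q.basis.repr a (0, j) = 0 := by
  constructor
  · rintro ⟨b, rfl⟩ j
    have : Q.basis.coord (0, j) ∘ₗ LinearMap.mulLeft k Q.s = 0 := by
      refine Q.basis.ext fun y => ?_
      simp [s_mul_basis]
    exact LinearMap.congr_fun this b
  · intro h
    have h1 : a ∈ Submodule.span k (Q.basis '' {x | x.1 ≠ 0}) := by
      rw [mem_span_basis_iff]
      rintro ⟨i, j⟩ hx
      obtain rfl : i = 0 := by simpa using hx
      exact h j
    refine (show Submodule.span k _ ≤ LinearMap.range (LinearMap.mulLeft k Q.s) from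
      Submodule.span_le.mpr ?_) h1
    rintro _ ⟨⟨i, j⟩, hx, rfl⟩
    obtain ⟨i, rfl⟩ := Nat.exists_eq_succ_of_ne_zero (show i ≠ 0 from hx)
    exact ⟨Q.basis (i, j), by simp [s_mul_basis]⟩

theorem exists_mul_s_iff {a : A} : (∃ b, b * Q.s = a) ↔ ∀ j, Q.basis.repr a (0, j) = 0 := by
  constructor
  · rintro ⟨b, rfl⟩ j
    have : Q.basis.coord (0, j) ∘ₗ LinearMap.mulRight k Q.s = 0 := by
      refine Q.basis.ext fun y => ?_
      simp [basis_mul_s]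
    exact LinearMap.congr_fun this b
  · intro h
    have h1 : a ∈ Submodule.span k (Q.basis '' {x | x.1 ≠ 0}) := by
      rw [mem_span_basis_iff]
      rintro ⟨i, j⟩ hx
      obtain rfl : i = 0 := by simpa using hx
      exact h j
    refine (show Submodule.span k _ ≤ LinearMap.range (LinearMap.mulRight k Q.s) from
      Submodule.span_le.mpr ?_) h1
    rintro _ ⟨⟨i, j⟩, hx, rfl⟩
    obtain ⟨i, rfl⟩ := Nat.exists_eq_succ_of_ne_zero (show i ≠ 0 from hx)
    refine ⟨(Q.μ ^ j)⁻¹ • Q.basis (i, j), ?_⟩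
    simp [basis_mul_s, smul_smul, Q.μ_ne_zero]

/-- The augmentation, the constant coefficient. -/
def augmentation : A →ₗ[k] k := Q.basis.coord (0, 0)

theorem augmentation_basis (x : ℕ × ℕ) :
    Q.augmentation (Q.basis x) = if x = (0, 0) then 1 else 0 := by
  simp [augmentation, Finsupp.single_apply]

theorem augmentation_mul (a b : A) :
    Q.augmentation (a * b) = Q.augmentation a * Q.augmentation b := by
  have : (LinearMap.mul k A).compr₂ Q.augmentation =
      (LinearMap.mul k k).compl₁₂ Q.augmentation Q.augmentation := by
    refine Q.basis.ext fun ⟨x, x'⟩ => Q.basis.ext fun ⟨y, y'⟩ => ?_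
    simp only [LinearMap.compr₂_apply, LinearMap.compl₁₂_apply, LinearMap.mul_apply',
      basis_mul_basis, map_smul, augmentation_basis, Prod.mk.injEq, smul_eq_mul]
    by_cases hx : x = 0 <;> by_cases hx' : x' = 0 <;> by_cases hy : y = 0 <;>
      by_cases hy' : y' = 0 <;> simp [hx, hx', hy, hy']
  exact LinearMap.congr_fun₂ this a b

theorem augmentation_s : Q.augmentation Q.s = 0 := by
  rw [← basis_s, augmentation_basis]; simp

theorem augmentation_t : Q.augmentation Q.t = 0 := by
  rw [← basis_t, augmentation_basis]; simp

theorem exists_of_augmentation_eq_zero {a : A} (h : Q.augmentation a = 0) :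
    ∃ b c, a = Q.s * b + Q.t * c := by
  have h1 : a ∈ Submodule.span k (Q.basis '' {x | x ≠ (0, 0)}) := by
    rw [mem_span_basis_iff]
    intro x hx
    obtain rfl : x = (0, 0) := by simpa using hx
    exact h
  have h2 : a ∈ LinearMap.range (LinearMap.mulLeft k Q.s) ⊔
      LinearMap.range (LinearMap.mulLeft k Q.t) := by
    refine (Submodule.span_le.mpr ?_) h1
    rintro _ ⟨⟨i, j⟩, hx, rfl⟩
    rcases i with _ | i
    · rcases j with _ | j
      · simp at hx
      · refine Submodule.mem_sup_right ⟨Q.basis (0, j), ?_⟩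
        simp [t_mul_basis]
    · refine Submodule.mem_sup_left ⟨Q.basis (i, j), ?_⟩
      simp [s_mul_basis]
  obtain ⟨_, ⟨b, rfl⟩, _, ⟨c, rfl⟩, hbc⟩ := Submodule.mem_sup.mp h2
  exact ⟨b, c, hbc.symm⟩

/-- The term in `s A` moves to `A s` by normality, and the term in `t A` moves to `A t` because `t`
commutes with each monomial up to a scalar. -/
theorem exists_of_augmentation_eq_zero' {a : A} (h : Q.augmentation a = 0) :
    ∃ b c, a = b * Q.s + c * Q.t := by
  obtain ⟨b, c, rfl⟩ := Q.exists_of_augmentation_eq_zero h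
  obtain ⟨b', hb'⟩ := Q.exists_mul_s_iff.mpr (Q.exists_s_mul_iff.mp ⟨b, rfl⟩)
  have h2 : Q.t * c ∈ LinearMap.range (LinearMap.mulRight k Q.s) ⊔
      LinearMap.range (LinearMap.mulRight k Q.t) := by
    have : LinearMap.mulLeft k Q.t c ∈ (Submodule.span k (Set.range Q.basis)).map
      (LinearMap.mulLeft k Q.t) := Submodule.mem_map_of_mem (Q.basis.mem_span c)
    rw [Submodule.map_span] at this
    refine (Submodule.span_le.mpr ?_) this
    rintro _ ⟨_, ⟨x, rfl⟩, rfl⟩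
    refine Submodule.mem_sup_right ⟨Q.μ ^ x.1 • Q.basis x, ?_⟩
    simp [t_mul_basis, basis_mul_t]
  obtain ⟨_, ⟨b'', rfl⟩, _, ⟨c', rfl⟩, hbc⟩ := Submodule.mem_sup.mp h2
  refine ⟨b' + b'', c', ?_⟩
  rw [← hb', ← hbc]
  simp only [LinearMap.mulRight_apply]
  noncomm_ring

/-- The degrees of `s` and `t` are positive, so the constants are exactly the part of degree zero.
-/
theorem mem_augmentationIdeal_iff {Q : QuantumPlane k A} {𝒜 : ℕ → Submodule k A} {d e : ℕ}
    (h : Q.IsGrading 𝒜 d e) (a : A) :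
    a ∈ ASRegular.augmentationIdeal 𝒜 ↔ Q.augmentation a = 0 := by
  constructor
  · intro ha
    rw [ASRegular.augmentationIdeal] at ha
    induction ha using Submodule.span_induction with
    | mem a ha =>
      simp only [Set.mem_iUnion] at ha
      obtain ⟨i, hi, ha⟩ := ha
      rw [SetLike.mem_coe, h.eq_span, mem_span_basis_iff] at ha
      exact ha (0, 0) (by simpa using hi.ne)
    | zero => exact map_zero _
    | add a b _ _ ha hb => rw [map_add, ha, hb, add_zero]
    | smul c a _ ha => rw [smul_eq_mul, augmentation_mul, ha, mul_zero]
  · intro ha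
    obtain ⟨b, c, rfl⟩ := Q.exists_of_augmentation_eq_zero' ha
    refine add_mem (Ideal.mul_mem_left _ _ (Ideal.subset_span ?_))
      (Ideal.mul_mem_left _ _ (Ideal.subset_span ?_))
    · exact Set.mem_biUnion h.d_pos h.s_mem
    · exact Set.mem_biUnion h.e_pos h.t_mem

end Normal

end QuantumPlane

namespace QuantumPlane

open Abelian ASRegular

/-! ### Endomorphisms of the left module `A` are right multiplications -/

section RightMul

variable {k : Type v} {A : Type u} [Field k] [Ring A] [Algebra k A]

theorem rightMul_comp (a b : A) : rightMul a ≫ rightMul b = rightMul (a * b) := by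
  ext
  simp [rightMul]

theorem exists_eq_rightMul (f : ModuleCat.of A A ⟶ ModuleCat.of A A) : ∃ a, f = rightMul a :=
  ⟨f.hom 1, by ext; simp [rightMul]⟩

theorem rightMul_injective : Function.Injective (rightMul : A → _) := fun a b h => by
  have := congrArg (fun f => ModuleCat.Hom.hom f 1) h
  simpa [rightMul] using this

theorem rightMul_add (a b : A) : rightMul (a + b) = rightMul a + rightMul b := by
  ext
  simp [rightMul]

theorem mk₀_rightMul_smul (c : k) (a : A) :
    Ext.mk₀ (rightMul (c • a)) = c • Ext.mk₀ (rightMul a) := by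
  rw [← Ext.mk₀_smul]
  refine congrArg _ (ModuleCat.hom_ext (LinearMap.ext_ring ?_))
  change (1 : A) * (c • a) = algebraMap k A c * (1 * a)
  rw [one_mul, one_mul, Algebra.smul_def]

end RightMul

/-! ### The Gorenstein condition and regularity of quantum planes -/

section Gorenstein

variable {k : Type v} {A : Type u} [Field k] [Ring A] [Algebra k A] (Q : QuantumPlane k A)

/-- The left ideal generated by `s`. -/
abbrev sIdeal : Submodule A A := LinearMap.range (LinearMap.toSpanSingleton A A Q.s)

theorem mem_sIdeal_iff (a : A) : a ∈ Q.sIdeal ↔ ∀ j, Q.basis.repr a (0, j) = 0 :=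
  Q.exists_mul_s_iff

theorem mul_t_mem_sIdeal_iff (a : A) : a * Q.t ∈ Q.sIdeal ↔ a ∈ Q.sIdeal := by
  constructor
  · intro h
    rw [mem_sIdeal_iff] at h ⊢
    exact fun j => by rw [← repr_mul_t, h]
  · rintro ⟨b, rfl⟩
    refine ⟨Q.μ⁻¹ • (b * Q.t), ?_⟩
    simp [mul_assoc, Q.t_mul_s, smul_smul, Q.μ_ne_zero]

/-- Left multiplication by `t` is injective on `A / s A`, since it only rescales and shifts the
monomials `t ^ j`. This is what kills `Ext¹ (k, A)`. -/
theorem exists_s_mul_of_t_mul {a b : A} (h : Q.s * b = Q.t * a) : ∃ c, Q.s * c = a := by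
  rw [exists_s_mul_iff]
  intro j
  have := Q.exists_s_mul_iff.mp ⟨b, h⟩ (j + 1)
  simpa [repr_t_mul] using this

/-- The short exact sequence `0 → A → A → A / A s → 0`. -/
def seqS : ShortComplex (ModuleCat.{u} A) :=
  ShortComplex.moduleCatMk (LinearMap.toSpanSingleton A A Q.s) Q.sIdeal.mkQ
    (LinearMap.exact_map_mkQ_range _).linearMap_comp_eq_zero

theorem seqS_shortExact : Q.seqS.ShortExact :=
  ModuleCat.shortExact_moduleCatMk (by
      rw [← LinearMap.ker_eq_bot, LinearMap.ker_eq_bot']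
      exact fun a ha => Q.eq_zero_of_mul_s ha) (Submodule.mkQ_surjective _)
    (LinearMap.exact_map_mkQ_range _)

theorem sIdeal_le_comap :
    Q.sIdeal ≤ Q.sIdeal.comap (LinearMap.toSpanSingleton A A Q.t) := fun a ha =>
  (Q.mul_t_mem_sIdeal_iff a).mpr ha

/-- Right multiplication by `t` on `A / A s`. -/
def mulT : A ⧸ Q.sIdeal →ₗ[A] A ⧸ Q.sIdeal := Submodule.mapQ _ _ _ Q.sIdeal_le_comap

theorem mulT_injective : Function.Injective Q.mulT := by
  rw [← LinearMap.ker_eq_bot, LinearMap.ker_eq_bot']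
  intro a ha
  obtain ⟨a, rfl⟩ := Submodule.mkQ_surjective _ a
  rw [Submodule.mkQ_apply, mulT, Submodule.mapQ_apply, Submodule.Quotient.mk_eq_zero] at ha
  rw [Submodule.mkQ_apply, Submodule.Quotient.mk_eq_zero]
  exact (Q.mul_t_mem_sIdeal_iff a).mp ha

/-- The endomorphism of `seqS` which lifts right multiplication by `t`. -/
def seqSEnd : Q.seqS ⟶ Q.seqS where
  τ₁ := rightMul (Q.μ⁻¹ • Q.t)
  τ₂ := rightMul Q.t
  τ₃ := ModuleCat.ofHom Q.mulT
  -- The factor `μ⁻¹` is forced by the left square: `(μ⁻¹ t) s = s t`.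
  comm₁₂ := by
    change rightMul _ ≫ rightMul Q.s = rightMul Q.s ≫ rightMul _
    rw [rightMul_comp, rightMul_comp, smul_mul_assoc, Q.t_mul_s, smul_smul,
      inv_mul_cancel₀ Q.μ_ne_zero, one_smul]
  comm₂₃ := rfl

/-- The class of `seqS`. -/
def deltaS : Ext (ModuleCat.of A (A ⧸ Q.sIdeal)) (ModuleCat.of A A) 1 :=
  Q.seqS_shortExact.extClass

theorem exists_deltaS_comp_eq (x : Ext (ModuleCat.of A (A ⧸ Q.sIdeal)) (ModuleCat.of A A) 1) :
    ∃ y, Q.deltaS.comp y (add_zero 1) = x := by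
  have : Projective (ModuleCat.of A A) := (IsProjective.iff_projective _).mp inferInstance
  exact Ext.contravariant_sequence_exact₃ Q.seqS_shortExact _ x
    (Ext.eq_zero_of_projective (P := ModuleCat.of A A) _) (add_zero 1)

theorem exists_rightMul_comp_eq {x : Ext (ModuleCat.of A A) (ModuleCat.of A A) 0}
    (hx : Q.deltaS.comp x (add_zero 1) = 0) :
    ∃ y, (Ext.mk₀ (rightMul Q.s)).comp y (zero_add 0) = x :=
  Ext.contravariant_sequence_exact₁ Q.seqS_shortExact _ x (add_zero 1) hx

theorem deltaS_comp_rightMul_comp (x : Ext (ModuleCat.of A A) (ModuleCat.of A A) 0) :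
    Q.deltaS.comp ((Ext.mk₀ (rightMul Q.s)).comp x (zero_add 0)) (add_zero 1) = 0 :=
  Q.seqS_shortExact.extClass_comp_assoc x

theorem mulT_comp_deltaS : (Ext.mk₀ (ModuleCat.ofHom Q.mulT)).comp Q.deltaS (zero_add 1) =
    Q.deltaS.comp (Ext.mk₀ (rightMul (Q.μ⁻¹ • Q.t))) (add_zero 1) :=
  (ShortComplex.ShortExact.extClass_naturality Q.seqS_shortExact Q.seqS_shortExact Q.seqSEnd).symm

/-- Elements of `Ext¹ (A / A s, A)`. -/
def extS : A →ₗ[k] Ext (ModuleCat.of A (A ⧸ Q.sIdeal)) (ModuleCat.of A A) 1 where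
  toFun c := Q.deltaS.comp (Ext.mk₀ (rightMul c)) (add_zero 1)
  map_add' a b := by rw [rightMul_add, Ext.mk₀_add, Ext.comp_add]
  map_smul' c a := by
    rw [RingHom.id_apply, ← Ext.comp_smul, mk₀_rightMul_smul]

theorem extS_apply (c : A) : Q.extS c = Q.deltaS.comp (Ext.mk₀ (rightMul c)) (add_zero 1) := rfl

theorem extS_surjective : Function.Surjective Q.extS := by
  intro x
  obtain ⟨y, rfl⟩ := Q.exists_deltaS_comp_eq x
  obtain ⟨f, rfl⟩ := (Ext.mk₀_bijective _ _).2 y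
  obtain ⟨c, rfl⟩ := exists_eq_rightMul f
  exact ⟨c, rfl⟩

/-- With `extS_surjective` this identifies `Ext¹ (A / A s, A)` with `A / s A`: a class vanishes
exactly when its representative factors through right multiplication by `s` on the first copy of
`A`. -/
theorem extS_eq_zero_iff (c : A) : Q.extS c = 0 ↔ ∃ b, Q.s * b = c := by
  constructor
  · intro h
    obtain ⟨y, hy⟩ := Q.exists_rightMul_comp_eq h
    obtain ⟨f, rfl⟩ := (Ext.mk₀_bijective _ _).2 y
    obtain ⟨b, rfl⟩ := exists_eq_rightMul f
    rw [Ext.mk₀_comp_mk₀, rightMul_comp] at hy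
    exact ⟨b, rightMul_injective ((Ext.mk₀_bijective _ _).1 hy)⟩
  · rintro ⟨b, rfl⟩
    rw [extS_apply, ← rightMul_comp, ← Ext.mk₀_comp_mk₀, deltaS_comp_rightMul_comp]

/-- By naturality of the extension class under `seqSEnd`, the map induced by right multiplication by
`t` becomes left multiplication by `μ⁻¹ t` on `A / s A`. -/
theorem mulT_comp_extS (c : A) :
    (Ext.mk₀ (ModuleCat.ofHom Q.mulT)).comp (Q.extS c) (zero_add 1) =
      Q.extS (Q.μ⁻¹ • (Q.t * c)) := by
  rw [extS_apply, ← Ext.comp_assoc_of_third_deg_zero, mulT_comp_deltaS,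
    Ext.comp_assoc_of_third_deg_zero, Ext.mk₀_comp_mk₀, rightMul_comp, smul_mul_assoc, extS_apply]

/-- There are no nonzero maps to `A` from a cyclic module killed by `s`. -/
theorem ext_zero_eq_zero {I : Submodule A A} (hI : Q.s ∈ I)
    (x : Ext (ModuleCat.of A (A ⧸ I)) (ModuleCat.of A A) 0) : x = 0 := by
  obtain ⟨f, rfl⟩ := (Ext.mk₀_bijective _ _).2 x
  rw [Ext.mk₀_eq_zero_iff]
  -- Here `s f(1) = f(s) = 0`, and `s` is left regular.
  have h1 : f.hom (Submodule.Quotient.mk 1) = 0 := by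
    refine Q.eq_zero_of_s_mul ?_
    rw [← smul_eq_mul, ← map_smul, ← Submodule.Quotient.mk_smul, smul_eq_mul, mul_one,
      (Submodule.Quotient.mk_eq_zero _).mpr hI, map_zero]
  ext : 1
  refine Submodule.linearMap_qext _ (LinearMap.ext_ring ?_)
  exact h1

variable {Q} {𝒜 : ℕ → Submodule k A} {d e : ℕ} (h : Q.IsGrading 𝒜 d e)
include h

theorem IsGrading.sIdeal_le : Q.sIdeal ≤ augmentationIdeal 𝒜 := by
  rintro _ ⟨b, rfl⟩
  rw [mem_augmentationIdeal_iff h, LinearMap.toSpanSingleton_apply, smul_eq_mul, augmentation_mul,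
    augmentation_s, mul_zero]

/-- The projection `A / A s → k`. -/
def toTrivial : A ⧸ Q.sIdeal →ₗ[A] A ⧸ augmentationIdeal 𝒜 := Submodule.factor h.sIdeal_le

theorem exact_mulT_toTrivial : Function.Exact Q.mulT (toTrivial h) := by
  intro a
  obtain ⟨a, rfl⟩ := Submodule.mkQ_surjective _ a
  have h1 : toTrivial h (Q.sIdeal.mkQ a) = 0 ↔ Q.augmentation a = 0 := by
    rw [← mem_augmentationIdeal_iff h]
    exact Submodule.Quotient.mk_eq_zero _
  rw [h1]
  constructor
  · intro ha
    obtain ⟨b, c, rfl⟩ := Q.exists_of_augmentation_eq_zero' ha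
    refine ⟨Submodule.Quotient.mk c, ?_⟩
    rw [mulT, Submodule.mapQ_apply, Submodule.mkQ_apply, Submodule.Quotient.eq]
    exact ⟨-b, by simp⟩
  · rintro ⟨c, hc⟩
    obtain ⟨c, rfl⟩ := Submodule.mkQ_surjective _ c
    rw [mulT, Submodule.mkQ_apply, Submodule.mkQ_apply, Submodule.mapQ_apply,
      Submodule.Quotient.eq] at hc
    obtain ⟨b, hb⟩ := hc
    simp only [LinearMap.toSpanSingleton_apply, smul_eq_mul] at hb
    rw [← sub_sub_cancel (c * Q.t) a, ← hb, map_sub, augmentation_mul, augmentation_mul,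
      augmentation_s, augmentation_t]
    simp

/-- The short exact sequence `0 → A / A s → A / A s → k → 0`. -/
def seqT : ShortComplex (ModuleCat.{u} A) :=
  ShortComplex.moduleCatMk Q.mulT (toTrivial h) (exact_mulT_toTrivial h).linearMap_comp_eq_zero

theorem seqT_shortExact : (seqT h).ShortExact :=
  ModuleCat.shortExact_moduleCatMk Q.mulT_injective (Submodule.factor_surjective h.sIdeal_le)
    (exact_mulT_toTrivial h)

/-- The class of `seqT`. -/
def deltaT : Ext (trivialModule 𝒜) (ModuleCat.of A (A ⧸ Q.sIdeal)) 1 :=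
  (seqT_shortExact h).extClass

/-- The morphism `toTrivial` in the category of modules. -/
def trivialπ : ModuleCat.of A (A ⧸ Q.sIdeal) ⟶ trivialModule 𝒜 := ModuleCat.ofHom (toTrivial h)

theorem exists_deltaT_comp_eq {m n : ℕ} (x : Ext (trivialModule 𝒜) (ModuleCat.of A A) n)
    (hx : (Ext.mk₀ (trivialπ h)).comp x (zero_add n) = 0) (hm : 1 + m = n) :
    ∃ y, (deltaT h).comp y hm = x :=
  Ext.contravariant_sequence_exact₃ (seqT_shortExact h) _ x hx hm

theorem exists_mulT_comp_eq {x : Ext (ModuleCat.of A (A ⧸ Q.sIdeal)) (ModuleCat.of A A) 1}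
    (hx : (deltaT h).comp x one_add_one_eq_two = 0) :
    ∃ y, (Ext.mk₀ (ModuleCat.ofHom Q.mulT)).comp y (zero_add 1) = x :=
  Ext.contravariant_sequence_exact₁ (seqT_shortExact h) _ x one_add_one_eq_two hx

theorem deltaT_comp_mulT_comp (x : Ext (ModuleCat.of A (A ⧸ Q.sIdeal)) (ModuleCat.of A A) 1) :
    (deltaT h).comp ((Ext.mk₀ (ModuleCat.ofHom Q.mulT)).comp x (zero_add 1))
      one_add_one_eq_two = 0 :=
  (seqT_shortExact h).extClass_comp_assoc x

theorem mulT_comp_trivialπ : ModuleCat.ofHom Q.mulT ≫ trivialπ h = 0 := (seqT h).zero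

/-- Elements of `Ext² (k, A)`. -/
def extK : A →ₗ[k] Ext (trivialModule 𝒜) (ModuleCat.of A A) 2 where
  toFun c := (deltaT h).comp (Q.extS c) one_add_one_eq_two
  map_add' a b := by rw [map_add, Ext.comp_add]
  map_smul' c a := by rw [map_smul, Ext.comp_smul]; rfl

theorem extK_apply (c : A) : extK h c = (deltaT h).comp (Q.extS c) one_add_one_eq_two := rfl

/-- The next term `Ext² (A / A s, A)` vanishes because `A / A s` has a free resolution of length
one. -/
theorem extK_surjective : Function.Surjective (extK h) := by
  intro x
  have hP : Projective (ModuleCat.of A A) := (IsProjective.iff_projective _).mp inferInstance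
  have hN : HasProjectiveDimensionLT (ModuleCat.of A (A ⧸ Q.sIdeal)) 2 :=
    Q.seqS_shortExact.hasProjectiveDimensionLT_X₃ 1
      (inferInstanceAs (HasProjectiveDimensionLT (ModuleCat.of A A) 1))
      (inferInstanceAs (HasProjectiveDimensionLT (ModuleCat.of A A) (1 + 1)))
  obtain ⟨y, rfl⟩ := exists_deltaT_comp_eq h x
    (Ext.eq_zero_of_hasProjectiveDimensionLT _ 2 le_rfl) one_add_one_eq_two
  obtain ⟨c, rfl⟩ := Q.extS_surjective y
  exact ⟨c, rfl⟩

/-- `Ext² (k, A)` is the cokernel of left multiplication by `μ⁻¹ t` on `A / s A`, that is `A / (s A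
+ t A)`, and the denominator is the kernel of the augmentation. -/
theorem extK_eq_zero_iff (c : A) : extK h c = 0 ↔ Q.augmentation c = 0 := by
  constructor
  · intro hc
    obtain ⟨y, hy⟩ := exists_mulT_comp_eq h hc
    obtain ⟨b, rfl⟩ := Q.extS_surjective y
    rw [mulT_comp_extS, ← sub_eq_zero, ← map_sub, extS_eq_zero_iff] at hy
    obtain ⟨a, ha⟩ := hy
    rw [← sub_sub_cancel (Q.μ⁻¹ • (Q.t * b)) c, ← ha, map_sub, map_smul, augmentation_mul,
      augmentation_mul, augmentation_s, augmentation_t]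
    simp
  · intro hc
    obtain ⟨a, b, rfl⟩ := Q.exists_of_augmentation_eq_zero hc
    have h1 := Q.mulT_comp_extS (Q.μ • b)
    rw [mul_smul_comm, smul_smul, inv_mul_cancel₀ Q.μ_ne_zero, one_smul] at h1
    rw [extK_apply, map_add, (Q.extS_eq_zero_iff _).mpr ⟨a, rfl⟩, zero_add, ← h1,
      deltaT_comp_mulT_comp]

/-- The pullback to `Ext¹ (A / A s, A) = A / s A` is killed by the injective left multiplication by
`μ⁻¹ t`, so it is zero. The class then comes from `Hom (A / A s, A)`, which is zero. -/
theorem ext_one_eq_zero (x : Ext (trivialModule 𝒜) (ModuleCat.of A A) 1) : x = 0 := by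
  have h1 : (Ext.mk₀ (trivialπ h)).comp x (zero_add 1) = 0 := by
    obtain ⟨c, hc⟩ := Q.extS_surjective ((Ext.mk₀ (trivialπ h)).comp x (zero_add 1))
    have h2 : Q.extS (Q.μ⁻¹ • (Q.t * c)) = 0 := by
      rw [← mulT_comp_extS, hc, Ext.mk₀_comp_mk₀_assoc, mulT_comp_trivialπ, Ext.mk₀_zero,
        Ext.zero_comp]
    obtain ⟨b, hb⟩ := (Q.extS_eq_zero_iff _).mp h2
    refine hc.symm.trans ((Q.extS_eq_zero_iff _).mpr (Q.exists_s_mul_of_t_mul (b := Q.μ • b) ?_))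
    rw [mul_smul_comm, hb, smul_smul, mul_inv_cancel₀ Q.μ_ne_zero, one_smul]
  obtain ⟨y, rfl⟩ := exists_deltaT_comp_eq h x h1 (add_zero 1)
  rw [Q.ext_zero_eq_zero (I := Q.sIdeal) ⟨1, by simp⟩ y, Ext.comp_zero]

theorem IsGrading.isGorenstein : IsGorenstein 𝒜 2 where
  ext_eq_zero i hi := by
    refine subsingleton_of_forall_eq 0 fun x => ?_
    match i, x with
    | 0, x =>
      exact Q.ext_zero_eq_zero ((mem_augmentationIdeal_iff h _).mpr Q.augmentation_s) x
    | 1, x => exact ext_one_eq_zero h x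
    | 2, x => exact absurd rfl hi
    | i + 3, x =>
      have : HasProjectiveDimensionLT (trivialModule 𝒜) 3 :=
        (projectiveDimension_le_iff _ 2).mp ((le_iSup _ _).trans Q.globalDimension_le)
      exact x.eq_zero_of_hasProjectiveDimensionLT 3 (by lia)
  finrank_ext := by
    have hker : LinearMap.ker (extK h) = LinearMap.ker Q.augmentation := by
      ext c
      rw [LinearMap.mem_ker, LinearMap.mem_ker, extK_eq_zero_iff]
    have hs : Function.Surjective Q.augmentation := fun c => ⟨c • 1, by
      rw [map_smul, ← Q.basis_zero, augmentation_basis]; simp⟩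
    rw [← ((extK h).quotKerEquivOfSurjective (extK_surjective h)).finrank_eq, hker,
      (Q.augmentation.quotKerEquivOfSurjective hs).finrank_eq, Module.finrank_self]
  ext_comp_eq_zero i hi a ha x := by
    obtain ⟨c, rfl⟩ := extK_surjective h x
    -- Composition on the right passes through both connecting classes, so the right action of `a`
    -- sends the class of `c` to that of `c * a`.
    have h1 : (extK h c).comp (Ext.mk₀ (rightMul a)) (add_zero 2) = extK h (c * a) := by
      rw [extK_apply, Ext.comp_assoc_of_third_deg_zero, extS_apply,
        Ext.comp_assoc_of_third_deg_zero, Ext.mk₀_comp_mk₀, rightMul_comp, extK_apply, extS_apply]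
    rw [h1, extK_eq_zero_iff, ← mem_augmentationIdeal_iff h]
    exact Ideal.mul_mem_left _ _ (Ideal.subset_span (Set.mem_biUnion hi ha))

theorem IsGrading.isASRegular : IsASRegular 𝒜 2 where
  connectedGraded := h.isConnectedGraded
  globalDimension_eq := by
    refine le_antisymm Q.globalDimension_le ?_
    refine le_trans ?_ (le_iSup _ (trivialModule 𝒜))
    refine (projectiveDimension_ge_iff _ 2).mpr fun hd => ?_
    have h1 : Module.finrank k (Ext (trivialModule 𝒜) (ModuleCat.of A A) 2) = 1 :=
      h.isGorenstein.finrank_ext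
    -- Global dimension at least two: the one-dimensional `Ext² (k, A)` is not zero.
    have hsub := HasProjectiveDimensionLT.subsingleton (trivialModule 𝒜) 2 2 le_rfl
      (ModuleCat.of A A)
    rw [Module.finrank_zero_of_subsingleton] at h1
    exact zero_ne_one h1
  gkDimension_lt_top := lt_of_le_of_lt Q.gkDimension_le (by simp)
  gorenstein := h.isGorenstein

end Gorenstein

end QuantumPlane

/-! ### `A⁻` is a graded quantum plane -/

namespace Pansera

theorem p_ne_zero (n : ℕ) : p n ≠ 0 := neg_ne_zero.mpr (Complex.exp_ne_zero _)

namespace AMinus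

variable (n : ℕ) (i j : ℤ)

/-- The commutation parameter `p ^ (i² - j²)`. -/
def param : ℂ := p n ^ (i ^ 2 - j ^ 2)

theorem param_ne_zero : param n i j ≠ 0 := zpow_ne_zero _ (p_ne_zero n)

/-- The quotient map from the free algebra. -/
def mk : FreeAlgebra ℂ (Fin 2) →ₐ[ℂ] AMinus n i j := RingQuot.mkAlgHom ℂ (AMinusRel n i j)

theorem v_mul_u : v n i j * u n i j = param n i j • (u n i j * v n i j) := by
  have := RingQuot.mkAlgHom_rel ℂ (AMinusRel.rel (n := n) (i := i) (j := j))
  rw [map_smul, map_mul, map_mul] at this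
  exact this.symm

/-- The operator `X ^ a Y ^ b ↦ X ^ (a + 1) Y ^ b`. -/
def opU : Module.End ℂ (ℕ × ℕ →₀ ℂ) := Finsupp.lsum ℂ fun x => Finsupp.lsingle (x.1 + 1, x.2)

/-- The operator `X ^ a Y ^ b ↦ μ ^ a X ^ a Y ^ (b + 1)`. -/
def opV : Module.End ℂ (ℕ × ℕ →₀ ℂ) :=
  Finsupp.lsum ℂ fun x => param n i j ^ x.1 • Finsupp.lsingle (x.1, x.2 + 1)

theorem opU_single (x : ℕ × ℕ) (c : ℂ) :
    opU (Finsupp.single x c) = Finsupp.single (x.1 + 1, x.2) c := by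
  simp [opU]

theorem opV_single (x : ℕ × ℕ) (c : ℂ) :
    opV n i j (Finsupp.single x c) = param n i j ^ x.1 • Finsupp.single (x.1, x.2 + 1) c := by
  simp [opV]

theorem opV_mul_opU : param n i j • (opU * opV n i j) = opV n i j * opU := by
  refine Finsupp.lhom_ext fun x c => ?_
  simp only [LinearMap.smul_apply, Module.End.mul_apply, opU_single, opV_single, map_smul,
    smul_smul, pow_succ']

/-- The representation of `A⁻` on the polynomials in two variables. -/
def rep : AMinus n i j →ₐ[ℂ] Module.End ℂ (ℕ × ℕ →₀ ℂ) :=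
  RingQuot.liftAlgHom ℂ ⟨FreeAlgebra.lift ℂ ![opU, opV n i j], by
    rintro _ _ ⟨⟩
    simpa using! opV_mul_opU n i j⟩

theorem rep_u : rep n i j (u n i j) = opU :=
  (RingQuot.liftAlgHom_mkAlgHom_apply ..).trans (by simp)

theorem rep_v : rep n i j (v n i j) = opV n i j :=
  (RingQuot.liftAlgHom_mkAlgHom_apply ..).trans (by simp)

theorem rep_monomial (x : ℕ × ℕ) :
    rep n i j (u n i j ^ x.1 * v n i j ^ x.2) (Finsupp.single (0, 0) 1) = Finsupp.single x 1 := by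
  have hV : ∀ b, (opV n i j ^ b) (Finsupp.single (0, 0) 1) = Finsupp.single (0, b) 1 := by
    intro b
    induction b with
    | zero => simp
    | succ b ih => rw [pow_succ', Module.End.mul_apply, ih, opV_single]; simp
  have hU : ∀ a b, (opU ^ a) (Finsupp.single (0, b) 1) = Finsupp.single (a, b) 1 := by
    intro a b
    induction a with
    | zero => simp
    | succ a ih => rw [pow_succ', Module.End.mul_apply, ih, opU_single]
  rw [map_mul, map_pow, map_pow, rep_u, rep_v, Module.End.mul_apply, hV, hU]

/-- In the representation `rep` the monomials send the vector `1` to distinct basis vectors. -/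
theorem linearIndependent_monomial :
    LinearIndependent ℂ fun x : ℕ × ℕ => u n i j ^ x.1 * v n i j ^ x.2 := by
  refine LinearIndependent.of_comp
    ((LinearMap.applyₗ (Finsupp.single (0, 0) (1 : ℂ))).comp (rep n i j).toLinearMap) ?_
  convert (Finsupp.basisSingleOne (R := ℂ) (ι := ℕ × ℕ)).linearIndependent using 1
  funext x
  simpa using! rep_monomial n i j x

/-- The span contains `1` and is stable under left multiplication by `u` and `v`, hence by all of
`A⁻`. -/
theorem span_monomial :
    Submodule.span ℂ (Set.range fun x : ℕ × ℕ => u n i j ^ x.1 * v n i j ^ x.2) = ⊤ := by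
  set W := Submodule.span ℂ (Set.range fun x : ℕ × ℕ => u n i j ^ x.1 * v n i j ^ x.2)
  have hu : ∀ f ∈ W, u n i j * f ∈ W := by
    intro f hf
    refine (show W ≤ W.comap (LinearMap.mulLeft ℂ (u n i j)) from Submodule.span_le.mpr ?_) hf
    rintro _ ⟨x, rfl⟩
    exact Submodule.subset_span ⟨(x.1 + 1, x.2), by simp [pow_succ', mul_assoc]⟩
  have hv : ∀ f ∈ W, v n i j * f ∈ W := by
    intro f hf
    refine (show W ≤ W.comap (LinearMap.mulLeft ℂ (v n i j)) from Submodule.span_le.mpr ?_) hf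
    rintro _ ⟨x, rfl⟩
    simp only [SetLike.mem_coe, Submodule.mem_comap, LinearMap.mulLeft_apply]
    rw [← mul_assoc, mul_pow_eq_smul_of_mul_eq_smul (v_mul_u n i j), smul_mul_assoc]
    exact Submodule.smul_mem _ _ (Submodule.subset_span
      ⟨(x.1, x.2 + 1), by simp [pow_succ', mul_assoc]⟩)
  have key : ∀ (w : FreeAlgebra ℂ (Fin 2)), ∀ f ∈ W,
      mk n i j w * f ∈ W := by
    intro w
    induction w using FreeAlgebra.induction with
    | grade0 r =>
      intro f hf
      rw [AlgHom.commutes, ← Algebra.smul_def]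
      exact Submodule.smul_mem _ _ hf
    | grade1 t =>
      fin_cases t
      · exact hu
      · exact hv
    | mul a b ha hb =>
      intro f hf
      rw [map_mul, mul_assoc]
      exact ha _ (hb _ hf)
    | add a b ha hb =>
      intro f hf
      rw [map_add, add_mul]
      exact add_mem (ha _ hf) (hb _ hf)
  rw [eq_top_iff]
  intro f _
  obtain ⟨w, rfl⟩ : ∃ w, mk n i j w = f := RingQuot.mkAlgHom_surjective ℂ (AMinusRel n i j) f
  rw [← mul_one (mk n i j w)]
  exact key w 1 (Submodule.subset_span ⟨(0, 0), by simp⟩)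

/-- The algebra `A⁻` is a quantum plane. -/
def quantumPlane : QuantumPlane ℂ (AMinus n i j) where
  s := u n i j
  t := v n i j
  μ := param n i j
  basis := Module.Basis.mk (linearIndependent_monomial n i j) (span_monomial n i j).ge
  basis_apply a b := by rw [Module.Basis.mk_apply]
  μ_ne_zero := param_ne_zero n i j
  t_mul_s := v_mul_u n i j

theorem grading_le (d : ℕ) : grading n i j d ≤
    Submodule.span ℂ ((quantumPlane n i j).basis '' {x | x.1 + x.2 = d}) := by
  induction d with
  | zero =>
    rw [grading, pow_zero, Submodule.one_le]
    exact Submodule.subset_span ⟨(0, 0), by simp, (quantumPlane n i j).basis_zero⟩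
  | succ d ih =>
    rw [grading, pow_succ]
    refine (mul_le_mul' ih le_rfl).trans ?_
    rw [Submodule.span_mul_span, Submodule.span_le]
    rintro _ ⟨_, ⟨x, hx, rfl⟩, _, rfl | rfl, rfl⟩
    · refine (congrArg (· ∈ Submodule.span ℂ _) ((quantumPlane n i j).basis_mul_s x)).mpr
        (Submodule.smul_mem _ _ (Submodule.subset_span ⟨_, ?_, rfl⟩))
      rw [Set.mem_ofPred_eq] at hx ⊢
      lia
    · refine (congrArg (· ∈ Submodule.span ℂ _) ((quantumPlane n i j).basis_mul_t x)).mpr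
        (Submodule.subset_span ⟨_, ?_, rfl⟩)
      rw [Set.mem_ofPred_eq] at hx ⊢
      lia

theorem isGrading : (quantumPlane n i j).IsGrading (grading n i j) 1 1 where
  gradedMonoid := Submodule.nat_power_gradedMonoid _
  iSupIndep d := by
    refine ((quantumPlane n i j).basis.linearIndependent.disjoint_span_image
      (s := {x | x.1 + x.2 = d}) (t := {x | x.1 + x.2 ≠ d}) ?_).mono (grading_le n i j d) ?_
    · exact Set.disjoint_left.mpr fun x hx hx' => hx' hx
    · refine iSup₂_le fun d' hd' => (grading_le n i j d').trans (Submodule.span_mono ?_)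
      exact Set.image_mono fun x hx hx' => hd' ((show _ = _ from hx).symm.trans hx')
  s_mem := by
    rw [grading, pow_one]
    exact Submodule.subset_span (Set.mem_insert _ _)
  t_mem := by
    rw [grading, pow_one]
    exact Submodule.subset_span (Set.mem_insert_of_mem _ rfl)
  d_pos := one_pos
  e_pos := one_pos

end AMinus

end Pansera

namespace Pansera

/-! ### The twist as a bicharacter on eigenvalues -/

section TwistSum

variable {R : Type*} [Ring R] [Algebra ℂ R] {n : ℕ}

theorem map_idem {S : Type*} [Ring S] [Algebra ℂ S] (f : R →ₐ[ℂ] S) (b : R) (r : ℕ) :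
    f (idem n b r) = idem n (f b) r := by
  simp [idem, map_sum]

theorem semiconjBy_idem {b b' c : R} (h : SemiconjBy c b b') (r : ℕ) :
    SemiconjBy c (idem n b r) (idem n b' r) := by
  unfold SemiconjBy idem
  rw [mul_smul_comm, smul_mul_assoc, Finset.mul_sum, Finset.sum_mul]
  refine congrArg _ (Finset.sum_congr rfl fun s _ => ?_)
  rw [mul_smul_comm, smul_mul_assoc, (h.pow_right s).eq]

variable [NeZero n]

theorem sum_idem (b : R) : ∑ r ∈ Finset.range n, idem n b r = 1 := by
  have := twistSum_one_left n b
  rw [twistSum_eq] at this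
  simpa using this

theorem twistSum_pow_left {a b : R} (hb : b ^ n = 1) (h : Commute a b) (m : ℕ) :
    twistSum n (a ^ m) b = twistSum n a b ^ m := by
  induction m with
  | zero => rw [pow_zero, pow_zero, twistSum_one_left]
  | succ m ih => rw [pow_succ, pow_succ, twistSum_mul_left n hb ((Commute.refl a).pow_left m) h, ih]

theorem twistSum_pow_eq_one {a b : R} (ha : a ^ n = 1) (hb : b ^ n = 1) (h : Commute a b) :
    twistSum n a b ^ n = 1 := by
  rw [← twistSum_pow_left hb h, ha, twistSum_one_left]

theorem q_zpow_pow (α : ℤ) : ((q n) ^ α) ^ n = 1 := by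
  rw [← zpow_natCast, ← zpow_mul, mul_comm, zpow_mul, zpow_natCast,
    (q_isPrimitiveRoot n).pow_eq_one, one_zpow]

theorem q_zpow_eq_iff (α β : ℤ) : q n ^ α = q n ^ β ↔ (n : ℤ) ∣ α - β := by
  rw [← (q_isPrimitiveRoot n).zpow_eq_one_iff_dvd, zpow_sub₀ (q_ne_zero n),
    div_eq_one_iff_eq (zpow_ne_zero _ (q_ne_zero n))]

/-- The double sum is a discrete Fourier transform, which turns the kernel `q ^ (-r s)` into the
pairing `q ^ (α β)`. All scalars produced by `J` and by `z ^ 2` come from here. -/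
theorem twistSum_q_zpow (α β : ℤ) : twistSum n (q n ^ α) (q n ^ β) = q n ^ (α * β) := by
  have hβ := q_zpow_pow (n := n) β
  -- The idempotent with index `r` has eigenvalue `q ^ r`, so `∑ q ^ r e_r = b ∑ e_r = b` for `b = q
  -- ^ β`.
  have h1 : twistSum n (q n) (q n ^ β) = q n ^ β := by
    rw [twistSum_eq]
    refine Eq.trans ?_ ((Finset.mul_sum _ _ _).symm.trans
      ((congrArg (q n ^ β * ·) (sum_idem (n := n) (q n ^ β))).trans (mul_one _)))
    exact Finset.sum_congr rfl fun r _ => (mul_idem n hβ r).symm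
  have hn : (n : ℤ) ≠ 0 := Nat.cast_ne_zero.mpr (NeZero.ne n)
  -- The exponent `α` is replaced by its residue modulo `n`, so that multiplicativity for natural
  -- powers applies.
  obtain ⟨a, ha⟩ := Int.eq_ofNat_of_zero_le (Int.emod_nonneg α hn)
  have h2 : q n ^ α = q n ^ a := by
    rw [← zpow_natCast, ← ha, q_zpow_eq_iff]
    exact Int.dvd_self_sub_emod
  rw [zpow_mul, h2, twistSum_pow_left hβ (Commute.all _ _), h1, ← zpow_natCast, ← zpow_natCast,
    ← zpow_mul, ← zpow_mul, mul_comm]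

theorem idem_q_pow (r : ℕ) : idem n (q n ^ r) r = 1 := by
  have h : ∀ s ∈ Finset.range n, ((q n) ^ (r * s))⁻¹ • ((q n) ^ r) ^ s = 1 := by
    intro s _
    rw [smul_eq_mul, ← pow_mul, inv_mul_cancel₀ (pow_ne_zero _ (q_ne_zero n))]
  rw [idem, Finset.sum_congr rfl h]
  simp [NeZero.ne n]

end TwistSum

section Eigenvector

variable {V : Type*} [AddCommGroup V] [Module ℂ V] {n : ℕ}

theorem pow_apply_of_apply_eq_smul {X : Module.End ℂ V} {w : V} {c : ℂ} (hX : X w = c • w) (r : ℕ) :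
    (X ^ r) w = c ^ r • w := by
  induction r with
  | zero => simp
  | succ r ih => rw [pow_succ, Module.End.mul_apply, hX, map_smul, ih, smul_smul, pow_succ']

theorem idem_apply {X : Module.End ℂ V} {w : V} {c : ℂ} (hX : X w = c • w) (r : ℕ) :
    idem n X r w = idem n c r • w := by
  simp only [idem, LinearMap.smul_apply, LinearMap.sum_apply, pow_apply_of_apply_eq_smul hX,
    smul_smul, ← Finset.sum_smul, smul_eq_mul]

theorem twistSum_apply {X Y : Module.End ℂ V} {w : V} {c d : ℂ} (hX : X w = c • w)
    (hY : Y w = d • w) : twistSum n X Y w = twistSum n c d • w := by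
  simp only [twistSum, LinearMap.smul_apply, LinearMap.sum_apply, Module.End.mul_apply,
    pow_apply_of_apply_eq_smul hX, pow_apply_of_apply_eq_smul hY, map_smul, smul_smul,
    ← Finset.sum_smul, smul_eq_mul, mul_comm (d ^ _)]

end Eigenvector

/-! ### Finiteness and semisimplicity of `H` -/

namespace H

variable {n : ℕ}

theorem commute_idem_idem (r s : ℕ) : Commute (idem n (x n) r) (idem n (y n) s) :=
  semiconjBy_idem (semiconjBy_idem x_y.symm r).symm s

/-- The primitive idempotents of the group algebra of `⟨x, y⟩`. -/
def idemXY (n : ℕ) (r s : ℕ) : H n := idem n (x n) r * idem n (y n) s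

theorem z_mul_idemXY (r s : ℕ) : z n * idemXY n r s = idemXY n s r * z n := by
  rw [idemXY, ← mul_assoc, (semiconjBy_idem z_x r).eq, mul_assoc, (semiconjBy_idem z_y s).eq,
    ← mul_assoc, idemXY, (commute_idem_idem s r).eq]

variable [NeZero n]

/-- `z ^ 2` is the twist sum, which is multiplicative in its first argument, so its `n`-th power is
the twist sum of `x ^ n = 1`. -/
theorem z_pow : z n ^ (2 * n) = 1 := by
  rw [pow_mul, z_sq, twistSum_pow_eq_one x_pow y_pow x_y]

theorem two_mul_ne_zero : 2 * n ≠ 0 := mul_ne_zero two_ne_zero (NeZero.ne n)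

variable (n)

/-- The unit `x`. -/
def xUnit : (H n)ˣ := Units.ofPowEqOne (x n) n x_pow (NeZero.ne n)

/-- The unit `y`. -/
def yUnit : (H n)ˣ := Units.ofPowEqOne (y n) n y_pow (NeZero.ne n)

/-- The unit `z`. -/
def zUnit : (H n)ˣ := Units.ofPowEqOne (z n) (2 * n) z_pow two_mul_ne_zero

theorem xUnit_pow : xUnit n ^ n = 1 := Units.pow_ofPowEqOne _ _

theorem yUnit_pow : yUnit n ^ n = 1 := Units.pow_ofPowEqOne _ _

theorem zUnit_pow : zUnit n ^ (2 * n) = 1 := Units.pow_ofPowEqOne _ _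

theorem xUnit_yUnit : Commute (xUnit n) (yUnit n) := Units.ext x_y

theorem zUnit_xUnit : SemiconjBy (zUnit n) (xUnit n) (yUnit n) := Units.ext z_x

theorem zUnit_yUnit : SemiconjBy (zUnit n) (yUnit n) (xUnit n) := Units.ext z_y

/-- The monomials `x ^ a y ^ b z ^ c`. -/
def monomials : Set (H n)ˣ :=
  Set.range fun m : ℕ × ℕ × ℕ => xUnit n ^ m.1 * yUnit n ^ m.2.1 * zUnit n ^ m.2.2

theorem finite_monomials : (monomials n).Finite := by
  refine (Set.finite_range fun m : Fin n × Fin n × Fin (2 * n) =>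
    xUnit n ^ (m.1 : ℕ) * yUnit n ^ (m.2.1 : ℕ) * zUnit n ^ (m.2.2 : ℕ)).subset ?_
  rintro _ ⟨⟨a, b, c⟩, rfl⟩
  refine ⟨(⟨a % n, Nat.mod_lt _ (NeZero.pos n)⟩, ⟨b % n, Nat.mod_lt _ (NeZero.pos n)⟩,
    ⟨c % (2 * n), Nat.mod_lt _ (Nat.pos_of_ne_zero two_mul_ne_zero)⟩), ?_⟩
  simp only [← pow_eq_pow_mod _ (xUnit_pow n), ← pow_eq_pow_mod _ (yUnit_pow n),
    ← pow_eq_pow_mod _ (zUnit_pow n)]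

variable {n}

theorem mul_zUnit_mem {g : (H n)ˣ} (hg : g ∈ monomials n) : g * zUnit n ∈ monomials n := by
  obtain ⟨⟨a, b, c⟩, rfl⟩ := hg
  exact ⟨(a, b, c + 1), by simp only [pow_succ, mul_assoc]⟩

/-- Moving `x` or `y` to the left past a `z` interchanges the two, so both claims must go through
the induction together. -/
theorem mul_xUnit_mem_and {g : (H n)ˣ} (hg : g ∈ monomials n) :
    g * xUnit n ∈ monomials n ∧ g * yUnit n ∈ monomials n := by
  obtain ⟨⟨a, b, c⟩, rfl⟩ := hg
  induction c with
  | zero =>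
    refine ⟨⟨(a + 1, b, 0), ?_⟩, ⟨(a, b + 1, 0), ?_⟩⟩
    · simp only [pow_zero, mul_one, pow_succ, mul_assoc, ((xUnit_yUnit n).pow_right b).eq]
    · simp only [pow_zero, mul_one, pow_succ, mul_assoc]
  | succ c ih =>
    simp only [pow_succ, mul_assoc, (zUnit_xUnit n).eq, (zUnit_yUnit n).eq] at ih ⊢
    refine ⟨?_, ?_⟩
    · simpa only [mul_assoc] using mul_zUnit_mem ih.2
    · simpa only [mul_assoc] using mul_zUnit_mem ih.1

theorem mul_pow_mem {g u : (H n)ˣ} (hu : ∀ g ∈ monomials n, g * u ∈ monomials n)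
    (hg : g ∈ monomials n) (c : ℕ) : g * u ^ c ∈ monomials n := by
  induction c with
  | zero => rwa [pow_zero, mul_one]
  | succ c ih =>
    rw [pow_succ, ← mul_assoc]
    exact hu _ ih

theorem mul_xUnit_pow_mem {g : (H n)ˣ} (hg : g ∈ monomials n) (c : ℕ) :
    g * xUnit n ^ c ∈ monomials n := mul_pow_mem (fun _ h => (mul_xUnit_mem_and h).1) hg c

theorem mul_yUnit_pow_mem {g : (H n)ˣ} (hg : g ∈ monomials n) (c : ℕ) :
    g * yUnit n ^ c ∈ monomials n := mul_pow_mem (fun _ h => (mul_xUnit_mem_and h).2) hg c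

theorem mul_zUnit_pow_mem {g : (H n)ˣ} (hg : g ∈ monomials n) (c : ℕ) :
    g * zUnit n ^ c ∈ monomials n := mul_pow_mem (fun _ => mul_zUnit_mem) hg c

theorem one_mem_monomials : (1 : (H n)ˣ) ∈ monomials n := ⟨(0, 0, 0), by simp⟩

theorem inv_eq_pow {G : Type*} [Group G] {g : G} {m : ℕ} (hm : m ≠ 0) (h : g ^ m = 1) :
    g⁻¹ = g ^ (m - 1) := by
  rw [inv_eq_iff_mul_eq_one, mul_pow_sub_one hm, h]

variable (n)

/-- The finite group of the monomials `x ^ a y ^ b z ^ c`. -/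
def group : Subgroup (H n)ˣ where
  carrier := monomials n
  one_mem' := one_mem_monomials
  mul_mem' := by
    rintro g _ hg ⟨⟨a, b, c⟩, rfl⟩
    simp only [← mul_assoc]
    exact mul_zUnit_pow_mem (mul_yUnit_pow_mem (mul_xUnit_pow_mem hg a) b) c
  inv_mem' := by
    rintro _ ⟨⟨a, b, c⟩, rfl⟩
    rw [mul_inv_rev, mul_inv_rev, ← inv_pow, ← inv_pow, ← inv_pow,
      inv_eq_pow (NeZero.ne n) (xUnit_pow n), inv_eq_pow (NeZero.ne n) (yUnit_pow n),
      inv_eq_pow two_mul_ne_zero (zUnit_pow n), ← pow_mul, ← pow_mul, ← pow_mul, ← mul_assoc,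
      ← one_mul (zUnit n ^ _)]
    exact mul_xUnit_pow_mem (mul_yUnit_pow_mem (mul_zUnit_pow_mem one_mem_monomials _) _) _

instance : Finite (group n) := finite_monomials n

/-- The map from the group algebra. -/
def ofGroupAlgebra : MonoidAlgebra ℂ (group n) →ₐ[ℂ] H n :=
  MonoidAlgebra.lift ℂ (H n) (group n) ((Units.coeHom (H n)).comp (group n).subtype)

theorem ofGroupAlgebra_surjective : Function.Surjective (ofGroupAlgebra n) := by
  have key : ∀ g ∈ monomials n, (g : H n) ∈ (ofGroupAlgebra n).range := fun g hg =>
    ⟨MonoidAlgebra.of ℂ _ (⟨g, hg⟩ : group n), by simp [ofGroupAlgebra]⟩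
  intro h
  change h ∈ (ofGroupAlgebra n).range
  induction h using induction with
  | hadd a b ha hb => exact add_mem ha hb
  | hmul a b ha hb => exact mul_mem ha hb
  | hc c => exact algebraMap_mem _ c
  | hx => exact key (xUnit n) ⟨(1, 0, 0), by simp⟩
  | hy => exact key (yUnit n) ⟨(0, 1, 0), by simp⟩
  | hz => exact key (zUnit n) ⟨(0, 0, 1), by simp⟩

instance : Module.Finite ℂ (H n) :=
  have : Module.Finite ℂ (MonoidAlgebra ℂ (group n)) :=
    Module.Finite.of_basis (MonoidAlgebra.basis (group n) ℂ)
  Module.Finite.of_surjective (ofGroupAlgebra n).toLinearMap (ofGroupAlgebra_surjective n)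

/-- Maschke's theorem over `ℂ` makes the group algebra semisimple, and semisimplicity passes to
quotients. -/
instance : IsSemisimpleRing (H n) :=
  have : NeZero (Nat.card (group n) : ℂ) := ⟨Nat.cast_ne_zero.mpr Nat.card_pos.ne'⟩
  RingHom.isSemisimpleRing_of_surjective (ofGroupAlgebra n).toRingHom (ofGroupAlgebra_surjective n)

variable {n}

theorem sum_idemXY : ∑ r ∈ Finset.range n, ∑ s ∈ Finset.range n, idemXY n r s = 1 := by
  simp only [idemXY, ← Finset.mul_sum, sum_idem, mul_one]

theorem idemXY_mul_x (r s : ℕ) : idemXY n r s * x n = q n ^ r • idemXY n r s := by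
  have h1 : Commute (idem n (y n) s) (x n) := (semiconjBy_idem x_y s).symm
  have h2 : Commute (x n) (idem n (x n) r) := semiconjBy_idem (Commute.refl _) r
  rw [idemXY, mul_assoc, h1.eq, ← mul_assoc, ← h2.eq, mul_idem n x_pow, smul_mul_assoc]

theorem idemXY_mul_y (r s : ℕ) : idemXY n r s * y n = q n ^ s • idemXY n r s := by
  have h2 : Commute (y n) (idem n (y n) s) := semiconjBy_idem (Commute.refl _) s
  rw [idemXY, mul_assoc, ← h2.eq, mul_idem n y_pow, mul_smul_comm]

/-- The right ideal `e_{r,s} H` has dimension at most two: `x` and `y` act on `e_{r,s}` by scalars,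
`e_{r,s} z = z e_{s,r}`, and `e_{r,s} z ^ 2` is again a multiple of `e_{r,s}`. Since `z` exchanges
the indices, the induction must allow both orders. -/
theorem exists_idemXY_mul (h : H n) (r s : ℕ) :
    ∃ c d : ℂ, idemXY n r s * h = c • idemXY n r s + d • (idemXY n r s * z n) := by
  induction h using induction generalizing r s with
  | hadd a b ha hb =>
    obtain ⟨c, d, h⟩ := ha r s
    obtain ⟨c', d', h'⟩ := hb r s
    exact ⟨c + c', d + d', by rw [mul_add, h, h', add_smul, add_smul]; abel⟩
  | hmul a b ha hb =>
    obtain ⟨c, d, h⟩ := ha r s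
    obtain ⟨c₁, d₁, h₁⟩ := hb r s
    obtain ⟨c₂, d₂, h₂⟩ := hb s r
    have hz : ∃ e : ℂ, idemXY n r s * z n * z n = e • idemXY n r s := by
      have hx : ∀ a b : ℕ, idemXY n r s * (x n ^ a * y n ^ b) =
          ((q n ^ r) ^ a * (q n ^ s) ^ b) • idemXY n r s := by
        intro a b
        have hX : ∀ a, idemXY n r s * x n ^ a = (q n ^ r) ^ a • idemXY n r s := fun a => by
          induction a with
          | zero => simp
          | succ a ih => rw [pow_succ, ← mul_assoc, ih, smul_mul_assoc, idemXY_mul_x, smul_smul,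
              pow_succ]
        have hY : ∀ b, idemXY n r s * y n ^ b = (q n ^ s) ^ b • idemXY n r s := fun b => by
          induction b with
          | zero => simp
          | succ a ih => rw [pow_succ, ← mul_assoc, ih, smul_mul_assoc, idemXY_mul_y, smul_smul,
              pow_succ]
        rw [← mul_assoc, hX, smul_mul_assoc, hY, smul_smul]
      refine ⟨twistSum n (q n ^ r) (q n ^ s), ?_⟩
      rw [mul_assoc, ← sq, z_sq, twistSum, mul_smul_comm, Finset.mul_sum]
      simp only [Finset.mul_sum, mul_smul_comm, hx, smul_smul, ← Finset.sum_smul, twistSum,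
        smul_eq_mul]
    obtain ⟨e, he⟩ := hz
    refine ⟨c * c₁ + d * d₂ * e, c * d₁ + d * c₂, ?_⟩
    rw [← mul_assoc, h, add_mul, smul_mul_assoc, h₁, smul_mul_assoc, ← z_mul_idemXY, mul_assoc, h₂,
      mul_add, mul_smul_comm, mul_smul_comm, z_mul_idemXY, ← mul_assoc, z_mul_idemXY, he]
    module
  | hc c => exact ⟨c, 0, by rw [← Algebra.commutes, ← Algebra.smul_def]; simp⟩
  | hx => exact ⟨q n ^ r, 0, by rw [idemXY_mul_x]; simp⟩
  | hy => exact ⟨q n ^ s, 0, by rw [idemXY_mul_y]; simp⟩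
  | hz => exact ⟨0, 1, by simp⟩

end H

end Pansera

namespace Pansera

open HopfAction

/-! ### The action on products -/

section Twisted

variable {n : ℕ} {A : Type*} [Ring A] [Algebra ℂ A]

/-- The componentwise action of `H ⊗ H` on `A ⊗ A`. -/
def tensorAct (act : H n →ₐ[ℂ] Module.End ℂ A) : H n ⊗[ℂ] H n →ₐ[ℂ] Module.End ℂ (A ⊗[ℂ] A) :=
  Module.endTensorEndAlgHom.comp (Algebra.TensorProduct.map act act)

@[simp] theorem tensorAct_tmul (act : H n →ₐ[ℂ] Module.End ℂ A) (g h : H n) (a b : A) :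
    tensorAct act (g ⊗ₜ h) (a ⊗ₜ b) = act g a ⊗ₜ act h b := rfl

theorem lift_eq_tensorAct (act : H n →ₐ[ℂ] Module.End ℂ A) (t : H n ⊗[ℂ] H n) (a b : A) :
    TensorProduct.lift ((LinearMap.mul ℂ A).compl₁₂ (act.toLinearMap.flip a)
      (act.toLinearMap.flip b)) t = LinearMap.mul' ℂ A (tensorAct act t (a ⊗ₜ b)) := by
  induction t with
  | zero => simp
  | tmul g h => simp
  | add s t hs ht => rw [map_add, hs, ht, map_add, LinearMap.add_apply, map_add]

variable [NeZero n]

theorem tensorAct_J {act : H n →ₐ[ℂ] Module.End ℂ A} {a b : A} {α β : ℤ}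
    (ha : act (H.x n) a = q n ^ α • a) (hb : act (H.y n) b = q n ^ β • b) :
    tensorAct act (H.J n) (a ⊗ₜ b) = q n ^ (α * β) • (a ⊗ₜ[ℂ] b) := by
  rw [H.J, map_twistSum, ← twistSum_q_zpow]
  refine twistSum_apply ?_ ?_
  · rw [tensorAct_tmul, ha, map_one, Module.End.one_apply, TensorProduct.smul_tmul']
  · rw [tensorAct_tmul, hb, map_one, Module.End.one_apply, TensorProduct.tmul_smul]

/-- The compatibility of the action of `h` with products. -/
def ActsOnProducts (act : H n →ₐ[ℂ] Module.End ℂ A) (h : H n) : Prop :=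
  act h ∘ₗ LinearMap.mul' ℂ A = LinearMap.mul' ℂ A ∘ₗ tensorAct act (H.comulHom n h)

/-- Both sides are compatible with sums and products in `h`, because the comultiplication and
`tensorAct act` are algebra maps. -/
theorem actsOnProducts_of_generators {act : H n →ₐ[ℂ] Module.End ℂ A}
    (hx : ActsOnProducts act (H.x n)) (hy : ActsOnProducts act (H.y n))
    (hz : ActsOnProducts act (H.z n)) (h : H n) : ActsOnProducts act h := by
  induction h using H.induction with
  | hadd a b ha hb =>
    unfold ActsOnProducts at *
    rw [map_add, map_add, map_add, LinearMap.add_comp, LinearMap.comp_add, ha, hb]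
  | hmul a b ha hb =>
    unfold ActsOnProducts at *
    rw [map_mul, map_mul, map_mul, Module.End.mul_eq_comp, Module.End.mul_eq_comp,
      LinearMap.comp_assoc, hb, ← LinearMap.comp_assoc, ha, LinearMap.comp_assoc]
  | hc c =>
    unfold ActsOnProducts
    rw [AlgHom.commutes, AlgHom.commutes, AlgHom.commutes]
    ext a b
    simp
  | hx => exact hx
  | hy => exact hy
  | hz => exact hz

variable (ρ : ModuleAlgebra ℂ (H n) A)

theorem act_x_mul (a b : A) : ρ.act (H.x n) (a * b) = ρ.act (H.x n) a * ρ.act (H.x n) b := by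
  rw [ρ.act_mul, lift_eq_tensorAct, H.comul_apply, H.comulHom_x, tensorAct_tmul,
    LinearMap.mul'_apply]

theorem act_y_mul (a b : A) : ρ.act (H.y n) (a * b) = ρ.act (H.y n) a * ρ.act (H.y n) b := by
  rw [ρ.act_mul, lift_eq_tensorAct, H.comul_apply, H.comulHom_y, tensorAct_tmul,
    LinearMap.mul'_apply]

/-- In `Δ(z)` the twist `J` acts after `z ⊗ z`, so the relevant weights are those of `z a` and `z
b`. -/
theorem act_z_mul {a b : A} {α β : ℤ}
    (ha : ρ.act (H.x n) (ρ.act (H.z n) a) = q n ^ α • ρ.act (H.z n) a)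
    (hb : ρ.act (H.y n) (ρ.act (H.z n) b) = q n ^ β • ρ.act (H.z n) b) :
    ρ.act (H.z n) (a * b) = q n ^ (α * β) • (ρ.act (H.z n) a * ρ.act (H.z n) b) := by
  rw [ρ.act_mul, lift_eq_tensorAct, H.comul_apply, H.comulHom_z, map_mul, Module.End.mul_apply,
    tensorAct_tmul, tensorAct_J ha hb, map_smul, LinearMap.mul'_apply]

theorem act_one (h : H n) : ρ.act h 1 = H.counitHom n h • (1 : A) := ρ.act_one h

end Twisted

/-! ### Writing all scalars as powers of `p` -/

section Scalars

variable (n : ℕ)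

theorem p_sq : p n ^ 2 = q n := by
  rw [p, q, neg_sq, ← Complex.exp_nat_mul]
  congr 1
  push_cast
  ring

theorem q_zpow (m : ℤ) : q n ^ m = p n ^ (2 * m) := by
  rw [zpow_mul, ← p_sq]
  rfl

theorem param_pow (i j : ℤ) (m : ℕ) : AMinus.param n i j ^ m = p n ^ ((i ^ 2 - j ^ 2) * m) := by
  rw [AMinus.param, zpow_mul, zpow_natCast]

end Scalars

/-- The exponent of `q` in the action of `x` on `u ^ a v ^ b`. -/
def weight (i j : ℤ) (m : ℕ × ℕ) : ℤ := i * m.1 + j * m.2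

/-- The exponent of `p` in the action of `z` on `u ^ a v ^ b`. -/
def zExponent (i j : ℤ) (m : ℕ × ℕ) : ℤ :=
  i * j * ((m.1 : ℤ) ^ 2 + m.1 + (m.2 : ℤ) ^ 2 - m.2) + (i ^ 2 + j ^ 2) * (m.1 * m.2)

/-! ### Existence and uniqueness of the action -/

namespace AMinus

variable (n : ℕ) (i j : ℤ)

/-- The monomial basis of `A⁻`. -/
abbrev basis : Module.Basis (ℕ × ℕ) ℂ (AMinus n i j) := (quantumPlane n i j).basis

theorem basis_mul (a b c d : ℕ) : basis n i j (a, b) * basis n i j (c, d) =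
    p n ^ ((i ^ 2 - j ^ 2) * (b * c)) • basis n i j (a + c, b + d) := by
  have := (quantumPlane n i j).basis_mul_basis a b c d
  rw [show (quantumPlane n i j).μ = param n i j from rfl, param_pow] at this
  rw [this]
  push_cast
  rfl

theorem basis_one_zero : basis n i j (1, 0) = u n i j := (quantumPlane n i j).basis_s

theorem basis_zero_one : basis n i j (0, 1) = v n i j := (quantumPlane n i j).basis_t

theorem basis_zero_zero : basis n i j (0, 0) = 1 := (quantumPlane n i j).basis_zero

/-- A diagonal operator. -/
def diag (c : ℕ × ℕ → ℤ) : Module.End ℂ (AMinus n i j) :=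
  (basis n i j).constr ℂ fun m => q n ^ c m • basis n i j m

theorem diag_basis (c : ℕ × ℕ → ℤ) (m : ℕ × ℕ) :
    diag n i j c (basis n i j m) = q n ^ c m • basis n i j m :=
  (basis n i j).constr_basis ℂ _ _

/-- The operator by which `z` acts. -/
def opZ : Module.End ℂ (AMinus n i j) :=
  (basis n i j).constr ℂ fun m => p n ^ zExponent i j m • basis n i j m.swap

theorem opZ_basis (m : ℕ × ℕ) :
    opZ n i j (basis n i j m) = p n ^ zExponent i j m • basis n i j m.swap :=
  (basis n i j).constr_basis ℂ _ _

variable [NeZero n]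

theorem diag_pow (c : ℕ × ℕ → ℤ) : diag n i j c ^ n = 1 := by
  refine (basis n i j).ext fun m => ?_
  rw [pow_apply_of_apply_eq_smul (diag_basis n i j c m), q_zpow_pow, one_smul, Module.End.one_apply]

/-- The action of `H` on `A⁻`. -/
def act : H n →ₐ[ℂ] Module.End ℂ (AMinus n i j) :=
  H.lift (diag n i j (weight i j)) (diag n i j (weight j i)) (opZ n i j) (diag_pow n i j _)
    (diag_pow n i j _)
    ((basis n i j).ext fun m => by
      simp only [Module.End.mul_apply, diag_basis, map_smul, smul_smul, mul_comm])
    ((basis n i j).ext fun m => by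
      simp only [Module.End.mul_apply, diag_basis, opZ_basis, map_smul, smul_smul]
      rw [mul_comm, show weight j i m.swap = weight i j m by simp [weight, add_comm]])
    ((basis n i j).ext fun m => by
      simp only [Module.End.mul_apply, diag_basis, opZ_basis, map_smul, smul_smul]
      rw [mul_comm, show weight i j m.swap = weight j i m by simp [weight, add_comm]])
    -- The relation for `z ^ 2`: the values of `zExponent` at `m` and `m.swap` add up to twice the
    -- product of the two weights, and `q = p ^ 2`.
    ((basis n i j).ext fun m => by
      rw [sq, Module.End.mul_apply, opZ_basis, map_smul, opZ_basis, smul_smul,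
        twistSum_apply (diag_basis n i j _ m) (diag_basis n i j _ m), twistSum_q_zpow, q_zpow,
        ← zpow_add₀ (p_ne_zero n), Prod.swap_swap]
      congr 2
      simp only [zExponent, weight, Prod.fst_swap, Prod.snd_swap]
      ring)

theorem act_x_basis (m : ℕ × ℕ) :
    act n i j (H.x n) (basis n i j m) = q n ^ weight i j m • basis n i j m := by
  rw [act, H.lift_x, diag_basis]

theorem act_y_basis (m : ℕ × ℕ) :
    act n i j (H.y n) (basis n i j m) = q n ^ weight j i m • basis n i j m := by
  rw [act, H.lift_y, diag_basis]

theorem act_z_basis (m : ℕ × ℕ) :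
    act n i j (H.z n) (basis n i j m) = p n ^ zExponent i j m • basis n i j m.swap := by
  rw [act, H.lift_z, opZ_basis]

theorem actsOnProducts_of_basis {h : H n} (hh : ∀ m m',
    act n i j h (basis n i j m * basis n i j m') =
      LinearMap.mul' ℂ _ (tensorAct (act n i j) (H.comulHom n h)
        (basis n i j m ⊗ₜ basis n i j m'))) : ActsOnProducts (act n i j) h :=
  TensorProduct.ext ((basis n i j).ext fun m => (basis n i j).ext fun m' => hh m m')

theorem actsOnProducts (h : H n) : ActsOnProducts (act n i j) h := by
  refine actsOnProducts_of_generators ?_ ?_ ?_ h <;>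
    refine actsOnProducts_of_basis n i j fun ⟨a, b⟩ ⟨c, d⟩ => ?_
  · simp only [LinearMap.mul'_apply, H.comulHom_x, tensorAct_tmul, basis_mul, map_smul,
      act_x_basis, smul_mul_assoc, mul_smul_comm, smul_smul, q_zpow, ← zpow_add₀ (p_ne_zero n)]
    congr 2
    simp only [weight]
    push_cast
    ring
  · simp only [LinearMap.mul'_apply, H.comulHom_y, tensorAct_tmul, basis_mul, map_smul,
      act_y_basis, smul_mul_assoc, mul_smul_comm, smul_smul, q_zpow, ← zpow_add₀ (p_ne_zero n)]
    congr 2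
    simp only [weight]
    push_cast
    ring
  -- This is where the parameter `p ^ (i² - j²)` matters: reordering before and after the exchange
  -- contributes `(i² - j²) b c` and `(i² - j²) a d`, which balance the unsymmetric cross terms
  -- coming from `J`.
  · rw [H.comulHom_z, map_mul (tensorAct (act n i j)), Module.End.mul_apply, tensorAct_tmul, act_z_basis, act_z_basis,
      TensorProduct.smul_tmul_smul, map_smul,
      tensorAct_J (act_x_basis n i j _) (act_y_basis n i j _), map_smul, map_smul,
      LinearMap.mul'_apply, basis_mul, map_smul, act_z_basis]
    simp only [Prod.swap_prod_mk, basis_mul, smul_smul, q_zpow, ← zpow_add₀ (p_ne_zero n)]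
    congr 2
    simp only [zExponent, weight]
    push_cast
    ring

/-- The module algebra structure on `A⁻`. -/
def moduleAlgebra : ModuleAlgebra ℂ (H n) (AMinus n i j) where
  act := act n i j
  act_one h := by
    rw [H.counit_apply]
    induction h using H.induction with
    | hadd a b ha hb => rw [map_add, map_add, LinearMap.add_apply, ha, hb, add_smul]
    | hmul a b ha hb =>
      rw [map_mul, map_mul, Module.End.mul_apply, hb, map_smul, ha, smul_smul, mul_comm]
    | hc c => simp
    | hx =>
      rw [← basis_zero_zero, act_x_basis, H.counitHom_x]
      simp [weight]
    | hy =>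
      rw [← basis_zero_zero, act_y_basis, H.counitHom_y]
      simp [weight]
    | hz =>
      rw [← basis_zero_zero, act_z_basis, H.counitHom_z]
      simp [zExponent]
  act_mul h a b := by
    rw [lift_eq_tensorAct, H.comul_apply]
    exact LinearMap.congr_fun (actsOnProducts n i j h) (a ⊗ₜ b)

theorem actsByPi_moduleAlgebra : ActsByPi (moduleAlgebra n i j) where
  x_u := by
    rw [← basis_one_zero]
    exact (act_x_basis n i j _).trans (by simp [weight])
  x_v := by
    rw [← basis_zero_one]
    exact (act_x_basis n i j _).trans (by simp [weight])
  y_u := by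
    rw [← basis_one_zero]
    exact (act_y_basis n i j _).trans (by simp [weight])
  y_v := by
    rw [← basis_zero_one]
    exact (act_y_basis n i j _).trans (by simp [weight])
  z_u := by
    rw [← basis_one_zero, ← basis_zero_one]
    refine (act_z_basis n i j _).trans ?_
    rw [q_zpow]
    simp [zExponent, mul_comm, one_add_one_eq_two]
  z_v := by
    rw [← basis_one_zero, ← basis_zero_one]
    exact (act_z_basis n i j _).trans (by simp [zExponent])

variable {n i j} {ρ : ModuleAlgebra ℂ (H n) (AMinus n i j)} (hρ : ActsByPi ρ)
include hρ

theorem ActsByPi.act_x (m : ℕ × ℕ) :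
    ρ.act (H.x n) (basis n i j m) = q n ^ weight i j m • basis n i j m := by
  have h1 : ∀ a, ρ.act (H.x n) (u n i j ^ a) = (q n ^ i) ^ a • u n i j ^ a := fun a => by
    induction a with
    | zero => simp [act_one, H.counitHom_x]
    | succ a ih =>
      rw [pow_succ, act_x_mul, ih, hρ.x_u, smul_mul_smul_comm, ← pow_succ]
  have h2 : ∀ a, ρ.act (H.x n) (v n i j ^ a) = (q n ^ j) ^ a • v n i j ^ a := fun a => by
    induction a with
    | zero => simp [act_one, H.counitHom_x]
    | succ a ih =>
      rw [pow_succ, act_x_mul, ih, hρ.x_v, smul_mul_smul_comm, ← pow_succ]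
  have h3 : basis n i j m = u n i j ^ m.1 * v n i j ^ m.2 := (quantumPlane n i j).basis_apply _ _
  rw [h3, act_x_mul, h1, h2, smul_mul_smul_comm, weight, zpow_add₀ (q_ne_zero n), zpow_mul,
    zpow_mul, zpow_natCast, zpow_natCast]

theorem ActsByPi.act_y (m : ℕ × ℕ) :
    ρ.act (H.y n) (basis n i j m) = q n ^ weight j i m • basis n i j m := by
  have h1 : ∀ a, ρ.act (H.y n) (u n i j ^ a) = (q n ^ j) ^ a • u n i j ^ a := fun a => by
    induction a with
    | zero => simp [act_one, H.counitHom_y]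
    | succ a ih =>
      rw [pow_succ, act_y_mul, ih, hρ.y_u, smul_mul_smul_comm, ← pow_succ]
  have h2 : ∀ a, ρ.act (H.y n) (v n i j ^ a) = (q n ^ i) ^ a • v n i j ^ a := fun a => by
    induction a with
    | zero => simp [act_one, H.counitHom_y]
    | succ a ih =>
      rw [pow_succ, act_y_mul, ih, hρ.y_v, smul_mul_smul_comm, ← pow_succ]
  have h3 : basis n i j m = u n i j ^ m.1 * v n i j ^ m.2 := (quantumPlane n i j).basis_apply _ _
  rw [h3, act_y_mul, h1, h2, smul_mul_smul_comm, weight, zpow_add₀ (q_ne_zero n), zpow_mul,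
    zpow_mul, zpow_natCast, zpow_natCast]

/-- The rule for `Δ(z)` propagates the formula from two monomials to their product, so `z` is
determined by its values on `u` and `v`. -/
theorem ActsByPi.act_z_mul_basis {m m' : ℕ × ℕ}
    (hm : ρ.act (H.z n) (basis n i j m) = p n ^ zExponent i j m • basis n i j m.swap)
    (hm' : ρ.act (H.z n) (basis n i j m') = p n ^ zExponent i j m' • basis n i j m'.swap) :
    ρ.act (H.z n) (basis n i j (m.1 + m'.1, m.2 + m'.2)) =
      p n ^ zExponent i j (m.1 + m'.1, m.2 + m'.2) •
        basis n i j (m.1 + m'.1, m.2 + m'.2).swap := by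
  obtain ⟨a, b⟩ := m
  obtain ⟨c, d⟩ := m'
  have h1 : ρ.act (H.z n) (basis n i j (a, b) * basis n i j (c, d)) =
      q n ^ (weight i j (b, a) * weight j i (d, c)) • (ρ.act (H.z n) (basis n i j (a, b)) *
        ρ.act (H.z n) (basis n i j (c, d))) := by
    refine act_z_mul ρ ?_ ?_
    · rw [hm, map_smul, Prod.swap_prod_mk, ActsByPi.act_x hρ, smul_comm]
    · rw [hm', map_smul, Prod.swap_prod_mk, ActsByPi.act_y hρ, smul_comm]
  rw [basis_mul, map_smul, hm, hm', smul_mul_smul_comm, Prod.swap_prod_mk, Prod.swap_prod_mk,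
    basis_mul] at h1
  -- The nonzero scalar from reordering the product of the two monomials is cancelled.
  refine smul_right_injective _ (zpow_ne_zero ((i ^ 2 - j ^ 2) * (b * c)) (p_ne_zero n))
    (h1.trans ?_)
  simp only [Prod.swap_prod_mk, smul_smul, q_zpow, ← zpow_add₀ (p_ne_zero n)]
  congr 2
  simp only [zExponent, weight]
  push_cast
  ring

theorem ActsByPi.act_z (m : ℕ × ℕ) :
    ρ.act (H.z n) (basis n i j m) = p n ^ zExponent i j m • basis n i j m.swap := by
  obtain ⟨a, b⟩ := m
  induction b with
  | zero =>
    induction a with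
    | zero => simp [basis_zero_zero, act_one, H.counitHom_z, zExponent]
    | succ a ih =>
      refine ActsByPi.act_z_mul_basis hρ (m := (a, 0)) (m' := (1, 0)) ih ?_
      rw [Prod.swap_prod_mk, basis_one_zero, basis_zero_one, hρ.z_u, q_zpow]
      simp [zExponent, mul_comm, one_add_one_eq_two]
  | succ b ih =>
    refine ActsByPi.act_z_mul_basis hρ (m := (a, b)) (m' := (0, 1)) ih ?_
    rw [Prod.swap_prod_mk, basis_one_zero, basis_zero_one, hρ.z_v]
    simp [zExponent]

theorem ActsByPi.eq_moduleAlgebra : ρ = moduleAlgebra n i j := by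
  have h : ρ.act = act n i j := by
    refine H.hom_ext ((basis n i j).ext fun m => ?_) ((basis n i j).ext fun m => ?_)
      ((basis n i j).ext fun m => ?_)
    · rw [ActsByPi.act_x hρ, act_x_basis]
    · rw [ActsByPi.act_y hρ, act_y_basis]
    · rw [ActsByPi.act_z hρ, act_z_basis]
  cases ρ
  cases h
  rfl

theorem ActsByPi.preservesGrading : PreservesGrading ρ (grading n i j) := by
  have key : ∀ (F : Module.End ℂ (AMinus n i j)) (c : ℕ × ℕ → ℂ) (φ : ℕ × ℕ → ℕ × ℕ),
      (∀ m, F (basis n i j m) = c m • basis n i j (φ m)) →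
      (∀ m, (φ m).1 + (φ m).2 = m.1 + m.2) → ∀ d, ∀ a ∈ grading n i j d,
        F a ∈ grading n i j d := by
    intro F c φ hF hφ d a ha
    rw [(isGrading n i j).eq_span] at ha ⊢
    refine (Submodule.span_le (p := (Submodule.span ℂ _).comap F)).mpr ?_ ha
    rintro _ ⟨m, hm, rfl⟩
    rw [SetLike.mem_coe, Submodule.mem_comap, hF]
    refine Submodule.smul_mem _ _ (Submodule.subset_span ⟨_, ?_, rfl⟩)
    simpa [hφ] using! hm
  intro h d
  induction h using H.induction with
  | hadd a b ha hb =>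
    intro f hf
    rw [map_add]
    exact add_mem (ha f hf) (hb f hf)
  | hmul a b ha hb =>
    intro f hf
    rw [map_mul]
    exact ha _ (hb f hf)
  | hc c =>
    intro f hf
    rw [AlgHom.commutes]
    exact Submodule.smul_mem _ _ hf
  | hx => exact key _ _ id (ActsByPi.act_x hρ) (fun _ => rfl) d
  | hy => exact key _ _ id (ActsByPi.act_y hρ) (fun _ => rfl) d
  | hz => exact key _ _ Prod.swap (ActsByPi.act_z hρ) (fun m => add_comm _ _) d

end AMinus
end Pansera

/-! ### Faithfulness of the action -/

namespace Pansera

open HopfAction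

theorem exists_weights {n : ℕ} [NeZero n] {i j : ℤ} (hij : Int.gcd (i ^ 2 - j ^ 2) n = 1)
    (r s : ℤ) : ∃ m : ℕ × ℕ, m.1 ≠ m.2 ∧ (n : ℤ) ∣ weight i j m - r ∧
      (n : ℤ) ∣ weight j i m - s := by
  have hn : (n : ℤ) ≠ 0 := Nat.cast_ne_zero.mpr (NeZero.ne n)
  have hbez := Int.gcd_eq_gcd_ab (i ^ 2 - j ^ 2) n
  rw [hij] at hbez
  set x := Int.gcdA (i ^ 2 - j ^ 2) n
  set y := Int.gcdB (i ^ 2 - j ^ 2) n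
  -- Cramer's rule for `i a + j b ≡ r`, `j a + i b ≡ s`, where `x` is an inverse of the determinant
  -- `i² - j²` modulo `n`.
  obtain ⟨a, ha⟩ := Int.eq_ofNat_of_zero_le (Int.emod_nonneg (x * (i * r - j * s)) hn)
  obtain ⟨b, hb⟩ := Int.eq_ofNat_of_zero_le (Int.emod_nonneg (x * (i * s - j * r)) hn)
  have ha' := Int.mul_ediv_add_emod (x * (i * r - j * s)) n
  have hb' := Int.mul_ediv_add_emod (x * (i * s - j * r)) n
  have hlt := Int.emod_lt_of_pos (x * (i * r - j * s)) (by lia : (0 : ℤ) < n)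
  rw [ha] at ha' hlt
  rw [hb] at hb'
  set a' := x * (i * r - j * s) / n
  set b' := x * (i * s - j * r) / n
  push_cast at hbez
  -- As `a < n`, adding `n` to the second exponent makes the two exponents different without
  -- changing the residues.
  refine ⟨(a, b + n), by dsimp only; lia, ⟨-(y * r) - i * a' - j * b' + j, ?_⟩,
    ⟨-(y * s) - j * a' - i * b' + i, ?_⟩⟩ <;> simp only [weight] <;> push_cast
  · linear_combination i * ha' + j * hb' - r * hbez
  · linear_combination j * ha' + i * hb' - s * hbez

namespace AMinus

variable {n : ℕ} [NeZero n] {i j : ℤ} {ρ : ModuleAlgebra ℂ (H n) (AMinus n i j)} (hρ : ActsByPi ρ)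
include hρ

theorem ActsByPi.act_idemXY (r s : ℕ) (m : ℕ × ℕ) : ρ.act (H.idemXY n r s) (basis n i j m) =
    (idem n (q n ^ weight i j m) r * idem n (q n ^ weight j i m) s) • basis n i j m := by
  rw [H.idemXY, map_mul, map_idem, map_idem, Module.End.mul_apply,
    idem_apply (ActsByPi.act_y hρ m), map_smul, idem_apply (ActsByPi.act_x hρ m), smul_smul,
    mul_comm]

/-- It suffices to kill each `e_{r,s} h = c e_{r,s} + d e_{r,s} z`. For a monomial `m` of weights
`(r, s)` with unequal exponents, `m` and `m.swap` are distinct basis vectors exchanged by `z` up to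
scalars: the value at `m` gives `c = 0`, then the value at `m.swap` gives `d = 0`. -/
theorem ActsByPi.eq_zero_of_act_eq_zero (hij : Int.gcd (i ^ 2 - j ^ 2) n = 1) {h : H n}
    (hh : ρ.act h = 0) : h = 0 := by
  have key : ∀ r s, H.idemXY n r s * h = 0 := by
    intro r s
    obtain ⟨c, d, hcd⟩ := H.exists_idemXY_mul h r s
    obtain ⟨m, hm, hr, hs⟩ := exists_weights hij r s
    have hE : ρ.act (H.idemXY n r s) (basis n i j m) = basis n i j m := by
      rw [← q_zpow_eq_iff, zpow_natCast] at hr hs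
      rw [ActsByPi.act_idemXY hρ, hr, hs, idem_q_pow, idem_q_pow, one_mul, one_smul]
    have hact : ∀ a, c • ρ.act (H.idemXY n r s) a +
        d • ρ.act (H.idemXY n r s) (ρ.act (H.z n) a) = 0 := by
      intro a
      have := congrArg (ρ.act · a) hcd
      simp only [map_mul, hh, mul_zero, map_add, map_smul, LinearMap.zero_apply,
        LinearMap.add_apply, LinearMap.smul_apply, Module.End.mul_apply] at this
      exact this.symm
    have hm' : m.swap ≠ m := fun h' => hm (congrArg Prod.snd h')
    have hc : c = 0 := by
      have := congrArg (fun a => (basis n i j).repr a m) (hact (basis n i j m))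
      simpa [hE, ActsByPi.act_z hρ, ActsByPi.act_idemXY hρ, Finsupp.single_apply, hm'] using this
    have hd : d = 0 := by
      have := hact (basis n i j m.swap)
      rw [hc, zero_smul, zero_add, ActsByPi.act_z hρ, map_smul, Prod.swap_swap, hE, smul_smul,
        smul_eq_zero] at this
      simpa [zpow_ne_zero _ (p_ne_zero n), (basis n i j).ne_zero] using this
    rw [hcd, hc, hd, zero_smul, zero_smul, add_zero]
  rw [← one_mul h, ← H.sum_idemXY, Finset.sum_mul]
  refine Finset.sum_eq_zero fun r _ => ?_
  rw [Finset.sum_mul]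
  exact Finset.sum_eq_zero fun s _ => key r s

theorem ActsByPi.isInnerFaithful (hij : Int.gcd (i ^ 2 - j ^ 2) n = 1) : IsInnerFaithful ρ :=
  fun I _ _ hI => (Submodule.eq_bot_iff I).mpr fun h hh =>
    ActsByPi.eq_zero_of_act_eq_zero hρ hij (LinearMap.ext (hI h hh))

end AMinus
end Pansera

/-! ### The fixed ring as a ring of symmetric polynomials -/

namespace Pansera

open HopfAction

section Scalars

variable (n : ℕ) [NeZero n]

theorem p_pow_self : p n ^ n = (-1) ^ (n + 1) := by
  rw [p, neg_pow, ← Complex.exp_nat_mul, mul_div_cancel₀ _ (Nat.cast_ne_zero.mpr (NeZero.ne n)),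
    Complex.exp_pi_mul_I, pow_succ]

theorem p_zpow_mul_two (k : ℤ) : p n ^ (n * (2 * k)) = 1 := by
  rw [zpow_mul, zpow_natCast, p_pow_self, zpow_mul, zpow_ofNat, ← pow_mul, pow_mul', neg_one_sq,
    one_pow, one_zpow]

theorem p_zpow_mul_self (k : ℤ) : p n ^ (n * (n * k)) = 1 := by
  rw [zpow_mul, zpow_natCast, p_pow_self, zpow_mul, zpow_natCast, ← pow_mul, mul_comm,
    (Nat.even_mul_succ_self n).neg_one_pow, one_zpow]

/-- The sign by which `z` permutes `u ^ n` and `v ^ n`. -/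
def sgn (i j : ℤ) : ℂ := p n ^ (n * (i * j))

variable {n}

theorem sgn_sq (i j : ℤ) : sgn n i j ^ 2 = 1 := by
  rw [sgn, ← zpow_natCast, ← zpow_mul, ← p_zpow_mul_two n (i * j)]
  congr 1
  push_cast
  ring

theorem sgn_mul_self (i j : ℤ) : sgn n i j * sgn n i j = 1 := by rw [← sq, sgn_sq]

theorem sgn_of_odd (hn : Odd n) (i j : ℤ) : sgn n i j = 1 := by
  rw [sgn, zpow_mul, zpow_natCast, p_pow_self, hn.add_one.neg_one_pow, one_zpow]

theorem sgn_of_even (hn : Even n) (i j : ℤ) : sgn n i j = (-1) ^ (i * j) := by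
  rw [sgn, zpow_mul, zpow_natCast, p_pow_self, hn.add_one.neg_one_pow]

theorem p_zpow_zExponent (i j : ℤ) (a b : ℕ) :
    p n ^ zExponent i j (n * a, n * b) = sgn n i j ^ (a + b) := by
  -- The two exponents differ by a multiple of `2 n` plus a multiple of `n ^ 2`, and both kinds of
  -- power of `p` are `1`.
  rw [sgn, ← zpow_natCast, ← zpow_mul, ← mul_one (p n ^ (n * (i * j) * _)),
    ← p_zpow_mul_two n (-(i * j * b)), ← zpow_add₀ (p_ne_zero n), ← mul_one (p n ^ (_ + _)),
    ← p_zpow_mul_self n (i * j * (a ^ 2 + b ^ 2) + (i ^ 2 + j ^ 2) * (a * b)),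
    ← zpow_add₀ (p_ne_zero n)]
  congr 1
  simp only [zExponent]
  push_cast
  ring

end Scalars

namespace AMinus

open MvPolynomial

section Hom

variable (n : ℕ) (i j : ℤ)

/-- The linear map underlying `polyHom`. -/
def polyLin : MvPolynomial (Fin 2) ℂ →ₗ[ℂ] AMinus n i j :=
  (basisMonomials (Fin 2) ℂ).constr ℂ fun m =>
    sgn n i j ^ m 1 • basis n i j (n * m 0, n * m 1)

theorem polyLin_monomial (m : Fin 2 →₀ ℕ) : polyLin n i j (monomial m 1) =
    sgn n i j ^ m 1 • basis n i j (n * m 0, n * m 1) := by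
  exact (congrArg _ (congrFun (coe_basisMonomials ..) m)).symm.trans
    ((basisMonomials (Fin 2) ℂ).constr_basis ℂ _ _)

variable [NeZero n]

/-- Reordering costs a power of `p` with exponent divisible by `n ^ 2`, which is `1`; hence `u ^ n`
and `v ^ n` commute. -/
theorem basis_mul_of_dvd (a b c d : ℕ) :
    basis n i j (n * a, n * b) * basis n i j (n * c, n * d) =
      basis n i j (n * (a + c), n * (b + d)) := by
  have h : (i ^ 2 - j ^ 2) * ((n * b : ℕ) * (n * c : ℕ) : ℤ) =
      n * (n * ((i ^ 2 - j ^ 2) * (b * c))) := by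
    push_cast
    ring
  rw [basis_mul, mul_add, mul_add, h, p_zpow_mul_self, one_smul]

/-- The algebra homomorphism with `X 0 ↦ u ^ n` and `X 1 ↦ ± v ^ n`. -/
def polyHom : MvPolynomial (Fin 2) ℂ →ₐ[ℂ] AMinus n i j :=
  AlgHom.ofLinearMap (polyLin n i j)
    (by
      change polyLin n i j (monomial 0 1) = 1
      rw [polyLin_monomial]
      simp [basis_zero_zero])
    (by
      have h : (LinearMap.mul ℂ (MvPolynomial (Fin 2) ℂ)).compr₂ (polyLin n i j) =
          (LinearMap.mul ℂ (AMinus n i j)).compl₁₂ (polyLin n i j) (polyLin n i j) := by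
        refine (basisMonomials (Fin 2) ℂ).ext fun m => (basisMonomials (Fin 2) ℂ).ext fun m' => ?_
        simp [polyLin_monomial, monomial_mul, smul_smul, basis_mul_of_dvd, pow_add, mul_comm]
      exact fun f g => LinearMap.congr_fun₂ h f g)

theorem polyHom_monomial (m : Fin 2 →₀ ℕ) : polyHom n i j (monomial m 1) =
    sgn n i j ^ m 1 • basis n i j (n * m 0, n * m 1) := polyLin_monomial n i j m

theorem polyHom_X_zero : polyHom n i j (X 0) = u n i j ^ n := by
  have := polyHom_monomial n i j (Finsupp.single 0 1)
  rw [← X, (quantumPlane n i j).basis_apply] at this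
  simpa using! this

theorem polyHom_X_one : polyHom n i j (X 1) = sgn n i j • v n i j ^ n := by
  have := polyHom_monomial n i j (Finsupp.single 1 1)
  rw [← X, (quantumPlane n i j).basis_apply] at this
  simpa using! this

theorem repr_polyHom (f : MvPolynomial (Fin 2) ℂ) (m : Fin 2 →₀ ℕ) :
    (basis n i j).repr (polyHom n i j f) (n * m 0, n * m 1) = sgn n i j ^ m 1 * f.coeff m := by
  have h : Finsupp.lapply (n * m 0, n * m 1) ∘ₗ (basis n i j).repr.toLinearMap ∘ₗ
      (polyHom n i j).toLinearMap = sgn n i j ^ m 1 • lcoeff ℂ m := by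
    refine (basisMonomials (Fin 2) ℂ).ext fun m' => ?_
    have hm : (n * m' 0, n * m' 1) = (n * m 0, n * m 1) ↔ m' = m := by
      simp [NeZero.ne n, Finsupp.ext_iff]
    by_cases h' : m' = m
    · subst h'
      simp [polyHom_monomial]
    · simp [polyHom_monomial, coeff_monomial, h', hm]
  exact LinearMap.congr_fun h f

theorem polyHom_injective : Function.Injective (polyHom n i j) := by
  refine (injective_iff_map_eq_zero _).mpr fun f hf => ?_
  ext m
  have := repr_polyHom n i j f m
  rw [hf, map_zero, Finsupp.zero_apply] at this
  have h1 : sgn n i j ^ m 1 ≠ 0 := pow_ne_zero _ fun h => by simpa [h] using sgn_sq (n := n) i j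
  simpa [h1] using this.symm

theorem basis_mem_range_polyHom (a b : ℕ) :
    basis n i j (n * a, n * b) ∈ (polyHom n i j).range := by
  let m : Fin 2 →₀ ℕ := Finsupp.single 0 a + Finsupp.single 1 b
  refine ⟨sgn n i j ^ b • monomial m 1, ?_⟩
  change polyHom n i j _ = _
  rw [map_smul, polyHom_monomial, smul_smul]
  simp [m, ← mul_pow, sgn_mul_self]

end Hom

variable {n : ℕ} [NeZero n] {i j : ℤ} {ρ : ModuleAlgebra ℂ (H n) (AMinus n i j)}

theorem mem_fixedRing_iff (f : AMinus n i j) : f ∈ fixedRing ρ ↔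
    ρ.act (H.x n) f = f ∧ ρ.act (H.y n) f = f ∧ ρ.act (H.z n) f = f := by
  constructor
  · intro h
    refine ⟨(h (H.x n)).trans ?_, (h (H.y n)).trans ?_, (h (H.z n)).trans ?_⟩ <;>
      simp [H.counit_apply, H.counitHom_x, H.counitHom_y, H.counitHom_z]
  · rintro ⟨hx, hy, hz⟩ h
    rw [H.counit_apply]
    induction h using H.induction with
    | hadd a b ha hb => rw [map_add, map_add, LinearMap.add_apply, ha, hb, add_smul]
    | hmul a b ha hb =>
      rw [map_mul, map_mul, Module.End.mul_apply, hb, map_smul, ha, smul_smul, mul_comm]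
    | hc c => simp
    | hx => rw [hx, H.counitHom_x, one_smul]
    | hy => rw [hy, H.counitHom_y, one_smul]
    | hz => rw [hz, H.counitHom_z, one_smul]

variable (hρ : ActsByPi ρ)
include hρ

theorem ActsByPi.act_x_polyHom (f : MvPolynomial (Fin 2) ℂ) :
    ρ.act (H.x n) (polyHom n i j f) = polyHom n i j f := by
  have h : ρ.act (H.x n) ∘ₗ (polyHom n i j).toLinearMap = (polyHom n i j).toLinearMap := by
    refine (basisMonomials (Fin 2) ℂ).ext fun m => ?_
    have hq : q n ^ weight i j (n * m 0, n * m 1) = 1 := by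
      rw [← zpow_zero (q n), q_zpow_eq_iff]
      exact ⟨i * m 0 + j * m 1, by simp only [weight]; push_cast; ring⟩
    simp [polyHom_monomial, ActsByPi.act_x hρ, hq]
  exact LinearMap.congr_fun h f

theorem ActsByPi.act_y_polyHom (f : MvPolynomial (Fin 2) ℂ) :
    ρ.act (H.y n) (polyHom n i j f) = polyHom n i j f := by
  have h : ρ.act (H.y n) ∘ₗ (polyHom n i j).toLinearMap = (polyHom n i j).toLinearMap := by
    refine (basisMonomials (Fin 2) ℂ).ext fun m => ?_
    have hq : q n ^ weight j i (n * m 0, n * m 1) = 1 := by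
      rw [← zpow_zero (q n), q_zpow_eq_iff]
      exact ⟨j * m 0 + i * m 1, by simp only [weight]; push_cast; ring⟩
    simp [polyHom_monomial, ActsByPi.act_y hρ, hq]
  exact LinearMap.congr_fun h f

/-- The sign built into the image of `X 1` is chosen so that `z` becomes the plain interchange of
variables; otherwise it would carry the factor `sgn ^ (a + b)`. -/
theorem ActsByPi.act_z_polyHom (f : MvPolynomial (Fin 2) ℂ) :
    ρ.act (H.z n) (polyHom n i j f) = polyHom n i j (rename (Equiv.swap 0 1) f) := by
  have h : ρ.act (H.z n) ∘ₗ (polyHom n i j).toLinearMap =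
      (polyHom n i j).toLinearMap ∘ₗ (rename (R := ℂ) (Equiv.swap (0 : Fin 2) 1)).toLinearMap := by
    refine (basisMonomials (Fin 2) ℂ).ext fun m => ?_
    have h0 : Finsupp.mapDomain (Equiv.swap (0 : Fin 2) 1) m 0 = m 1 := by
      have := Finsupp.mapDomain_apply (Equiv.swap (0 : Fin 2) 1).injective m 1
      rwa [Equiv.swap_apply_right] at this
    have h1 : Finsupp.mapDomain (Equiv.swap (0 : Fin 2) 1) m 1 = m 0 := by
      have := Finsupp.mapDomain_apply (Equiv.swap (0 : Fin 2) 1).injective m 0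
      rwa [Equiv.swap_apply_left] at this
    have hs : sgn n i j ^ m 1 * sgn n i j ^ (m 0 + m 1) = sgn n i j ^ m 0 := by
      rw [← pow_add, show m 1 + (m 0 + m 1) = m 0 + 2 * m 1 by ring, pow_add, pow_mul, sgn_sq,
        one_pow, mul_one]
    simp [polyHom_monomial, ActsByPi.act_z hρ, p_zpow_zExponent, smul_smul, rename_monomial, h0, h1,
      hs]
  exact LinearMap.congr_fun h f

theorem ActsByPi.mem_range_polyHom (hij : Int.gcd (i ^ 2 - j ^ 2) n = 1) {f : AMinus n i j}
    (hx : ρ.act (H.x n) f = f) (hy : ρ.act (H.y n) f = f) : f ∈ (polyHom n i j).range := by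
  have key : ∀ (F : Module.End ℂ (AMinus n i j)) (w : ℕ × ℕ → ℤ),
      (∀ m, F (basis n i j m) = q n ^ w m • basis n i j m) → F f = f →
        ∀ m, (basis n i j).repr f m ≠ 0 → (n : ℤ) ∣ w m := by
    intro F w hF hf m hm
    have h : Finsupp.lapply m ∘ₗ (basis n i j).repr.toLinearMap ∘ₗ F =
        q n ^ w m • (Finsupp.lapply m ∘ₗ (basis n i j).repr.toLinearMap) := by
      refine (basis n i j).ext fun m' => ?_
      by_cases h' : m' = m
      · subst h'
        simp [hF]
      · simp [hF, h']
    have h1 := LinearMap.congr_fun h f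
    simp only [LinearMap.comp_apply, hf, LinearMap.smul_apply, smul_eq_mul, Finsupp.lapply_apply,
      LinearEquiv.coe_coe] at h1
    have h2 : q n ^ w m = q n ^ (0 : ℤ) := by
      rw [zpow_zero]
      exact mul_right_cancel₀ hm (h1.symm.trans (one_mul _).symm)
    rwa [q_zpow_eq_iff, sub_zero] at h2
  -- Eliminating one exponent from the two weights leaves `(i² - j²) a` and `(i² - j²) b`, from
  -- which the factor prime to `n` can be removed.
  have hcop : IsCoprime (n : ℤ) (i ^ 2 - j ^ 2) := (Int.isCoprime_iff_gcd_eq_one.mpr hij).symm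
  rw [← (basis n i j).linearCombination_repr f, Finsupp.linearCombination_apply, Finsupp.sum]
  refine sum_mem fun m hm => Subalgebra.smul_mem _ ?_ _
  rw [Finsupp.mem_support_iff] at hm
  have hwx := key _ _ (ActsByPi.act_x hρ) hx m hm
  have hwy := key _ _ (ActsByPi.act_y hρ) hy m hm
  obtain ⟨a, b⟩ := m
  simp only [weight] at hwx hwy
  have ha : (n : ℤ) ∣ a := hcop.dvd_of_dvd_mul_left (by
    convert dvd_sub (hwx.mul_left i) (hwy.mul_left j) using 1
    ring)
  have hb : (n : ℤ) ∣ b := hcop.dvd_of_dvd_mul_left (by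
    convert dvd_sub (hwy.mul_left i) (hwx.mul_left j) using 1
    ring)
  obtain ⟨a, rfl⟩ := Int.natCast_dvd_natCast.mp ha
  obtain ⟨b, rfl⟩ := Int.natCast_dvd_natCast.mp hb
  exact basis_mem_range_polyHom n i j a b

/-- Invariance under `x` and `y` restricts to the image of `polyHom`. There invariance under `z` is
invariance under the only nontrivial permutation of the two variables. -/
theorem ActsByPi.fixedRing_eq_map (hij : Int.gcd (i ^ 2 - j ^ 2) n = 1) :
    fixedRing ρ = (symmetricSubalgebra (Fin 2) ℂ).map (polyHom n i j) := by
  ext f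
  rw [mem_fixedRing_iff, Subalgebra.mem_map]
  constructor
  · rintro ⟨hx, hy, hz⟩
    obtain ⟨g, rfl⟩ := ActsByPi.mem_range_polyHom hρ hij hx hy
    refine ⟨g, fun e => ?_, rfl⟩
    rcases (by decide +revert : e = 1 ∨ e = Equiv.swap 0 1) with rfl | rfl
    · simp
    · exact polyHom_injective n i j ((ActsByPi.act_z_polyHom hρ g).symm.trans hz)
  · rintro ⟨g, hg, rfl⟩
    refine ⟨ActsByPi.act_x_polyHom hρ g, ActsByPi.act_y_polyHom hρ g, ?_⟩
    exact (ActsByPi.act_z_polyHom hρ g).trans (congrArg _ (hg _))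

end AMinus
end Pansera

/-! ### Polynomial rings in two variables as quantum planes -/

section PolynomialRing

open MvPolynomial

variable {k : Type v} {A : Type u} [Field k] [Ring A] [Algebra k A]

/-- A polynomial ring in two variables is a quantum plane. -/
def QuantumPlane.ofAlgEquiv (e : MvPolynomial (Fin 2) k ≃ₐ[k] A) : QuantumPlane k A where
  s := e (X 0)
  t := e (X 1)
  μ := 1
  basis := ((basisMonomials (Fin 2) k).map e.toLinearEquiv).reindex
    (Finsupp.equivFunOnFinite.trans (finTwoArrowEquiv ℕ))
  basis_apply a b := by
    simp [← map_pow, ← map_mul, monomial_eq, Fin.prod_univ_two]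
  μ_ne_zero := one_ne_zero
  t_mul_s := by rw [one_smul, ← map_mul, ← map_mul, mul_comm]

theorem HopfAction.isPolynomialRingIn_of_algEquiv {B : Subalgebra k A}
    (e : MvPolynomial (Fin 2) k ≃ₐ[k] B) {a b : A} (ha : (e (X 0) : A) = a)
    (hb : (e (X 1) : A) = b) : IsPolynomialRingIn B a b := by
  refine ⟨?_, e, ha, hb⟩
  have h1 : (B.val.comp (e : MvPolynomial (Fin 2) k →ₐ[k] B)).range = B := by
    rw [AlgHom.range_comp, (AlgHom.range_eq_top _).mpr e.surjective, Algebra.map_top,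
      Subalgebra.range_val]
  rw [← h1, ← Algebra.map_top, ← adjoin_range_X, AlgHom.map_adjoin, ← Set.range_comp,
    show Set.range (_ ∘ X) = {a, b} from ?_]
  rw [← ha, ← hb]
  ext x
  simp [Fin.exists_fin_two, eq_comm]

theorem HopfAction.inducedGrading_gradedMonoid (B : Subalgebra k A) {𝒜 : ℕ → Submodule k A}
    (h : SetLike.GradedMonoid 𝒜) : SetLike.GradedMonoid (inducedGrading B 𝒜) where
  one_mem := h.one_mem
  mul_mem _ _ _ _ ha hb := h.mul_mem ha hb

/-- Independence passes to a subalgebra because the inclusion is injective. It is all that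
`IsGrading` asks; that the pieces span then follows from homogeneity of the generators. -/
theorem HopfAction.inducedGrading_iSupIndep (B : Subalgebra k A) {𝒜 : ℕ → Submodule k A}
    (h : iSupIndep 𝒜) : iSupIndep (inducedGrading B 𝒜) := by
  intro m
  rw [Submodule.disjoint_def]
  intro b hb hb'
  have hle : ⨆ m', ⨆ _ : m' ≠ m, inducedGrading B 𝒜 m' ≤
      (⨆ m', ⨆ _ : m' ≠ m, 𝒜 m').comap B.val.toLinearMap :=
    iSup₂_le fun m' hm' => Submodule.comap_mono (le_iSup₂_of_le m' hm' le_rfl)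
  exact Subtype.ext (Submodule.disjoint_def.mp (h m) b hb (hle hb'))

/-- Scaling the second variable by a sign. -/
def scaleEquiv {c : k} (hc : c * c = 1) : MvPolynomial (Fin 2) k ≃ₐ[k] MvPolynomial (Fin 2) k :=
  AlgEquiv.ofAlgHom (aeval ![X 0, c • X 1]) (aeval ![X 0, c • X 1])
    (by ext i : 1; fin_cases i <;> simp [smul_smul, hc])
    (by ext i : 1; fin_cases i <;> simp [smul_smul, hc])

theorem scaleEquiv_X_zero {c : k} (hc : c * c = 1) : scaleEquiv hc (X 0) = X 0 := by
  simp [scaleEquiv]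

theorem scaleEquiv_X_one {c : k} (hc : c * c = 1) : scaleEquiv hc (X 1) = c • X 1 := by
  simp [scaleEquiv]

theorem esymm_fin_two : esymm (Fin 2) k 2 = X 0 * X 1 := by
  have h : Finset.powersetCard 2 (Finset.univ : Finset (Fin 2)) = {Finset.univ} := by decide
  rw [esymm, h, Finset.sum_singleton, Fin.prod_univ_two]

end PolynomialRing

/-! ### Generators and regularity of the fixed ring -/

namespace Pansera

open HopfAction MvPolynomial

namespace AMinus

variable {n : ℕ} [NeZero n] {i j : ℤ} {ρ : ModuleAlgebra ℂ (H n) (AMinus n i j)} (hρ : ActsByPi ρ)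
  (hij : Int.gcd (i ^ 2 - j ^ 2) n = 1)

/-- The fixed ring as a polynomial ring. -/
def ActsByPi.fixedRingEquiv : MvPolynomial (Fin 2) ℂ ≃ₐ[ℂ] fixedRing ρ :=
  (scaleEquiv (sgn_mul_self (n := n) i j)).trans
    ((esymmAlgEquiv (Fin 2) ℂ (Fintype.card_fin 2)).trans
      (((symmetricSubalgebra (Fin 2) ℂ).equivMapOfInjective (polyHom n i j)
        (polyHom_injective n i j)).trans
        (Subalgebra.equivOfEq _ _ (ActsByPi.fixedRing_eq_map hρ hij).symm)))

theorem ActsByPi.fixedRingEquiv_X_zero : (ActsByPi.fixedRingEquiv hρ hij (X 0) : AMinus n i j) =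
    u n i j ^ n + sgn n i j • v n i j ^ n := by
  change polyHom n i j (esymmAlgEquiv (Fin 2) ℂ (Fintype.card_fin 2) (scaleEquiv (sgn_mul_self i j) (X 0))).val = _
  rw [scaleEquiv_X_zero]
  refine (congrArg _ (esymmAlgHom_apply _)).trans ?_
  simp [polyHom_X_zero, polyHom_X_one, Fin.sum_univ_two]

theorem ActsByPi.fixedRingEquiv_X_one : (ActsByPi.fixedRingEquiv hρ hij (X 1) : AMinus n i j) =
    u n i j ^ n * v n i j ^ n := by
  change polyHom n i j (esymmAlgEquiv (Fin 2) ℂ (Fintype.card_fin 2) (scaleEquiv (sgn_mul_self i j) (X 1))).val = _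
  rw [scaleEquiv_X_one]
  -- The second elementary symmetric polynomial maps to `sgn • (u ^ n * v ^ n)`; the sign from
  -- `scaleEquiv` cancels this factor, since its square is `1`.
  refine (congrArg _ (esymmAlgHom_apply _)).trans ?_
  rw [map_smul, aeval_X, map_smul, Fin.val_one, esymm_fin_two, map_mul, polyHom_X_zero,
    polyHom_X_one, mul_smul_comm, smul_smul, sgn_mul_self, one_smul]

include hρ hij

theorem ActsByPi.isPolynomialRingIn_fixedRing : IsPolynomialRingIn (fixedRing ρ)
    (u n i j ^ n + sgn n i j • v n i j ^ n) (u n i j ^ n * v n i j ^ n) :=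
  isPolynomialRingIn_of_algEquiv _ (ActsByPi.fixedRingEquiv_X_zero hρ hij)
    (ActsByPi.fixedRingEquiv_X_one hρ hij)

theorem ActsByPi.isGrading_fixedRing :
    (QuantumPlane.ofAlgEquiv (ActsByPi.fixedRingEquiv hρ hij)).IsGrading
      (inducedGrading (fixedRing ρ) (grading n i j)) n (2 * n) where
  gradedMonoid := inducedGrading_gradedMonoid _ (isGrading n i j).gradedMonoid
  iSupIndep := inducedGrading_iSupIndep _ (isGrading n i j).iSupIndep
  s_mem := by
    change (ActsByPi.fixedRingEquiv hρ hij (X 0) : AMinus n i j) ∈ grading n i j n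
    rw [ActsByPi.fixedRingEquiv_X_zero]
    have hu := (isGrading n i j).basis_mem (n, 0)
    have hv := (isGrading n i j).basis_mem (0, n)
    rw [(quantumPlane n i j).basis_apply] at hu hv
    refine add_mem ?_ (Submodule.smul_mem _ _ ?_)
    · simpa using! hu
    · simpa using! hv
  t_mem := by
    change (ActsByPi.fixedRingEquiv hρ hij (X 1) : AMinus n i j) ∈ grading n i j (2 * n)
    rw [ActsByPi.fixedRingEquiv_X_one]
    have h := (isGrading n i j).basis_mem (n, n)
    rw [(quantumPlane n i j).basis_apply] at h
    simpa [two_mul] using! h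
  d_pos := NeZero.pos n
  e_pos := Nat.mul_pos two_pos (NeZero.pos n)

theorem ActsByPi.isReflectionHopfAlgebra : IsReflectionHopfAlgebra ρ (grading n i j) where
  finite := inferInstance
  semisimple := inferInstance
  regular := ⟨2, (isGrading n i j).isASRegular⟩
  preservesGrading := ActsByPi.preservesGrading hρ
  innerFaithful := ActsByPi.isInnerFaithful hρ hij
  fixedRing_regular := ⟨2, (ActsByPi.isGrading_fixedRing hρ hij).isASRegular⟩

end AMinus
end Pansera

end

open Pansera HopfAction ASRegular in
theorem mainTheorem1 (n : ℕ) [NeZero n] (hn : 2 ≤ n) (i j : ℤ)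
    (hij : Int.gcd (i ^ 2 - j ^ 2) n = 1) :
    IsASRegular (AMinus.grading n i j) 2 ∧
    (∃! ρ : ModuleAlgebra ℂ (H n) (AMinus n i j), ActsByPi ρ) ∧
    ∀ ρ : ModuleAlgebra ℂ (H n) (AMinus n i j), ActsByPi ρ →
      (Odd n → IsPolynomialRingIn (fixedRing ρ)
        (AMinus.u n i j ^ n + AMinus.v n i j ^ n) (AMinus.u n i j ^ n * AMinus.v n i j ^ n)) ∧
      (Even n → IsPolynomialRingIn (fixedRing ρ)
        (AMinus.u n i j ^ n + (-1 : ℂ) ^ (i * j) • AMinus.v n i j ^ n)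
        (AMinus.u n i j ^ n * AMinus.v n i j ^ n)) ∧
      IsReflectionHopfAlgebra ρ (AMinus.grading n i j) := by
  refine ⟨(AMinus.isGrading n i j).isASRegular, ⟨AMinus.moduleAlgebra n i j,
    AMinus.actsByPi_moduleAlgebra n i j, fun ρ hρ => AMinus.ActsByPi.eq_moduleAlgebra hρ⟩,
    fun ρ hρ => ⟨fun hodd => ?_, fun heven => ?_,
      AMinus.ActsByPi.isReflectionHopfAlgebra hρ hij⟩⟩
  · simpa only [sgn_of_odd hodd, one_smul] using
      AMinus.ActsByPi.isPolynomialRingIn_fixedRing hρ hij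
  · simpa only [sgn_of_even heven] using AMinus.ActsByPi.isPolynomialRingIn_fixedRing hρ hij
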